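/- Let $\xi_\pm$ be smooth Euclidean vector bundles of positive rank over connected smooth manifolds $M_\pm$ (Hausdorff, second countable, without boundary), with total spaces of the same dimension $n$. Let $E_\pm=\{v\in\xi_\pm:|v|\le 1\}$ be their unit disk bundles, with boundaries $\partial E_\pm=\{|v|=1\}$. For a diffeomorphism $\varphi:\partial E_+\to\partial E_-$ let $E_\varphi=E_+\cup_\varphi E_-$ be the smooth $n$-manifold obtained by identifying each $x\in\partial E_+$ with $\varphi(x)\in\partial E_-$, with the smooth structure defined by the radial collars of $\partial E_\pm$ in $E_\pm$, and let $\mathcal F_\varphi$ be the foliation of $E_\varphi$ whose leaves are the concentric tubes $\{|v|=t\}$, $0\le t\le 1$, in $E_+$ and in $E_-$ (for $t=0$, the zero sections). Write $E_\varphi\cong E_\psi$ if the manifolds are diffeomorphic, and $(E_\varphi,\mathcal F_\varphi)\cong(E_\psi,\mathcal F_\psi)$ if there is a diffeomorphism $E_\varphi\to E_\psi$ mapping leaves to leaves. For a disk bundle $E$ among $E_\pm$, let $\mathrm{Diff}_E(\partial E)$ be the group of diffeomorphisms of $\partial E$ that extend to a diffeomorphism of $E$, and let $\mathrm{Isom}_b(\partial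 E)\subseteq\mathrm{Diff}_E(\partial E)$ be the subgroup of restrictions to $\partial E$ of vector bundle isomorphisms (covering diffeomorphisms of the base) that preserve the Euclidean metric. For such a group $G$ let $\pi_0(G)$ be its set of path components, i.e. of classes modulo smooth isotopy through elements of $G$. Write $\pi_0(\mathrm{Isom}_b(\partial E))\subsetneqq\pi_0(\mathrm{Diff}_E(\partial E))$ if the map on $\pi_0$ induced by the inclusion is not surjective, and write $[\varphi]\in\pi_0(\mathrm{Isom}_b(\partial E))$ if the class of $\varphi$ in $\pi_0(\mathrm{Diff}_E(\partial E))$ lies in the image of this map. Then: (1) Let $\varphi_0:\partial E_+\to\partial E_-$ be a diffeomorphism. If there are $h_\pm\in\mathrm{Diff}_{E_\pm}(\partial E_\pm)$ such that $(E_{h_-\circ\varphi_0\circ h_+^{-1}},\mathcal F_{h_-\circ\varphi_0\circ h_+^{-1}})\not\cong(E_{\varphi_0},\mathcal F_{\varphi_0})$, then $\pi_0(\mathrm{Isom}_b(\partial E_+))\subsetneqq\pi_0(\mathrm{Diff}_{E_+}(\partial E_+))$ or $\pi_0(\mathrm{Isom}_b(\partial E_-))\subsetneqq\pi_0(\mathrm{Diff}_{E_-}(\partial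 E_-))$. (2) Suppose $E_+=E_-$ and $\pi_0(\mathrm{Isom}_b(\partial E_+))\subsetneqq\pi_0(\mathrm{Diff}_{E_+}(\partial E_+))$. Then for all $\varphi_0,\varphi_1\in\mathrm{Diff}_{E_+}(\partial E_+)$ with $[\varphi_0]\in\pi_0(\mathrm{Isom}_b(\partial E_+))$ and $[\varphi_1]\notin\pi_0(\mathrm{Isom}_b(\partial E_+))$ we have $E_{\varphi_0}\cong E_{\varphi_1}$ but $(E_{\varphi_0},\mathcal F_{\varphi_0})\not\cong(E_{\varphi_1},\mathcal F_{\varphi_1})$. -/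

import Mathlib

open Set Bundle Topology Manifold
open scoped ContDiff

set_option linter.unusedSectionVars false

local notation "𝔼[" n "]" => EuclideanSpace ℝ (Fin n)
local notation "𝓑[" d "," m "]" => ModelWithCorners.prod (𝓡 d) 𝓘(ℝ, EuclideanSpace ℝ (Fin m))

noncomputable section

section SetDiffeo
variable {E₁ : Type*} [NormedAddCommGroup E₁] [NormedSpace ℝ E₁] {H₁ : Type*} [TopologicalSpace H₁]
  (I₁ : ModelWithCorners ℝ E₁ H₁) {W₁ : Type*} [TopologicalSpace W₁] [ChartedSpace H₁ W₁]
  {E₂ : Type*} [NormedAddCommGroup E₂] [NormedSpace ℝ E₂] {H₂ : Type*} [TopologicalSpace H₂]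
  (I₂ : ModelWithCorners ℝ E₂ H₂) {W₂ : Type*} [TopologicalSpace W₂] [ChartedSpace H₂ W₂]
  {E₃ : Type*} [NormedAddCommGroup E₃] [NormedSpace ℝ E₃] {H₃ : Type*} [TopologicalSpace H₃]
  (I₃ : ModelWithCorners ℝ E₃ H₃) {W₃ : Type*} [TopologicalSpace W₃] [ChartedSpace H₃ W₃]

/-- A map between subsets of manifolds is smooth if it is the restriction of a map of the ambient
manifolds that is smooth on the source subset. For a smooth submanifold, with or without boundary,
this is smoothness for the submanifold structure. -/
def SmoothBetween (A : Set W₁) (B : Set W₂) (f : A → B) : Prop :=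
  ∃ g : W₁ → W₂, ContMDiffOn I₁ I₂ ∞ g A ∧ ∀ a : A, g a = f a

/-- Diffeomorphisms from the subset `A` of a manifold to the subset `B` of a manifold. -/
structure SetDiffeo (A : Set W₁) (B : Set W₂) where
  toEquiv : A ≃ B
  smooth_toFun : SmoothBetween I₁ I₂ A B toEquiv
  smooth_invFun : SmoothBetween I₂ I₁ B A toEquiv.symm

variable {I₁ I₂ I₃} {A : Set W₁} {B : Set W₂} {C : Set W₃}

instance : CoeFun (SetDiffeo I₁ I₂ A B) (fun _ => A → B) := ⟨fun f => f.toEquiv⟩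

/-- The inverse diffeomorphism. -/
def SetDiffeo.symm (f : SetDiffeo I₁ I₂ A B) : SetDiffeo I₂ I₁ B A :=
  ⟨f.toEquiv.symm, f.smooth_invFun, f.smooth_toFun⟩

theorem SmoothBetween.comp {g : B → C} {f : A → B} (hg : SmoothBetween I₂ I₃ B C g)
    (hf : SmoothBetween I₁ I₂ A B f) : SmoothBetween I₁ I₃ A C (g ∘ f) := by
  obtain ⟨g', hg', hg⟩ := hg
  obtain ⟨f', hf', hf⟩ := hf
  refine ⟨g' ∘ f', hg'.comp hf' fun a ha => ?_, fun a => ?_⟩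
  · have := hf ⟨a, ha⟩
    simp only at this
    simp [this]
  · simp [hf, hg]

/-- The composition `g ∘ f` of two diffeomorphisms. -/
def SetDiffeo.comp (g : SetDiffeo I₂ I₃ B C) (f : SetDiffeo I₁ I₂ A B) : SetDiffeo I₁ I₃ A C :=
  ⟨f.toEquiv.trans g.toEquiv, g.smooth_toFun.comp f.smooth_toFun,
    f.smooth_invFun.comp g.smooth_invFun⟩

/-- `f` and `g` are smoothly isotopic through elements of the set `G` of diffeomorphisms of `A`. -/
def IsotopicIn (G : Set (SetDiffeo I₁ I₁ A A)) (f g : G) : Prop :=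
  ∃ K : ℝ → SetDiffeo I₁ I₁ A A,
    (∀ t ∈ Icc (0 : ℝ) 1, K t ∈ G) ∧ K 0 = f ∧ K 1 = g ∧
    ∃ k : ℝ × W₁ → W₁, ContMDiffOn (𝓘(ℝ, ℝ).prod I₁) I₁ ∞ k (Icc (0 : ℝ) 1 ×ˢ A) ∧
      ∀ t ∈ Icc (0 : ℝ) 1, ∀ a : A, k (t, a) = K t a

/-- The set `π₀(G)` of path components of a set `G` of diffeomorphisms of `A`, that is, of classes
for the equivalence relation generated by smooth isotopy inside `G`. -/
def PiZero (G : Set (SetDiffeo I₁ I₁ A A)) : Type _ := Quot (IsotopicIn G)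

/-- The class `[f] ∈ π₀(G)` of `f ∈ G`. -/
def PiZero.mk {G : Set (SetDiffeo I₁ I₁ A A)} (f : G) : PiZero G := Quot.mk _ f

/-- The map `π₀(G) → π₀(G')` induced by an inclusion `G ⊆ G'`. -/
def PiZero.map {G G' : Set (SetDiffeo I₁ I₁ A A)} (h : G ⊆ G') : PiZero G → PiZero G' :=
  Quot.map (inclusion h) fun _ _ ⟨K, hK, h0, h1, hk⟩ => ⟨K, fun t ht => h (hK t ht), h0, h1, hk⟩

end SetDiffeo


section OneBundle

variable (d m : ℕ) {M : Type*} [TopologicalSpace M] [ChartedSpace 𝔼[d] M]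
  (V : M → Type*) [∀ x, NormedAddCommGroup (V x)]

/-- The closed unit disk bundle `E` of a Euclidean vector bundle of rank `m` with fibres `V x`,
as a subset of the total space. -/
def diskBundle : Set (TotalSpace 𝔼[m] V) := {v | ‖v.2‖ ≤ 1}

/-- The unit sphere bundle `∂E`, the boundary of the disk bundle `E`. -/
def sphereBundle : Set (TotalSpace 𝔼[m] V) := {v | ‖v.2‖ = 1}

variable {m V} in
/-- The inclusion `∂E → E`. -/
def sphereToDisk (s : sphereBundle m V) : diskBundle m V := ⟨s, le_of_eq s.2⟩

variable [∀ x, InnerProductSpace ℝ (V x)] [TopologicalSpace (TotalSpace 𝔼[m] V)]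
  [FiberBundle 𝔼[m] V]

/-- `Diff(E)`, the diffeomorphisms of the disk bundle `E` (as a manifold with boundary). -/
abbrev DiskDiffeo := SetDiffeo 𝓑[d, m] 𝓑[d, m] (diskBundle m V) (diskBundle m V)

/-- `Diff(∂E)`, the diffeomorphisms of the sphere bundle `∂E`. -/
abbrev SphereDiffeo := SetDiffeo 𝓑[d, m] 𝓑[d, m] (sphereBundle m V) (sphereBundle m V)

/-- `Diff_E(∂E)`, the diffeomorphisms of `∂E` that extend to a diffeomorphism of `E`. -/
def extendableDiffeos : Set (SphereDiffeo d m V) :=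
  {f | ∃ F : DiskDiffeo d m V, ∀ s, F (sphereToDisk s) = sphereToDisk (f s)}

/-- `Isom_b(E)`, the diffeomorphisms `F` of `E` that are restrictions of vector bundle isomorphisms
preserving the Euclidean metric: `F` maps the fibre over `x` to the fibre over some `f x`, by a
linear isometry. Since `F` is a diffeomorphism, so is the map `f` of the base that it covers. -/
def diskBundleIsometries : Set (DiskDiffeo d m V) :=
  {F | ∃ (f : M → M) (L : ∀ x, V x ≃ₗᵢ[ℝ] V (f x)),
    ∀ v : diskBundle m V, (F v : TotalSpace 𝔼[m] V) = ⟨f v.1.1, L v.1.1 v.1.2⟩}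

/-- `Isom_b(∂E)`, the restrictions to `∂E` of the elements of `Isom_b(E)`. -/
def sphereBundleIsometries : Set (SphereDiffeo d m V) :=
  {f | ∃ F ∈ diskBundleIsometries d m V, ∀ s, F (sphereToDisk s) = sphereToDisk (f s)}

theorem sphereBundleIsometries_subset :
    sphereBundleIsometries d m V ⊆ extendableDiffeos d m V :=
  fun _ ⟨F, _, hF⟩ => ⟨F, hF⟩

/-- The map `π₀(Isom_b(∂E)) → π₀(Diff_E(∂E))` induced by the inclusion. -/
def piZeroInclusion :
    PiZero (sphereBundleIsometries d m V) → PiZero (extendableDiffeos d m V) :=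
  PiZero.map (sphereBundleIsometries_subset d m V)

variable {d m V}

variable (d m V) in
/-- `π₀(Isom_b(∂E)) ⊊ π₀(Diff_E(∂E))`: the inclusion `Isom_b(∂E) → Diff_E(∂E)` is not surjective on
path components. -/
def PiZeroStrict : Prop := ¬ Function.Surjective (piZeroInclusion d m V)

/-- Multiplication by a scalar in the fibres. -/
def scale (c : ℝ) (v : TotalSpace 𝔼[m] V) : TotalSpace 𝔼[m] V := ⟨v.1, c • v.2⟩

theorem norm_scale (c : ℝ) (v : TotalSpace 𝔼[m] V) : ‖(scale c v).2‖ = |c| * ‖v.2‖ := by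
  rw [← Real.norm_eq_abs]; exact norm_smul c v.2

theorem scale_scale (a b : ℝ) (v : TotalSpace 𝔼[m] V) : scale a (scale b v) = scale (a * b) v :=
  congrArg (TotalSpace.mk v.1) (smul_smul a b v.2)

theorem scale_one (v : TotalSpace 𝔼[m] V) : scale 1 v = v :=
  congrArg (TotalSpace.mk v.1) (one_smul ℝ v.2)

variable [VectorBundle ℝ 𝔼[m] V]

theorem contMDiffOn_scale {E' : Type*} [NormedAddCommGroup E'] [NormedSpace ℝ E']
    {H' : Type*} [TopologicalSpace H'] {I' : ModelWithCorners ℝ E' H'} {W : Type*}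
    [TopologicalSpace W] [ChartedSpace H' W] {s : Set W} {c : W → ℝ} {g : W → TotalSpace 𝔼[m] V}
    (hc : ContMDiffOn I' 𝓘(ℝ, ℝ) ∞ c s) (hg : ContMDiffOn I' 𝓑[d, m] ∞ g s) :
    ContMDiffOn I' 𝓑[d, m] ∞ (fun x => scale (c x) (g x)) s := by
  intro x hx
  have h := hg x hx
  rw [contMDiffWithinAt_totalSpace] at h ⊢
  refine ⟨h.1, ?_⟩
  set e := trivializationAt 𝔼[m] V (g x).1
  have hev : ∀ y, (g y).1 ∈ e.baseSet → (e (scale (c y) (g y))).2 = c y • (e (g y)).2 :=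
    fun y hy => (e.linear ℝ hy).map_smul (c y) (g y).2
  have hb : (g x).1 ∈ e.baseSet := FiberBundle.mem_baseSet_trivializationAt' _
  refine ((hc x hx).smul h.2).congr_of_eventuallyEq ?_ (hev x hb)
  filter_upwards [h.1.continuousWithinAt.preimage_mem_nhdsWithin (e.open_baseSet.mem_nhds hb)]
    with y hy using hev y hy

variable (d)

theorem contMDiff_normSq [IsContMDiffRiemannianBundle (𝓡 d) ∞ 𝔼[m] V] :
    ContMDiff 𝓑[d, m] 𝓘(ℝ, ℝ) ∞ (fun v : TotalSpace 𝔼[m] V => inner ℝ v.2 v.2) :=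
  ContMDiff.inner_bundle (IB := 𝓡 d) (E := V) (v := fun v : TotalSpace 𝔼[m] V => v.2)
    (w := fun v : TotalSpace 𝔼[m] V => v.2) contMDiff_id contMDiff_id

theorem contMDiffOn_norm_inv [IsContMDiffRiemannianBundle (𝓡 d) ∞ 𝔼[m] V] :
    ContMDiffOn 𝓑[d, m] 𝓘(ℝ, ℝ) ∞ (fun v : TotalSpace 𝔼[m] V => ‖v.2‖⁻¹) {v | v.2 ≠ 0} := by
  have h : ContMDiffOn 𝓑[d, m] 𝓘(ℝ, ℝ) ∞
      (fun v : TotalSpace 𝔼[m] V => (√ (inner ℝ v.2 v.2))⁻¹) {v | v.2 ≠ 0} := by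
    intro v hv
    have hv : inner ℝ v.2 v.2 ≠ 0 := by simpa using hv
    have h2 : ContDiffAt ℝ ∞ (fun x : ℝ => (√ x)⁻¹) (inner ℝ v.2 v.2) :=
      (Real.contDiffAt_sqrt hv).inv (by
        rw [Real.sqrt_ne_zero']; exact lt_of_le_of_ne real_inner_self_nonneg hv.symm)
    exact (h2.contMDiffAt.comp v (contMDiff_normSq (V := V) d v)).contMDiffWithinAt
  refine h.congr fun v _ => ?_
  rw [norm_eq_sqrt_real_inner]

theorem continuous_norm_bundle [IsContMDiffRiemannianBundle (𝓡 d) ∞ 𝔼[m] V] :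
    Continuous (fun v : TotalSpace 𝔼[m] V => ‖v.2‖) := by
  simp_rw [norm_eq_sqrt_real_inner]
  exact Real.continuous_sqrt.comp (contMDiff_normSq (V := V) d).continuous

theorem isOpen_ne_zero [IsContMDiffRiemannianBundle (𝓡 d) ∞ 𝔼[m] V] :
    IsOpen {v : TotalSpace 𝔼[m] V | v.2 ≠ 0} := by
  have := (continuous_norm_bundle (V := V) (m := m) d).isOpen_preimage {0}ᶜ
    isOpen_compl_singleton
  convert this using 1
  ext v
  simp

end OneBundle

section Gluing

variable {d₁ m₁ d₂ m₂ n : ℕ}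
  {M₁ : Type*} [TopologicalSpace M₁] [ChartedSpace 𝔼[d₁] M₁]
  {V₁ : M₁ → Type*} [∀ x, NormedAddCommGroup (V₁ x)] [∀ x, InnerProductSpace ℝ (V₁ x)]
  [TopologicalSpace (TotalSpace 𝔼[m₁] V₁)] [FiberBundle 𝔼[m₁] V₁]
  {M₂ : Type*} [TopologicalSpace M₂] [ChartedSpace 𝔼[d₂] M₂]
  {V₂ : M₂ → Type*} [∀ x, NormedAddCommGroup (V₂ x)] [∀ x, InnerProductSpace ℝ (V₂ x)]
  [TopologicalSpace (TotalSpace 𝔼[m₂] V₂)] [FiberBundle 𝔼[m₂] V₂]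
  (φ : SetDiffeo 𝓑[d₁, m₁] 𝓑[d₂, m₂] (sphereBundle m₁ V₁) (sphereBundle m₂ V₂))

/-- The identification `x ∼ φ x`, for `x ∈ ∂E₊`, on the disjoint union of `E₊` and `E₋`. (The index
`1` stands for `+` and the index `2` for `-`.) -/
inductive GlueRel :
    diskBundle m₁ V₁ ⊕ diskBundle m₂ V₂ → diskBundle m₁ V₁ ⊕ diskBundle m₂ V₂ → Prop
  | glue (s : sphereBundle m₁ V₁) :
      GlueRel (Sum.inl (sphereToDisk s)) (Sum.inr (sphereToDisk (φ s)))

/-- The glued space `E_φ = E₊ ∪_φ E₋`. -/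
def Glued : Type _ := Quot (GlueRel φ)

/-- `E_φ` carries the quotient topology. -/
instance Glued.instTopologicalSpace : TopologicalSpace (Glued φ) :=
  inferInstanceAs (TopologicalSpace (Quot (GlueRel φ)))

/-- The inclusion of `E₊` in `E_φ`. -/
def Glued.inl (x : diskBundle m₁ V₁) : Glued φ := Quot.mk _ (Sum.inl x)

/-- The inclusion of `E₋` in `E_φ`. -/
def Glued.inr (y : diskBundle m₂ V₂) : Glued φ := Quot.mk _ (Sum.inr y)

theorem Glued.inl_eq_inr (s : sphereBundle m₁ V₁) :
    Glued.inl φ (sphereToDisk s) = Glued.inr φ (sphereToDisk (φ s)) := Quot.sound (.glue s)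

/-- The leaves of the foliation `F_φ` of `E_φ`: the concentric tubes of constant radius `r ∈ [0, 1]`
around the zero sections in `E₊` and in `E₋`, those of radius `0` being the zero sections. -/
def leaves : Set (Set (Glued φ)) :=
  {L | ∃ r ∈ Icc (0 : ℝ) 1, L = Glued.inl φ '' {x | ‖x.1.2‖ = r} ∨
    L = Glued.inr φ '' {y | ‖y.1.2‖ = r}}

theorem norm_scale_inv {v : TotalSpace 𝔼[m₁] V₁} (hv : v.2 ≠ 0) : ‖(scale ‖v.2‖⁻¹ v).2‖ = 1 := by
  rw [norm_scale, abs_of_nonneg (by positivity), inv_mul_cancel₀ (norm_ne_zero_iff.2 hv)]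

/-- The inversion `r • s ↦ r⁻¹ • φ s` for `s ∈ ∂E₊` and `r > 0`. -/
def inversion (v : TotalSpace 𝔼[m₁] V₁) (hv : v.2 ≠ 0) : TotalSpace 𝔼[m₂] V₂ :=
  scale ‖v.2‖⁻¹ (φ ⟨scale ‖v.2‖⁻¹ v, norm_scale_inv hv⟩)

theorem norm_inversion (v : TotalSpace 𝔼[m₁] V₁) (hv : v.2 ≠ 0) :
    ‖(inversion φ v hv).2‖ = ‖v.2‖⁻¹ := by
  have : ‖(φ ⟨scale ‖v.2‖⁻¹ v, norm_scale_inv hv⟩).1.2‖ = 1 := (φ _).2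
  rw [inversion, norm_scale, this, mul_one, abs_of_nonneg (by positivity)]

theorem inversion_ne_zero (v : TotalSpace 𝔼[m₁] V₁) (hv : v.2 ≠ 0) :
    (inversion φ v hv).2 ≠ 0 := by
  rw [← norm_ne_zero_iff, norm_inversion]
  exact inv_ne_zero (norm_ne_zero_iff.2 hv)

theorem inversion_eq {v : TotalSpace 𝔼[m₁] V₁} (hv : v.2 ≠ 0) {c : ℝ} (hc : 0 < c)
    (s : sphereBundle m₁ V₁) (h : v = scale c s) : inversion φ v hv = scale c⁻¹ (φ s) := by
  have hs : ‖s.1.2‖ = 1 := s.2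
  have hn : ‖v.2‖ = c := by rw [h, norm_scale, hs, mul_one, abs_of_pos hc]
  have : (⟨scale ‖v.2‖⁻¹ v, norm_scale_inv hv⟩ : sphereBundle m₁ V₁) = s := by
    ext1
    simp only [hn]
    rw [h, scale_scale, inv_mul_cancel₀ hc.ne', scale_one]
  rw [inversion, this, hn]

theorem inversion_symm (v : TotalSpace 𝔼[m₁] V₁) (hv : v.2 ≠ 0) :
    inversion φ.symm (inversion φ v hv) (inversion_ne_zero φ v hv) = v := by
  have h0 : 0 < ‖v.2‖ := norm_pos_iff.2 hv
  refine (inversion_eq φ.symm (inversion_ne_zero φ v hv) (inv_pos.2 h0)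
    (φ ⟨scale ‖v.2‖⁻¹ v, norm_scale_inv hv⟩) rfl).trans ?_
  have : φ.symm (φ ⟨scale ‖v.2‖⁻¹ v, norm_scale_inv hv⟩) = ⟨scale ‖v.2‖⁻¹ v, norm_scale_inv hv⟩ :=
    φ.toEquiv.symm_apply_apply _
  rw [this, scale_scale, inv_inv, mul_inv_cancel₀ h0.ne', scale_one]

theorem inversion_sphere (s : sphereBundle m₁ V₁) (hs : s.1.2 ≠ 0) :
    inversion φ s.1 hs = φ s := by
  rw [inversion_eq φ hs one_pos s (scale_one _).symm, inv_one, scale_one]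

theorem norm_inversion_le {v : TotalSpace 𝔼[m₁] V₁} (hv : v.2 ≠ 0) (h : 1 ≤ ‖v.2‖) :
    ‖(inversion φ v hv).2‖ ≤ 1 := by
  rw [norm_inversion]; exact inv_le_one_of_one_le₀ h

theorem ne_zero_of_not_le {v : TotalSpace 𝔼[m₁] V₁} (h : ¬ ‖v.2‖ ≤ 1) : v.2 ≠ 0 := by
  rintro h0; simp [h0] at h

open Classical in
/-- The parametrization of `E_φ` minus the zero section of `E₋` by the total space of the vector
bundle `ξ₊ ⊇ E₊`, which extends the inclusion of `E₊` across the seam by the radial collar of `E₋`: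
`r • s ↦ r⁻¹ • φ s ∈ E₋` for `s ∈ ∂E₊` and `r ≥ 1`. -/
def Glued.param₁ (v : TotalSpace 𝔼[m₁] V₁) : Glued φ :=
  if h : ‖v.2‖ ≤ 1 then Glued.inl φ ⟨v, h⟩
  else Glued.inr φ ⟨inversion φ v (ne_zero_of_not_le h), norm_inversion_le φ _ (not_le.1 h).le⟩

open Classical in
/-- The parametrization of `E_φ` minus the zero section of `E₊` by the total space of the vector
bundle `ξ₋ ⊇ E₋`, which extends the inclusion of `E₋` across the seam by the radial collar of `E₊`. -/
def Glued.param₂ (w : TotalSpace 𝔼[m₂] V₂) : Glued φ :=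
  if h : ‖w.2‖ ≤ 1 then Glued.inr φ ⟨w, h⟩
  else Glued.inl φ ⟨inversion φ.symm w (ne_zero_of_not_le h),
    norm_inversion_le φ.symm _ (not_le.1 h).le⟩

theorem Glued.param₁_of_le {v : TotalSpace 𝔼[m₁] V₁} (h : ‖v.2‖ ≤ 1) :
    Glued.param₁ φ v = Glued.inl φ ⟨v, h⟩ := dif_pos h

theorem Glued.param₁_of_ge {v : TotalSpace 𝔼[m₁] V₁} (hv : v.2 ≠ 0) (h : 1 ≤ ‖v.2‖) :
    Glued.param₁ φ v = Glued.inr φ ⟨inversion φ v hv, norm_inversion_le φ hv h⟩ := by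
  rcases h.eq_or_lt with h1 | h1
  · rw [Glued.param₁_of_le φ h1.symm.le]
    have := Glued.inl_eq_inr φ ⟨v, h1.symm⟩
    have h2 := inversion_sphere φ ⟨v, h1.symm⟩ hv
    simp only [sphereToDisk] at this
    rw [this]
    congr 1
    ext1
    exact h2.symm
  · exact dif_neg (not_le.2 h1)

theorem Glued.param₂_of_le {w : TotalSpace 𝔼[m₂] V₂} (h : ‖w.2‖ ≤ 1) :
    Glued.param₂ φ w = Glued.inr φ ⟨w, h⟩ := dif_pos h

/-- Exchanging the two sides. -/
def Glued.swap : Glued φ → Glued φ.symm :=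
  Quot.lift (fun p => Quot.mk _ p.swap) (by
    rintro _ _ ⟨s⟩
    have := (Glued.inl_eq_inr φ.symm (φ s)).symm
    rwa [show φ.symm (φ s) = s from φ.toEquiv.symm_apply_apply s] at this)

theorem Glued.continuous_swap : Continuous (Glued.swap φ) :=
  continuous_quot_lift _ (continuous_quot_mk.comp continuous_sum_swap)

theorem Glued.swap_swap (g : Glued φ) : Glued.swap φ.symm (Glued.swap φ g) = g := by
  induction g using Quot.ind with | mk p => rcases p with p | p <;> rfl

/-- Exchanging the two sides, as a homeomorphism. -/
def Glued.swapHomeo : Glued φ.symm ≃ₜ Glued φ where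
  toFun := Glued.swap φ.symm
  invFun := Glued.swap φ
  left_inv := Glued.swap_swap φ.symm
  right_inv := Glued.swap_swap φ
  continuous_toFun := Glued.continuous_swap φ.symm
  continuous_invFun := Glued.continuous_swap φ

theorem Glued.swap_param₁ : Glued.param₂ φ = Glued.swapHomeo φ ∘ Glued.param₁ φ.symm := by
  ext w
  by_cases h : ‖w.2‖ ≤ 1
  · rw [Glued.param₂_of_le φ h, Function.comp_apply, Glued.param₁_of_le φ.symm h]; rfl
  · rw [Glued.param₂, dif_neg h, Function.comp_apply, Glued.param₁, dif_neg h]; rfl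

open Classical in
/-- A left inverse of `param₁`. -/
def Glued.back : Glued φ → Option (TotalSpace 𝔼[m₁] V₁) :=
  Quot.lift (Sum.elim (fun x => some x.1)
    (fun y => if h : y.1.2 = 0 then none else some (inversion φ.symm y.1 h))) (by
    rintro _ _ ⟨s⟩
    have hs : (φ s).1.2 ≠ 0 := by
      rw [← norm_ne_zero_iff, show ‖(φ s).1.2‖ = 1 from (φ s).2]; exact one_ne_zero
    simp only [Sum.elim_inl, Sum.elim_inr, sphereToDisk]
    rw [dif_neg hs, inversion_sphere φ.symm (φ s) hs]
    exact congrArg some (congrArg Subtype.val (φ.toEquiv.symm_apply_apply s).symm))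

theorem Glued.back_inl (x : diskBundle m₁ V₁) : Glued.back φ (Glued.inl φ x) = some x.1 := rfl

theorem Glued.back_inr {y : diskBundle m₂ V₂} (h : y.1.2 ≠ 0) :
    Glued.back φ (Glued.inr φ y) = some (inversion φ.symm y.1 h) := dif_neg h

theorem Glued.back_inr_zero {y : diskBundle m₂ V₂} (h : y.1.2 = 0) :
    Glued.back φ (Glued.inr φ y) = none := dif_pos h

theorem Glued.back_param₁ (v : TotalSpace 𝔼[m₁] V₁) :
    Glued.back φ (Glued.param₁ φ v) = some v := by
  by_cases h : ‖v.2‖ ≤ 1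
  · rw [Glued.param₁_of_le φ h, Glued.back_inl]
  · rw [Glued.param₁, dif_neg h, Glued.back_inr φ (inversion_ne_zero φ v (ne_zero_of_not_le h)), inversion_symm]

theorem Glued.param₁_of_back (g : Glued φ) (v : TotalSpace 𝔼[m₁] V₁)
    (h : Glued.back φ g = some v) : Glued.param₁ φ v = g := by
  induction g using Quot.ind with | mk p =>
  rcases p with x | y
  · obtain rfl : x.1 = v := Option.some.inj h
    exact Glued.param₁_of_le φ x.2
  · by_cases hy : y.1.2 = 0
    · have := (Glued.back_inr_zero φ hy).symm.trans h
      simp at this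
    · obtain rfl : inversion φ.symm y.1 hy = v :=
        Option.some.inj ((Glued.back_inr φ hy).symm.trans h)
      have h1 : 1 ≤ ‖(inversion φ.symm y.1 hy).2‖ := by
        rw [norm_inversion]
        exact (one_le_inv₀ (norm_pos_iff.2 hy)).2 y.2
      rw [Glued.param₁_of_ge φ (inversion_ne_zero φ.symm _ hy) h1]
      have := inversion_symm φ.symm y.1 hy
      exact congrArg (Glued.inr φ) (Subtype.ext this)

theorem Glued.injective_param₁ : Function.Injective (Glued.param₁ φ) := fun v w h => by
  have := congrArg (Glued.back φ) h
  rw [Glued.back_param₁, Glued.back_param₁] at this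
  exact Option.some.inj this

variable [VectorBundle ℝ 𝔼[m₁] V₁] [IsContMDiffRiemannianBundle (𝓡 d₁) ∞ 𝔼[m₁] V₁]
  [VectorBundle ℝ 𝔼[m₂] V₂] [IsContMDiffRiemannianBundle (𝓡 d₂) ∞ 𝔼[m₂] V₂]

theorem exists_contMDiffOn_inversion : ∃ G : TotalSpace 𝔼[m₁] V₁ → TotalSpace 𝔼[m₂] V₂,
    ContMDiffOn 𝓑[d₁, m₁] 𝓑[d₂, m₂] ∞ G {v | v.2 ≠ 0} ∧ ∀ v hv, G v = inversion φ v hv := by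
  obtain ⟨g, hg, hgφ⟩ := φ.smooth_toFun
  refine ⟨fun v => scale ‖v.2‖⁻¹ (g (scale ‖v.2‖⁻¹ v)), ?_, fun v hv => ?_⟩
  · refine contMDiffOn_scale (contMDiffOn_norm_inv d₁) (hg.comp
      (contMDiffOn_scale (contMDiffOn_norm_inv d₁) contMDiffOn_id) fun v hv => norm_scale_inv hv)
  · have := hgφ ⟨scale ‖v.2‖⁻¹ v, norm_scale_inv hv⟩
    simp only at this
    simp only [this, inversion]

theorem continuousOn_inversion :
    Continuous fun v : {v : TotalSpace 𝔼[m₁] V₁ // v.2 ≠ 0} => inversion φ v.1 v.2 := by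
  obtain ⟨G, hG, h⟩ := exists_contMDiffOn_inversion φ
  have := continuousOn_iff_continuous_domRestrict.1 hG.continuousOn
  exact this.congr fun v => h v.1 v.2

theorem Glued.continuous_param₁ : Continuous (Glued.param₁ φ) := by
  have hn := continuous_norm_bundle (V := V₁) (m := m₁) d₁
  have h1 : ContinuousOn (Glued.param₁ φ) {v | ‖v.2‖ ≤ 1} := by
    rw [continuousOn_iff_continuous_domRestrict]
    have : Continuous (Glued.inl φ) := continuous_quot_mk.comp continuous_inl
    exact this.congr fun v => (Glued.param₁_of_le φ v.2).symm
  have h2 : ContinuousOn (Glued.param₁ φ) {v | 1 ≤ ‖v.2‖} := by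
    rw [continuousOn_iff_continuous_domRestrict]
    have h0 : ∀ v : {v : TotalSpace 𝔼[m₁] V₁ | 1 ≤ ‖v.2‖}, v.1.2 ≠ 0 := fun v => by
      rw [← norm_ne_zero_iff]
      exact (zero_lt_one.trans_le (show 1 ≤ ‖v.1.2‖ from v.2)).ne'
    have hi : Continuous fun v : {v : TotalSpace 𝔼[m₁] V₁ | 1 ≤ ‖v.2‖} =>
        (⟨inversion φ v.1 (h0 v), norm_inversion_le φ (h0 v) v.2⟩ : diskBundle m₂ V₂) :=
      ((continuousOn_inversion φ).comp (f := fun v : {v : TotalSpace 𝔼[m₁] V₁ | 1 ≤ ‖v.2‖} =>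
        (⟨v.1, h0 v⟩ : {v : TotalSpace 𝔼[m₁] V₁ // v.2 ≠ 0}))
        (continuous_subtype_val.subtype_mk _)).subtype_mk _
    have : Continuous (Glued.inr φ) := continuous_quot_mk.comp continuous_inr
    exact (this.comp hi).congr fun v => (Glued.param₁_of_ge φ (h0 v) v.2).symm
  have := h1.union_of_isClosed h2 (isClosed_le hn continuous_const)
    (isClosed_le continuous_const hn)
  rw [← continuousOn_univ]
  exact this.mono fun v _ => le_total ‖v.2‖ 1

theorem Glued.isOpenEmbedding_param₁ : IsOpenEmbedding (Glued.param₁ φ) := by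
  refine .of_continuous_injective_isOpenMap (Glued.continuous_param₁ φ)
    (Glued.injective_param₁ φ) fun U hU => ?_
  have hset : Glued.param₁ φ '' U = {g | ∃ v ∈ U, Glued.back φ g = some v} := by
    ext g
    constructor
    · rintro ⟨v, hv, rfl⟩
      exact ⟨v, hv, Glued.back_param₁ φ v⟩
    · rintro ⟨v, hv, h⟩
      exact ⟨v, hv, Glued.param₁_of_back φ g v h⟩
  rw [hset]
  refine (isQuotientMap_quot_mk.isOpen_preimage).1 (isOpen_sum_iff.2 ⟨?_, ?_⟩)
  · convert hU.preimage (continuous_subtype_val (p := (· ∈ diskBundle m₁ V₁))) using 1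
    ext x
    change (∃ v ∈ U, Glued.back φ (Glued.inl φ x) = some v) ↔ _
    simp [Glued.back_inl]
  · have hO := (hU.preimage (continuousOn_inversion φ.symm))
    have hO' := ((isOpen_ne_zero (m := m₂) (V := V₂) d₂).isOpenEmbedding_subtypeVal).isOpenMap _ hO
    convert hO'.preimage (continuous_subtype_val (p := (· ∈ diskBundle m₂ V₂))) using 1
    ext y
    change (∃ v ∈ U, Glued.back φ (Glued.inr φ y) = some v) ↔ _
    by_cases hy : y.1.2 = 0
    · rw [Glued.back_inr_zero φ hy]
      simp [hy]
    · rw [Glued.back_inr φ hy]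
      simp [hy]

theorem Glued.isOpenEmbedding_param₂ : IsOpenEmbedding (Glued.param₂ φ) := by
  rw [Glued.swap_param₁]
  exact (Glued.swapHomeo φ).isOpenEmbedding.comp (Glued.isOpenEmbedding_param₁ φ.symm)

theorem Glued.param₁_eq_param₂ (v : TotalSpace 𝔼[m₁] V₁) (hv : v.2 ≠ 0) :
    Glued.param₁ φ v = Glued.param₂ φ (inversion φ v hv) := by
  by_cases h : 1 ≤ ‖v.2‖
  · rw [Glued.param₁_of_ge φ hv h, Glued.param₂_of_le]
  · have h' := (not_le.1 h).le
    have h1 : ¬ ‖(inversion φ v hv).2‖ ≤ 1 := by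
      rw [norm_inversion, not_le]
      exact (one_lt_inv₀ (norm_pos_iff.2 hv)).2 (not_le.1 h)
    rw [Glued.param₁_of_le φ h', Glued.param₂, dif_neg h1]
    exact congrArg (Glued.inl φ) (Subtype.ext (inversion_symm φ v hv).symm)

theorem Glued.param₁_mem_range {v : TotalSpace 𝔼[m₁] V₁}
    (h : Glued.param₁ φ v ∈ range (Glued.param₂ φ)) : v.2 ≠ 0 := by
  rintro h0
  obtain ⟨w, hw⟩ := h
  by_cases hw1 : w.2 = 0
  · have hle : ‖w.2‖ ≤ 1 := by simp [hw1]
    rw [Glued.param₂_of_le φ hle] at hw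
    have := congrArg (Glued.back φ) hw
    rw [Glued.back_param₁, Glued.back_inr_zero φ hw1] at this
    cases this
  · have e := Glued.param₁_eq_param₂ φ (inversion φ.symm w hw1) (inversion_ne_zero φ.symm w hw1)
    have e2 : inversion φ (inversion φ.symm w hw1) (inversion_ne_zero φ.symm w hw1) = w :=
      inversion_symm φ.symm w hw1
    rw [e2, hw] at e
    have := Glued.injective_param₁ φ e
    exact inversion_ne_zero φ.symm w hw1 (this ▸ h0)

theorem Glued.param_cover (g : Glued φ) :
    (∃ v, Glued.param₁ φ v = g) ∨ ∃ w, Glued.param₂ φ w = g := by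
  induction g using Quot.ind with | mk p =>
  rcases p with x | y
  · exact .inl ⟨x, Glued.param₁_of_le φ x.2⟩
  · exact .inr ⟨y, Glued.param₂_of_le φ y.2⟩

/-- A linear identification `ℝᵈ × ℝᵐ ≃ ℝⁿ` for `d + m = n`. -/
def modelEquiv (d m n : ℕ) [h : Fact (d + m = n)] : (𝔼[d] × 𝔼[m]) ≃L[ℝ] 𝔼[n] :=
  ContinuousLinearEquiv.ofFinrankEq (by simp [h.out])

/-- The chart of `E_φ` given by a chart of the manifold `ξ₊`. -/
def Glued.chart₁ (n : ℕ) [Fact (d₁ + m₁ = n)] (v : TotalSpace 𝔼[m₁] V₁) :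
    OpenPartialHomeomorph (Glued φ) 𝔼[n] :=
  haveI : Nonempty (TotalSpace 𝔼[m₁] V₁) := ⟨v⟩
  ((Glued.isOpenEmbedding_param₁ φ).toOpenPartialHomeomorph _).symm.trans
    ((chartAt (ModelProd 𝔼[d₁] 𝔼[m₁]) v).trans
      (modelEquiv d₁ m₁ n).toHomeomorph.toOpenPartialHomeomorph)

/-- The chart of `E_φ` given by a chart of the manifold `ξ₋`. -/
def Glued.chart₂ (n : ℕ) [Fact (d₂ + m₂ = n)] (w : TotalSpace 𝔼[m₂] V₂) :
    OpenPartialHomeomorph (Glued φ) 𝔼[n] :=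
  haveI : Nonempty (TotalSpace 𝔼[m₂] V₂) := ⟨w⟩
  ((Glued.isOpenEmbedding_param₂ φ).toOpenPartialHomeomorph _).symm.trans
    ((chartAt (ModelProd 𝔼[d₂] 𝔼[m₂]) w).trans
      (modelEquiv d₂ m₂ n).toHomeomorph.toOpenPartialHomeomorph)

theorem Glued.mem_chart₁_source [Fact (d₁ + m₁ = n)] (v : TotalSpace 𝔼[m₁] V₁) :
    Glued.param₁ φ v ∈ (Glued.chart₁ φ n v).source := by
  have : Nonempty (TotalSpace 𝔼[m₁] V₁) := ⟨v⟩
  simp [Glued.chart₁, IsOpenEmbedding.toOpenPartialHomeomorph_left_inv]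

theorem Glued.mem_chart₂_source [Fact (d₂ + m₂ = n)] (w : TotalSpace 𝔼[m₂] V₂) :
    Glued.param₂ φ w ∈ (Glued.chart₂ φ n w).source := by
  have : Nonempty (TotalSpace 𝔼[m₂] V₂) := ⟨w⟩
  simp [Glued.chart₂, IsOpenEmbedding.toOpenPartialHomeomorph_left_inv]

open Classical in
/-- The smooth atlas of `E_φ = E₊ ∪_φ E₋` obtained by gluing along the radial collars of the
boundaries: it makes `param₁` and `param₂` open embeddings of the manifolds `ξ₊` and `ξ₋`. -/
instance Glued.instChartedSpace [Fact (d₁ + m₁ = n)] [Fact (d₂ + m₂ = n)] :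
    ChartedSpace 𝔼[n] (Glued φ) where
  atlas := range (Glued.chart₁ φ n) ∪ range (Glued.chart₂ φ n)
  chartAt g := if h : ∃ v, Glued.param₁ φ v = g then Glued.chart₁ φ n h.choose
    else Glued.chart₂ φ n ((Glued.param_cover φ g).resolve_left h).choose
  mem_chart_source g := by
    split_ifs with h
    · have := Glued.mem_chart₁_source (n := n) φ h.choose
      rwa [h.choose_spec] at this
    · have := Glued.mem_chart₂_source (n := n) φ ((Glued.param_cover φ g).resolve_left h).choose
      rwa [((Glued.param_cover φ g).resolve_left h).choose_spec] at this
  chart_mem_atlas g := by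
    split_ifs with h
    · exact .inl ⟨_, rfl⟩
    · exact .inr ⟨_, rfl⟩

theorem contMDiff_modelEquiv (d m n : ℕ) [Fact (d + m = n)] :
    ContMDiff (M := ModelProd 𝔼[d] 𝔼[m]) 𝓑[d, m] (𝓡 n) ∞ (modelEquiv d m n) := by
  have := (modelEquiv d m n).toContinuousLinearMap.contMDiff (n := ∞)
  rw [modelWithCornersSelf_prod] at this
  exact this

theorem contMDiff_modelEquiv_symm (d m n : ℕ) [Fact (d + m = n)] :
    ContMDiff (M' := ModelProd 𝔼[d] 𝔼[m]) (𝓡 n) 𝓑[d, m] ∞ (modelEquiv d m n).symm := by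
  have := (modelEquiv d m n).symm.toContinuousLinearMap.contMDiff (n := ∞)
  rw [modelWithCornersSelf_prod] at this
  exact this

theorem transition_smooth {X : Type*} [TopologicalSpace X] [Fact (d₁ + m₁ = n)]
    [Fact (d₂ + m₂ = n)]
    [IsManifold (𝓡 d₁) ∞ M₁] [ContMDiffVectorBundle ∞ 𝔼[m₁] V₁ (𝓡 d₁)]
    [IsManifold (𝓡 d₂) ∞ M₂] [ContMDiffVectorBundle ∞ 𝔼[m₂] V₂ (𝓡 d₂)]
    (P : OpenPartialHomeomorph (TotalSpace 𝔼[m₁] V₁) X)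
    (Q : OpenPartialHomeomorph (TotalSpace 𝔼[m₂] V₂) X)
    (h : ContMDiffOn 𝓑[d₁, m₁] 𝓑[d₂, m₂] ∞ (Q.symm ∘ P) (P.source ∩ P ⁻¹' Q.target))
    (v : TotalSpace 𝔼[m₁] V₁) (w : TotalSpace 𝔼[m₂] V₂) :
    ContMDiffOn (𝓡 n) (𝓡 n) ∞
      ((P.symm.trans ((chartAt (ModelProd 𝔼[d₁] 𝔼[m₁]) v).trans
        (modelEquiv d₁ m₁ n).toHomeomorph.toOpenPartialHomeomorph)).symm.trans
      (Q.symm.trans ((chartAt (ModelProd 𝔼[d₂] 𝔼[m₂]) w).trans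
        (modelEquiv d₂ m₂ n).toHomeomorph.toOpenPartialHomeomorph)))
      ((P.symm.trans ((chartAt (ModelProd 𝔼[d₁] 𝔼[m₁]) v).trans
        (modelEquiv d₁ m₁ n).toHomeomorph.toOpenPartialHomeomorph)).symm.trans
      (Q.symm.trans ((chartAt (ModelProd 𝔼[d₂] 𝔼[m₂]) w).trans
        (modelEquiv d₂ m₂ n).toHomeomorph.toOpenPartialHomeomorph))).source := by
  intro x hx
  simp only [OpenPartialHomeomorph.trans_source, OpenPartialHomeomorph.symm_source,
    mem_inter_iff, mem_preimage,
    OpenPartialHomeomorph.trans_symm_eq_symm_trans_symm, OpenPartialHomeomorph.coe_trans,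
    Function.comp_apply,
    Homeomorph.toOpenPartialHomeomorph_source, Homeomorph.toOpenPartialHomeomorph_target,
    mem_univ, true_and, and_true, OpenPartialHomeomorph.symm_symm] at hx
  obtain ⟨⟨hx1, hx2⟩, hx3, hx4⟩ := hx
  have h0 := contMDiff_modelEquiv_symm d₁ m₁ n x
  have h1 : ContMDiffAt 𝓑[d₁, m₁] 𝓑[d₁, m₁] ∞ (chartAt (ModelProd 𝔼[d₁] 𝔼[m₁]) v).symm
      ((modelEquiv d₁ m₁ n).symm x) :=
    contMDiffOn_chart_symm.contMDiffAt ((OpenPartialHomeomorph.open_target _).mem_nhds hx1)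
  set y := (chartAt (ModelProd 𝔼[d₁] 𝔼[m₁]) v).symm ((modelEquiv d₁ m₁ n).symm x)
  have hy : P.source ∩ P ⁻¹' Q.target ∈ 𝓝 y :=
    (P.isOpen_inter_preimage Q.open_target).mem_nhds ⟨hx2, hx3⟩
  have h3 : ContMDiffAt 𝓑[d₁, m₁] 𝓑[d₂, m₂] ∞ (Q.symm ∘ P) y := h.contMDiffAt hy
  have h4 : ContMDiffAt 𝓑[d₂, m₂] 𝓑[d₂, m₂] ∞ (chartAt (ModelProd 𝔼[d₂] 𝔼[m₂]) w)
      ((Q.symm ∘ P) y) :=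
    contMDiffOn_chart.contMDiffAt ((OpenPartialHomeomorph.open_source _).mem_nhds hx4)
  have h5 := contMDiff_modelEquiv d₂ m₂ n (chartAt (ModelProd 𝔼[d₂] 𝔼[m₂]) w ((Q.symm ∘ P) y))
  exact (h5.comp x (h4.comp x (h3.comp x (h1.comp x h0)))).contMDiffWithinAt

theorem Glued.param₁_to_param₂ [Nonempty (TotalSpace 𝔼[m₁] V₁)] [Nonempty (TotalSpace 𝔼[m₂] V₂)] :
    let P := (Glued.isOpenEmbedding_param₁ φ).toOpenPartialHomeomorph
    let Q := (Glued.isOpenEmbedding_param₂ φ).toOpenPartialHomeomorph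
    ContMDiffOn 𝓑[d₁, m₁] 𝓑[d₂, m₂] ∞ (Q.symm ∘ P) (P.source ∩ P ⁻¹' Q.target) ∧
    ContMDiffOn 𝓑[d₂, m₂] 𝓑[d₁, m₁] ∞ (P.symm ∘ Q) (Q.source ∩ Q ⁻¹' P.target) := by
  intro P Q
  obtain ⟨G, hG, hGφ⟩ := exists_contMDiffOn_inversion φ
  obtain ⟨G', hG', hGφ'⟩ := exists_contMDiffOn_inversion φ.symm
  have key : ∀ v hv, (Q.symm ∘ P) v = inversion φ v hv := fun v hv => by
    have h1 : P v = Q (inversion φ v hv) := by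
      simpa [P, Q] using Glued.param₁_eq_param₂ φ v hv
    rw [Function.comp_apply, h1]
    exact Q.left_inv (by simp [Q])
  have key' : ∀ w hw, (P.symm ∘ Q) w = inversion φ.symm w hw := fun w hw => by
    have h1 : P (inversion φ.symm w hw) = Q w := by
      have := Glued.param₁_eq_param₂ φ _ (inversion_ne_zero φ.symm w hw)
      have e2 : inversion φ (inversion φ.symm w hw) (inversion_ne_zero φ.symm w hw) = w :=
        inversion_symm φ.symm w hw
      rw [e2] at this
      simpa [P, Q] using this
    rw [Function.comp_apply, ← h1]
    exact P.left_inv (by simp [P])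
  have m1 : ∀ v ∈ P.source ∩ P ⁻¹' Q.target, v.2 ≠ 0 := fun v hv =>
    Glued.param₁_mem_range φ (by simpa [P, Q] using hv)
  have m2 : ∀ w ∈ Q.source ∩ Q ⁻¹' P.target, w.2 ≠ 0 := fun w hw h0 => by
    have hw' : Q w ∈ P.target := hw.2
    have h2 : Q w = P (P.symm (Q w)) := (P.right_inv hw').symm
    have h3 : (P.symm (Q w)).2 ≠ 0 := Glued.param₁_mem_range φ ⟨w, by simpa [P, Q] using h2⟩
    have h4 := key _ h3
    rw [Function.comp_apply, P.right_inv hw', Q.left_inv hw.1] at h4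
    exact inversion_ne_zero φ _ h3 (h4 ▸ h0)
  refine ⟨(hG.mono m1).congr fun v hv => ?_, (hG'.mono m2).congr fun w hw => ?_⟩
  · rw [key v (m1 v hv), hGφ]
  · rw [key' w (m2 w hw), hGφ']

instance Glued.instIsManifold [Fact (d₁ + m₁ = n)] [Fact (d₂ + m₂ = n)]
    [IsManifold (𝓡 d₁) ∞ M₁] [ContMDiffVectorBundle ∞ 𝔼[m₁] V₁ (𝓡 d₁)]
    [IsManifold (𝓡 d₂) ∞ M₂] [ContMDiffVectorBundle ∞ 𝔼[m₂] V₂ (𝓡 d₂)] :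
    IsManifold (𝓡 n) ∞ (Glued φ) := by
  apply isManifold_of_contDiffOn
  intro e e' he he'
  suffices ContMDiffOn (𝓡 n) (𝓡 n) ∞ (e.symm.trans e') (e.symm.trans e').source by
    simpa [contMDiffOn_iff_contDiffOn] using this
  rcases he with ⟨v, rfl⟩ | ⟨v, rfl⟩ <;> rcases he' with ⟨w, rfl⟩ | ⟨w, rfl⟩
  · have : Nonempty (TotalSpace 𝔼[m₁] V₁) := ⟨v⟩
    refine transition_smooth _ _ (contMDiffOn_id.congr fun x hx => ?_) v w
    exact OpenPartialHomeomorph.left_inv _ hx.1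
  · have : Nonempty (TotalSpace 𝔼[m₁] V₁) := ⟨v⟩
    have : Nonempty (TotalSpace 𝔼[m₂] V₂) := ⟨w⟩
    exact transition_smooth _ _ (Glued.param₁_to_param₂ φ).1 v w
  · have : Nonempty (TotalSpace 𝔼[m₁] V₁) := ⟨w⟩
    have : Nonempty (TotalSpace 𝔼[m₂] V₂) := ⟨v⟩
    exact transition_smooth _ _ (Glued.param₁_to_param₂ φ).2 v w
  · have : Nonempty (TotalSpace 𝔼[m₂] V₂) := ⟨v⟩
    refine transition_smooth _ _ (contMDiffOn_id.congr fun x hx => ?_) v w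
    exact OpenPartialHomeomorph.left_inv _ hx.1

variable (n) in
/-- `(E_φ, F_φ) ≅ (E_ψ, F_ψ)`: there is a foliated diffeomorphism, that is, a diffeomorphism from
`E_φ` to `E_ψ` that maps leaves to leaves. -/
def FoliatedEquivalent [Fact (d₁ + m₁ = n)] [Fact (d₂ + m₂ = n)]
    (φ ψ : SetDiffeo 𝓑[d₁, m₁] 𝓑[d₂, m₂] (sphereBundle m₁ V₁) (sphereBundle m₂ V₂)) : Prop :=
  ∃ F : Glued φ ≃ₘ^∞⟮𝓡 n, 𝓡 n⟯ Glued ψ, ∀ L ∈ leaves φ, F '' L ∈ leaves ψ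

end Gluing

end

/-! Everything rests on extending a diffeomorphism `w` of ∂E₋ to a diffeomorphism `W` of the total
space ξ₋ that is r • s ↦ r • w s outside the disk bundle. Given such a `W`, the identity on E₊ and
`W` on E₋ fit together to a diffeomorphism from E_φ to E_{w ∘ φ}: in the parametrization by ξ₋ it is
`W` itself, so the seam causes no trouble (`Glued.exists_diffeomorph`). If `W` also preserves the
norm, this diffeomorphism preserves the height, whose level sets are the leaves.

Statement (1) is proved by contraposition. Bundle isometries extend to norm preserving `W`. So does
K₁ ∘ K₀⁻¹ for an isotopy K: perform the isotopy along the radius (`exists_diffeomorph_of_isotopy`).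
If both inclusions are onto on path components, each h± is joined to an isometry by a chain of
isotopies, hence composing the gluing map with h± does not change the foliated manifold.

In (2), the manifolds are diffeomorphic because w = φ₁ ∘ φ₀⁻¹ extends over the disk bundle. An
extension F need not respect the radial collar, so F together with the radial extension of w may
fail to be smooth along the sphere bundle. Conjugating F by a radial homeomorphism that squeezes the
collar doubly exponentially makes it agree to infinite order with the radial extension
(`exists_diffeomorph_of_mem_extendableDiffeos`).

For the foliations, a foliated diffeomorphism induces a homeomorphism of the height interval, so it
preserves or exchanges the two zero sections. In the first case it lifts to diffeomorphisms A, B of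
the total spaces that map spheres of constant radius to such spheres, and comparison on the seam
shows that φ₁ conjugates the direction of A into the direction of B ∘ φ₀ (`exists_conjugation`). Now
r⁻¹ A(r v) extends smoothly to r = 0, where it is fibrewise linear and multiplies norms by a
constant. Normalizing to unit length gives an isotopy from a bundle isometry to the direction of A
(`exists_isotopicIn_isometry`). The same holds for B, so [φ₁] = [b ∘ φ₀ ∘ a⁻¹] with isometries a, b,
and [φ₀] in the image forces [φ₁] into the image. When the zero sections are exchanged, the same
argument applies to φ₁⁻¹. -/

/-! ### Hadamard's lemma with parameters -/

section Hadamard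

open Filter MeasureTheory

variable {E F : Type} [NormedAddCommGroup E] [NormedSpace ℝ E] [FiniteDimensional ℝ E]
  [NormedAddCommGroup F] [NormedSpace ℝ F] [CompleteSpace F]

theorem hasFDerivAt_integral_unitInterval {F : Type} [NormedAddCommGroup F] [NormedSpace ℝ F]
    {f : ℝ × E → F} (hf : ContDiff ℝ 1 f) (x : E) :
    HasFDerivAt (fun x => ∫ u in (0 : ℝ)..1, f (u, x))
      (∫ u in (0 : ℝ)..1, (fderiv ℝ f (u, x)).comp (ContinuousLinearMap.inr ℝ ℝ E)) x := by
  have hc : Continuous fun p : ℝ × E => (fderiv ℝ f p).comp (ContinuousLinearMap.inr ℝ ℝ E) :=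
    (hf.continuous_fderiv one_ne_zero).clm_comp continuous_const
  have hK : IsCompact ((Icc (0 : ℝ) 1) ×ˢ Metric.closedBall x 1) :=
    isCompact_Icc.prod (isCompact_closedBall x 1)
  obtain ⟨C, hC⟩ := hK.exists_bound_of_continuousOn hc.continuousOn
  refine intervalIntegral.hasFDerivAt_integral_of_dominated_of_fderiv_le
    (𝕜 := ℝ) (μ := volume) (a := 0) (b := 1) (F := fun x u => f (u, x))
    (F' := fun x u => (fderiv ℝ f (u, x)).comp (ContinuousLinearMap.inr ℝ ℝ E))
    (bound := fun _ => C) (Metric.ball_mem_nhds x one_pos)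
    (.of_forall fun y => ?_) ?_ ?_ (.of_forall fun u hu y hy => ?_) ?_
    (.of_forall fun u _ y _ => ?_)
  · exact (hf.continuous.comp (by fun_prop : Continuous fun u : ℝ => (u, y))).aestronglyMeasurable
  · exact (hf.continuous.comp (by fun_prop : Continuous fun u : ℝ => (u, x))).intervalIntegrable _ _
  · exact (hc.comp (by fun_prop : Continuous fun u : ℝ => (u, x))).aestronglyMeasurable
  · rw [uIoc_of_le zero_le_one] at hu
    exact hC (u, y) ⟨⟨hu.1.le, hu.2⟩, Metric.ball_subset_closedBall hy⟩
  · exact intervalIntegrable_const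
  · have h1 : HasFDerivAt f (fderiv ℝ f (u, y)) (u, y) :=
      (hf.differentiable (by norm_num)).differentiableAt.hasFDerivAt
    exact h1.comp y (hasFDerivAt_prodMk_right (𝕜 := ℝ) u y)

/-- Differentiation under the integral sign, by induction on `n`. The target space is generalized
because the derivative takes values in a space of linear maps. -/
theorem ContDiff.integral_unitInterval (n : ℕ) {F : Type} [NormedAddCommGroup F] [NormedSpace ℝ F]
    {f : ℝ × E → F} (hf : ContDiff ℝ n f) :
    ContDiff ℝ n (fun x => ∫ u in (0 : ℝ)..1, f (u, x)) := by
  induction n generalizing F with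
  | zero =>
    rw [Nat.cast_zero, contDiff_zero] at hf ⊢
    exact intervalIntegral.continuous_parametric_intervalIntegral_of_continuous'
      (f := fun x u => f (u, x)) (hf.comp continuous_swap) 0 1
  | succ n ih =>
    have h1 : ContDiff ℝ 1 f := hf.of_le (by exact_mod_cast Nat.le_add_left 1 n)
    rw [Nat.cast_succ, contDiff_succ_iff_hasFDerivAt]
    refine ⟨_, ih (f := fun p => (fderiv ℝ f p).comp (ContinuousLinearMap.inr ℝ ℝ E)) ?_,
      hasFDerivAt_integral_unitInterval h1⟩
    exact (hf.fderiv_right (by norm_cast)).clm_comp contDiff_const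

/-- For `t ≠ 0` the quotient is f(t, y) / t = ∫₀¹ ∂ₜf(ut, y) du, and the right-hand side also gives
the derivative at `t = 0`. One order of differentiability is lost. -/
theorem ContDiff.dslope_fst {n : ℕ} {f : ℝ × E → F} (hf : ContDiff ℝ (n + 1) f)
    (h0 : ∀ y, f (0, y) = 0) :
    ContDiff ℝ n (fun p : ℝ × E => dslope (fun t => f (t, p.2)) 0 p.1) := by
  have hd : ∀ t y, HasDerivAt (fun t => f (t, y)) (fderiv ℝ f (t, y) (1, 0)) t := fun t y => by
    have h1 : HasFDerivAt f (fderiv ℝ f (t, y)) (t, y) :=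
      (hf.differentiable (by simp)).differentiableAt.hasFDerivAt
    exact h1.comp_hasDerivAt t ((hasDerivAt_id t).prodMk (hasDerivAt_const t y))
  have hg : ContDiff ℝ n fun p => fderiv ℝ f p ((1 : ℝ), (0 : E)) :=
    (hf.fderiv_right le_rfl).clm_apply contDiff_const
  have key : (fun p : ℝ × E => dslope (fun t => f (t, p.2)) 0 p.1) =
      fun p : ℝ × E => ∫ u in (0 : ℝ)..1, fderiv ℝ f (u * p.1, p.2) ((1 : ℝ), (0 : E)) := by
    ext ⟨t, y⟩
    rcases eq_or_ne t 0 with rfl | ht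
    · simp [(hd 0 y).deriv]
    · have hs : ∫ u in (0 : ℝ)..1, t • fderiv ℝ f (u * t, y) ((1 : ℝ), (0 : E)) = f (t, y) := by
        have := intervalIntegral.integral_eq_sub_of_hasDerivAt (a := 0) (b := 1)
          (f := fun u => f (u * t, y)) (f' := fun u => t • fderiv ℝ f (u * t, y) ((1 : ℝ), (0 : E)))
          (fun u _ => by
            have := HasDerivAt.scomp (h := fun u : ℝ => u * t) u (hd (u * t) y)
              ((hasDerivAt_id u).mul_const t)
            rwa [one_mul] at this)
          (Continuous.intervalIntegrable (continuous_const.smul (hg.continuous.comp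
            (by fun_prop : Continuous fun u : ℝ => (u * t, y)))) _ _)
        simpa [h0] using this
      rw [intervalIntegral.integral_smul] at hs
      simp only
      rw [dslope_of_ne _ ht, slope_def_module, h0, sub_zero, sub_zero, ← hs, smul_smul,
        inv_mul_cancel₀ ht, one_smul]
  rw [key]
  refine ContDiff.integral_unitInterval n (f := fun q : ℝ × (ℝ × E) =>
    fderiv ℝ f (q.1 * q.2.1, q.2.2) ((1 : ℝ), (0 : E))) (hg.comp ?_)
  fun_prop

theorem dslope_congr_of_eventuallyEq {f g : ℝ → F} {t : ℝ} (h0 : f =ᶠ[𝓝 0] g) (ht : f t = g t) :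
    dslope f 0 t = dslope g 0 t := by
  rcases eq_or_ne t 0 with rfl | h
  · simp [h0.deriv_eq]
  · simp [dslope_of_ne _ h, slope_def_module, ht, h0.eq_of_nhds]

/-- Cutting off with a bump function reduces to the global case. The quotient near `(0, y₀)` only
sees `f` near that point, so the cut-off does not change its germ. The orders `n` are treated one at
a time because the neighbourhood on which `f` is of class Cⁿ may depend on `n`. -/
theorem ContDiffAt.dslope_fst {f : ℝ × E → F} {y₀ : E} (hf : ContDiffAt ℝ ∞ f (0, y₀))
    (h0 : ∀ᶠ y in 𝓝 y₀, f (0, y) = 0) :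
    ContDiffAt ℝ ∞ (fun p : ℝ × E => dslope (fun t => f (t, p.2)) 0 p.1) (0, y₀) := by
  rw [contDiffAt_infty]
  intro n
  have hf' : ContDiffAt ℝ (n + 1 : ℕ) f (0, y₀) := hf.of_le (by exact_mod_cast le_top)
  obtain ⟨u, hu, hfu⟩ := hf'.contDiffOn le_rfl (by simp)
  have hsnd : Tendsto (Prod.snd : ℝ × E → E) (𝓝 (0, y₀)) (𝓝 y₀) := continuous_snd.tendsto _
  obtain ⟨v, hv, hvo, hv0⟩ := mem_nhds_iff.1 (inter_mem hu (hsnd.eventually h0))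
  obtain ⟨χ, hχ⟩ : ∃ χ : ContDiffBump ((0, y₀) : ℝ × E), tsupport χ ⊆ v := by
    obtain ⟨ε, hε, hb⟩ := Metric.isOpen_iff.1 hvo _ hv0
    refine ⟨⟨ε / 4, ε / 2, by positivity, by linarith⟩, ?_⟩
    rw [ContDiffBump.tsupport_eq]
    exact (Metric.closedBall_subset_ball (by linarith)).trans hb
  set g : ℝ × E → F := fun p => χ p • f p
  have hg : ContDiff ℝ (n + 1) g := by
    rw [contDiff_iff_contDiffAt]
    intro p
    by_cases hp : p ∈ v
    · exact χ.contDiff.contDiffAt.smul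
        ((hfu.mono (hv.trans inter_subset_left)).contDiffAt (hvo.mem_nhds hp))
    · have : g =ᶠ[𝓝 p] fun _ => 0 := by
        have hp' : p ∈ (tsupport χ)ᶜ := fun h => hp (hχ h)
        filter_upwards [(isClosed_tsupport χ).isOpen_compl.mem_nhds hp'] with q hq
        simp [g, image_eq_zero_of_notMem_tsupport hq]
      exact contDiffAt_const.congr_of_eventuallyEq this
  have hg0 : ∀ y, g (0, y) = 0 := fun y => by
    by_cases hp : ((0, y) : ℝ × E) ∈ v
    · have : f (0, y) = 0 := (hv hp).2
      simp [g, this]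
    · simp [g, image_eq_zero_of_notMem_tsupport fun h => hp (hχ h)]
  refine (ContDiff.dslope_fst hg hg0).contDiffAt.congr_of_eventuallyEq ?_
  have hfg : f =ᶠ[𝓝 (0, y₀)] g := by
    filter_upwards [χ.eventuallyEq_one] with p hp
    simp [g, hp]
  have ht : Tendsto (fun p : ℝ × E => ((0 : ℝ), p.2)) (𝓝 (0, y₀)) (𝓝 (0, y₀)) :=
    (by fun_prop : Continuous fun p : ℝ × E => ((0 : ℝ), p.2)).tendsto' _ _ rfl
  filter_upwards [hfg, ht.eventually hfg.eventually_nhds] with p hp hp'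
  refine dslope_congr_of_eventuallyEq ?_ hp
  exact (by fun_prop : Continuous fun t : ℝ => (t, p.2)).continuousAt.eventually hp'

variable {H : Type*} [TopologicalSpace H] {I : ModelWithCorners ℝ E H} [I.Boundaryless]
  {W : Type*} [TopologicalSpace W] [ChartedSpace H W] [IsManifold I ∞ W]

/-- Hadamard's lemma with parameters in a manifold: if `f (t, x)` is smooth and vanishes for
`t = 0`, the quotient `f (t, x) / t` extends smoothly to `t = 0`. -/
theorem ContMDiffAt.dslope_fst {f : ℝ × W → F} {x₀ : W}
    (hf : ContMDiffAt (𝓘(ℝ, ℝ).prod I) 𝓘(ℝ, F) ∞ f (0, x₀))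
    (h0 : ∀ᶠ x in 𝓝 x₀, f (0, x) = 0) :
    ContMDiffAt (𝓘(ℝ, ℝ).prod I) 𝓘(ℝ, F) ∞
      (fun p : ℝ × W => dslope (fun t => f (t, p.2)) 0 p.1) (0, x₀) := by
  set c := extChartAt I x₀
  have hc0 : c.symm (c x₀) = x₀ := extChartAt_to_inv x₀
  have hsymm : ContMDiffAt 𝓘(ℝ, E) I ∞ c.symm (c x₀) :=
    (contMDiffOn_extChartAt_symm x₀).contMDiffAt (extChartAt_target_mem_nhds x₀)
  have h1 : ContDiffAt ℝ ∞ (fun p : ℝ × E => f (p.1, c.symm p.2)) (0, c x₀) := by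
    rw [← contMDiffAt_iff_contDiffAt]
    refine ContMDiffAt.comp (I' := 𝓘(ℝ, ℝ).prod I) (0, c x₀) (g := f)
      (f := fun p : ℝ × E => (p.1, c.symm p.2)) (by simpa only [hc0] using hf) ?_
    exact contDiffAt_fst.contMDiffAt.prodMk (hsymm.comp (0, c x₀) contDiffAt_snd.contMDiffAt)
  have h2 := ContDiffAt.dslope_fst h1 ((hsymm.continuousAt.eventually (by rwa [hc0])))
  have h3 : ContMDiffAt (𝓘(ℝ, ℝ).prod I) 𝓘(ℝ, ℝ × E) ∞ (fun p : ℝ × W => (p.1, c p.2)) (0, x₀) :=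
    contMDiffAt_fst.prodMk_space ((contMDiffAt_extChartAt (x := x₀)).comp (0, x₀) contMDiffAt_snd)
  refine (h2.contMDiffAt.comp (0, x₀) h3).congr_of_eventuallyEq ?_
  have hev : ∀ᶠ p : ℝ × W in 𝓝 (0, x₀), p.2 ∈ c.source :=
    (continuous_snd.tendsto _).eventually (extChartAt_source_mem_nhds x₀)
  filter_upwards [hev] with p hp
  simp only [Function.comp_apply, c.left_inv hp]

end Hadamard

/-! ### Smoothness of inverse bijections -/

section InverseFunction

open Filter

variable {E : Type*} [NormedAddCommGroup E] [NormedSpace ℝ E] [FiniteDimensional ℝ E]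
  {H : Type*} [TopologicalSpace H] {I : ModelWithCorners ℝ E H} [I.Boundaryless]
  {W : Type*} [TopologicalSpace W] [ChartedSpace H W] [IsManifold I ∞ W]

/-- The inverse of a bijection of a manifold is smooth where the bijection is a smooth immersion. -/
theorem ContMDiffAt.equiv_symm {e : W ≃ W} {x : W} (he : ContMDiffAt I I ∞ e x)
    (hinj : ∀ w : TangentSpace I x, mfderiv I I e x w = 0 → w = 0) :
    ContMDiffAt I I ∞ e.symm (e x) := by
  have hcomp : CompleteSpace E := FiniteDimensional.complete ℝ E
  set c := extChartAt I x
  set c' := extChartAt I (e x)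
  set f : E → E := fun y => c' (e (c.symm y)) with hf_def
  have hf : ContDiffAt ℝ ∞ f (c x) := by
    have := (contMDiffAt_iff.1 he).2
    rwa [I.range_eq_univ, contDiffWithinAt_univ] at this
  have hd : mfderiv I I e x = fderiv ℝ f (c x) := by
    rw [(he.mdifferentiableAt (by simp)).mfderiv, I.range_eq_univ, fderivWithin_univ]
    rfl
  -- An injective endomorphism of a finite-dimensional space is invertible, so the inverse function
  -- theorem applies in charts.
  have hinj' : Function.Injective (fderiv ℝ f (c x)).toLinearMap := by
    rw [← LinearMap.ker_eq_bot, LinearMap.ker_eq_bot']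
    intro w hw
    exact hinj w (by rw [hd]; exact hw)
  set L : E ≃L[ℝ] E := (LinearEquiv.ofInjectiveEndo _ hinj').toContinuousLinearEquiv
  have hL : HasFDerivAt f (L : E →L[ℝ] E) (c x) := by
    have : (L : E →L[ℝ] E) = fderiv ℝ f (c x) := by ext; rfl
    rw [this]
    exact (hf.differentiableAt (by simp)).hasFDerivAt
  have hs := hf.hasStrictFDerivAt' hL (by simp)
  have hg : ContDiffAt ℝ ∞ (hf.localInverse hL (by simp)) (f (c x)) :=
    hf.to_localInverse hL (by simp)
  have hr : ∀ᶠ y in 𝓝 (f (c x)), f (hf.localInverse hL (by simp) y) = y :=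
    hs.eventually_right_inverse
  have hg0 : hf.localInverse hL (by simp) (f (c x)) = c x := hf.localInverse_apply_image hL (by simp)
  set g := hf.localInverse hL (by simp)
  have hcx : c.symm (c x) = x := extChartAt_to_inv x
  have hfx : f (c x) = c' (e x) := by simp only [hf_def, hcx]
  rw [hfx] at hg hr hg0
  have hm : ContMDiffAt I I ∞ (fun y => c.symm (g (c' y))) (e x) := by
    have h1 : ContMDiffAt 𝓘(ℝ, E) I ∞ c.symm (g (c' (e x))) := by
      rw [hg0]
      exact (contMDiffOn_extChartAt_symm x).contMDiffAt (extChartAt_target_mem_nhds x)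
    exact h1.comp (e x) (hg.contMDiffAt.comp (e x) (contMDiffAt_extChartAt (x := e x)))
  -- The local inverse agrees with `e.symm`: by continuity its image under `e` stays in the chart
  -- domain at `e x`, where the chart is injective.
  refine hm.congr_of_eventuallyEq ?_
  have hcont : ContinuousAt (fun y => e (c.symm (g (c' y)))) (e x) := by
    refine ContinuousAt.comp (g := e) ?_ hm.continuousAt
    simpa only [hg0, hcx] using he.continuousAt
  have hsrc : ∀ᶠ y in 𝓝 (e x), e (c.symm (g (c' y))) ∈ c'.source :=
    hcont.eventually (by
      simp only [hg0, hcx]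
      exact extChartAt_source_mem_nhds (I := I) (e x))
  filter_upwards [hsrc, (continuousAt_extChartAt (I := I) (e x)).eventually hr,
    extChartAt_source_mem_nhds (I := I) (e x)] with y h1 h2 h3
  rw [e.symm_apply_eq]
  exact (c'.injOn h1 h3 h2).symm

end InverseFunction

/-! ### Smoothness in the two parametrizations of the glued manifold -/

section GluedSmoothness

variable {d₁ m₁ d₂ m₂ n : ℕ} [Fact (d₁ + m₁ = n)] [Fact (d₂ + m₂ = n)]
  {M₁ : Type*} [TopologicalSpace M₁] [ChartedSpace 𝔼[d₁] M₁] [IsManifold (𝓡 d₁) ∞ M₁]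
  {V₁ : M₁ → Type*} [∀ x, NormedAddCommGroup (V₁ x)] [∀ x, InnerProductSpace ℝ (V₁ x)]
  [TopologicalSpace (TotalSpace 𝔼[m₁] V₁)] [FiberBundle 𝔼[m₁] V₁] [VectorBundle ℝ 𝔼[m₁] V₁]
  [ContMDiffVectorBundle ∞ 𝔼[m₁] V₁ (𝓡 d₁)] [IsContMDiffRiemannianBundle (𝓡 d₁) ∞ 𝔼[m₁] V₁]
  {M₂ : Type*} [TopologicalSpace M₂] [ChartedSpace 𝔼[d₂] M₂] [IsManifold (𝓡 d₂) ∞ M₂]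
  {V₂ : M₂ → Type*} [∀ x, NormedAddCommGroup (V₂ x)] [∀ x, InnerProductSpace ℝ (V₂ x)]
  [TopologicalSpace (TotalSpace 𝔼[m₂] V₂)] [FiberBundle 𝔼[m₂] V₂] [VectorBundle ℝ 𝔼[m₂] V₂]
  [ContMDiffVectorBundle ∞ 𝔼[m₂] V₂ (𝓡 d₂)] [IsContMDiffRiemannianBundle (𝓡 d₂) ∞ 𝔼[m₂] V₂]
  (φ : SetDiffeo 𝓑[d₁, m₁] 𝓑[d₂, m₂] (sphereBundle m₁ V₁) (sphereBundle m₂ V₂))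

/-- Formulated for an abstract parametrization `P` so that it serves both `param₁` and `param₂`:
they are local diffeomorphisms because their composites with bundle charts are in the atlas. -/
theorem contMDiffAt_of_bundle_chart_mem {X : Type*} [TopologicalSpace X] [ChartedSpace 𝔼[n] X]
    [IsManifold (𝓡 n) ∞ X] (P : OpenPartialHomeomorph (TotalSpace 𝔼[m₁] V₁) X)
    {v : TotalSpace 𝔼[m₁] V₁} (hv : v ∈ P.source)
    (h : P.symm.trans ((chartAt (ModelProd 𝔼[d₁] 𝔼[m₁]) v).trans
      (modelEquiv d₁ m₁ n).toHomeomorph.toOpenPartialHomeomorph) ∈ atlas 𝔼[n] X) :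
    ContMDiffAt 𝓑[d₁, m₁] (𝓡 n) ∞ P v ∧ ContMDiffAt (𝓡 n) 𝓑[d₁, m₁] ∞ P.symm (P v) := by
  set k := chartAt (ModelProd 𝔼[d₁] 𝔼[m₁]) v
  set c := P.symm.trans (k.trans (modelEquiv d₁ m₁ n).toHomeomorph.toOpenPartialHomeomorph)
  have hc : c ∈ IsManifold.maximalAtlas (𝓡 n) ∞ X := IsManifold.subset_maximalAtlas h
  have hk : v ∈ k.source := mem_chart_source _ v
  have hPv : P v ∈ c.source := by
    simp [c, P.map_source hv, P.left_inv hv, hk]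
  have hcP : ∀ u ∈ P.source, c (P u) = modelEquiv d₁ m₁ n (k u) := fun u hu => by
    simp [c, P.left_inv hu]
  constructor
  · have h1 : ContMDiffAt (𝓡 n) (𝓡 n) ∞ c.symm (modelEquiv d₁ m₁ n (k v)) := by
      rw [← hcP v hv]
      exact contMDiffAt_symm_of_mem_maximalAtlas hc (c.map_source hPv)
    have h2 : ContMDiffAt 𝓑[d₁, m₁] 𝓑[d₁, m₁] ∞ k v :=
      contMDiffOn_chart.contMDiffAt (k.open_source.mem_nhds hk)
    refine (h1.comp v ((contMDiff_modelEquiv d₁ m₁ n _).comp v h2)).congr_of_eventuallyEq ?_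
    filter_upwards [P.open_source.mem_nhds hv, k.open_source.mem_nhds hk] with u hu hku
    rw [Function.comp_apply, Function.comp_apply, ← hcP u hu, c.left_inv]
    simp [c, P.map_source hu, P.left_inv hu, hku]
  · have h1 : ContMDiffAt (𝓡 n) (𝓡 n) ∞ c (P v) := contMDiffAt_of_mem_maximalAtlas hc hPv
    have h2 : ContMDiffAt 𝓑[d₁, m₁] 𝓑[d₁, m₁] ∞ k.symm
        ((modelEquiv d₁ m₁ n).symm (c (P v))) := by
      rw [hcP v hv, ContinuousLinearEquiv.symm_apply_apply]
      exact contMDiffOn_chart_symm.contMDiffAt (k.open_target.mem_nhds (k.map_source hk))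
    refine (h2.comp (P v) ((contMDiff_modelEquiv_symm d₁ m₁ n _).comp (P v) h1)).congr_of_eventuallyEq
      ?_
    filter_upwards [c.open_source.mem_nhds hPv] with g hg
    have hg' : g ∈ P.target ∧ P.symm g ∈ k.source := by simpa [c] using hg
    have := hcP (P.symm g) (P.map_target hg'.1)
    rw [P.right_inv hg'.1] at this
    rw [Function.comp_apply, Function.comp_apply, this, ContinuousLinearEquiv.symm_apply_apply,
      k.left_inv hg'.2]

theorem Glued.contMDiff_param₁ : ContMDiff 𝓑[d₁, m₁] (𝓡 n) ∞ (Glued.param₁ φ) := fun v => by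
  have : Nonempty (TotalSpace 𝔼[m₁] V₁) := ⟨v⟩
  exact (contMDiffAt_of_bundle_chart_mem (n := n) (d₁ := d₁)
    ((Glued.isOpenEmbedding_param₁ φ).toOpenPartialHomeomorph _) (v := v) (by simp)
    (mem_union_left _ (mem_range_self v))).1

theorem Glued.contMDiff_param₂ : ContMDiff 𝓑[d₂, m₂] (𝓡 n) ∞ (Glued.param₂ φ) := fun v => by
  have : Nonempty (TotalSpace 𝔼[m₂] V₂) := ⟨v⟩
  exact (contMDiffAt_of_bundle_chart_mem (n := n) (d₁ := d₂)
    ((Glued.isOpenEmbedding_param₂ φ).toOpenPartialHomeomorph _) (v := v) (by simp)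
    (mem_union_right _ (mem_range_self v))).1

theorem Glued.exists_contMDiffAt_inverse₁ (v : TotalSpace 𝔼[m₁] V₁) :
    ∃ G : Glued φ → TotalSpace 𝔼[m₁] V₁, ContMDiffAt (𝓡 n) 𝓑[d₁, m₁] ∞ G (Glued.param₁ φ v) ∧
      (∀ u, G (Glued.param₁ φ u) = u) ∧
      ∀ᶠ g in 𝓝 (Glued.param₁ φ v), Glued.param₁ φ (G g) = g := by
  have : Nonempty (TotalSpace 𝔼[m₁] V₁) := ⟨v⟩
  set P := (Glued.isOpenEmbedding_param₁ φ).toOpenPartialHomeomorph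
  exact ⟨P.symm, (contMDiffAt_of_bundle_chart_mem (n := n) (d₁ := d₁) P (v := v) (by simp [P])
    (mem_union_left _ (mem_range_self v))).2, fun u => P.left_inv (by simp [P]),
    P.eventually_right_inverse' (by simp [P])⟩

theorem Glued.exists_contMDiffAt_inverse₂ (v : TotalSpace 𝔼[m₂] V₂) :
    ∃ G : Glued φ → TotalSpace 𝔼[m₂] V₂, ContMDiffAt (𝓡 n) 𝓑[d₂, m₂] ∞ G (Glued.param₂ φ v) ∧
      (∀ u, G (Glued.param₂ φ u) = u) ∧
      ∀ᶠ g in 𝓝 (Glued.param₂ φ v), Glued.param₂ φ (G g) = g := by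
  have : Nonempty (TotalSpace 𝔼[m₂] V₂) := ⟨v⟩
  set P := (Glued.isOpenEmbedding_param₂ φ).toOpenPartialHomeomorph
  exact ⟨P.symm, (contMDiffAt_of_bundle_chart_mem (n := n) (d₁ := d₂) P (v := v) (by simp [P])
    (mem_union_right _ (mem_range_self v))).2, fun u => P.left_inv (by simp [P]),
    P.eventually_right_inverse' (by simp [P])⟩

variable {E' : Type*} [NormedAddCommGroup E'] [NormedSpace ℝ E'] {H' : Type*}
  [TopologicalSpace H'] {I' : ModelWithCorners ℝ E' H'} {X : Type*} [TopologicalSpace X]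
  [ChartedSpace H' X] {φ}

theorem Glued.contMDiffAt_of_comp_param₁ {F : Glued φ → X} {v : TotalSpace 𝔼[m₁] V₁}
    (h : ContMDiffAt 𝓑[d₁, m₁] I' ∞ (fun u => F (Glued.param₁ φ u)) v) :
    ContMDiffAt (𝓡 n) I' ∞ F (Glued.param₁ φ v) := by
  obtain ⟨G, hG, hl, hr⟩ := Glued.exists_contMDiffAt_inverse₁ (n := n) φ v
  have h' : ContMDiffAt 𝓑[d₁, m₁] I' ∞ (fun u => F (Glued.param₁ φ u)) (G (Glued.param₁ φ v)) := by
    rwa [hl]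
  refine (h'.comp _ hG).congr_of_eventuallyEq ?_
  filter_upwards [hr] with g hg
  rw [Function.comp_apply, hg]

theorem Glued.contMDiffAt_of_comp_param₂ {F : Glued φ → X} {v : TotalSpace 𝔼[m₂] V₂}
    (h : ContMDiffAt 𝓑[d₂, m₂] I' ∞ (fun u => F (Glued.param₂ φ u)) v) :
    ContMDiffAt (𝓡 n) I' ∞ F (Glued.param₂ φ v) := by
  obtain ⟨G, hG, hl, hr⟩ := Glued.exists_contMDiffAt_inverse₂ (n := n) φ v
  have h' : ContMDiffAt 𝓑[d₂, m₂] I' ∞ (fun u => F (Glued.param₂ φ u)) (G (Glued.param₂ φ v)) := by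
    rwa [hl]
  refine (h'.comp _ hG).congr_of_eventuallyEq ?_
  filter_upwards [hr] with g hg
  rw [Function.comp_apply, hg]

theorem Glued.contMDiffAt_of_param₁_comp {g : X → TotalSpace 𝔼[m₁] V₁} {x : X}
    (h : ContMDiffAt I' (𝓡 n) ∞ (fun y => Glued.param₁ φ (g y)) x) :
    ContMDiffAt I' 𝓑[d₁, m₁] ∞ g x := by
  obtain ⟨G, hG, hl, -⟩ := Glued.exists_contMDiffAt_inverse₁ (n := n) φ (g x)
  refine (hG.comp x h).congr_of_eventuallyEq (.of_forall fun y => ?_)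
  exact (hl (g y)).symm

/-- Points of `param₁` of norm at least `1` also lie in the range of `param₂`. Hence only the open
disk bundle has to be tested on the first side. -/
theorem Glued.contMDiff_of_comp {F : Glued φ → X}
    (h₁ : ∀ v : TotalSpace 𝔼[m₁] V₁, ‖v.2‖ < 1 →
      ContMDiffAt 𝓑[d₁, m₁] I' ∞ (fun u => F (Glued.param₁ φ u)) v)
    (h₂ : ContMDiff 𝓑[d₂, m₂] I' ∞ (fun u => F (Glued.param₂ φ u))) :
    ContMDiff (𝓡 n) I' ∞ F := by
  intro g
  rcases Glued.param_cover φ g with ⟨v, rfl⟩ | ⟨w, rfl⟩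
  · rcases lt_or_ge ‖v.2‖ 1 with h | h
    · exact Glued.contMDiffAt_of_comp_param₁ (h₁ v h)
    · have hv : v.2 ≠ 0 := by
        rw [← norm_ne_zero_iff]
        exact (zero_lt_one.trans_le h).ne'
      rw [Glued.param₁_eq_param₂ φ v hv]
      exact Glued.contMDiffAt_of_comp_param₂ (h₂ _)
  · exact Glued.contMDiffAt_of_comp_param₂ (h₂ w)

end GluedSmoothness

noncomputable section

/-! ### Polar coordinates and radial extensions -/

section Polar

variable {m : ℕ} {M : Type*} [TopologicalSpace M] {V : M → Type*} [∀ x, NormedAddCommGroup (V x)]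
  [∀ x, InnerProductSpace ℝ (V x)] [TopologicalSpace (TotalSpace 𝔼[m] V)] [FiberBundle 𝔼[m] V]

/-- The unit vector in the direction of a nonzero vector. -/
def direction (v : TotalSpace 𝔼[m] V) : TotalSpace 𝔼[m] V := scale ‖v.2‖⁻¹ v

theorem direction_mem {v : TotalSpace 𝔼[m] V} (hv : v.2 ≠ 0) : direction v ∈ sphereBundle m V :=
  norm_scale_inv hv

theorem scale_direction {v : TotalSpace 𝔼[m] V} (hv : v.2 ≠ 0) : scale ‖v.2‖ (direction v) = v := by
  rw [direction, scale_scale, mul_inv_cancel₀ (norm_ne_zero_iff.2 hv), scale_one]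

theorem norm_scale_sphere {s : TotalSpace 𝔼[m] V} (hs : s ∈ sphereBundle m V) {r : ℝ} (hr : 0 ≤ r) :
    ‖(scale r s).2‖ = r := by
  rw [norm_scale, show ‖s.2‖ = 1 from hs, mul_one, abs_of_nonneg hr]

theorem direction_scale {v : TotalSpace 𝔼[m] V} {r : ℝ} (hr : 0 < r) :
    direction (scale r v) = direction v := by
  rw [direction, direction, norm_scale, scale_scale, abs_of_pos hr]
  congr 1
  field_simp

theorem direction_of_mem {s : TotalSpace 𝔼[m] V} (hs : s ∈ sphereBundle m V) : direction s = s := by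
  rw [direction, show ‖s.2‖ = 1 from hs, inv_one, scale_one]

theorem ne_zero_of_mem_sphereBundle {s : TotalSpace 𝔼[m] V} (hs : s ∈ sphereBundle m V) :
    s.2 ≠ 0 := by
  rw [← norm_ne_zero_iff, show ‖s.2‖ = 1 from hs]
  exact one_ne_zero

theorem ne_zero_of_one_le {v : TotalSpace 𝔼[m] V} (h : 1 ≤ ‖v.2‖) : v.2 ≠ 0 :=
  norm_ne_zero_iff.1 (zero_lt_one.trans_le h).ne'

/-- Outside the open unit disk bundle, `W` is the radial extension of the map `w` of the unit sphere
bundle. -/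
def ExtendsRadially (W : TotalSpace 𝔼[m] V → TotalSpace 𝔼[m] V)
    (w : sphereBundle m V → sphereBundle m V) : Prop :=
  ∀ (s : sphereBundle m V) (r : ℝ), 1 ≤ r → W (scale r s) = scale r (w s)

theorem exists_eq_scale {v : TotalSpace 𝔼[m] V} (hv : v.2 ≠ 0) :
    ∃ s : sphereBundle m V, v = scale ‖v.2‖ s :=
  ⟨⟨direction v, direction_mem hv⟩, (scale_direction hv).symm⟩

theorem ExtendsRadially.norm_eq {W : TotalSpace 𝔼[m] V → TotalSpace 𝔼[m] V}
    {w : sphereBundle m V → sphereBundle m V} (h : ExtendsRadially W w) {v : TotalSpace 𝔼[m] V}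
    (hv : 1 ≤ ‖v.2‖) : ‖(W v).2‖ = ‖v.2‖ := by
  obtain ⟨s, hs⟩ := exists_eq_scale (ne_zero_of_one_le hv)
  rw [hs, h s _ hv, norm_scale_sphere (w s).2 (norm_nonneg _), norm_scale_sphere s.2 (norm_nonneg _)]

theorem ExtendsRadially.symm {W : TotalSpace 𝔼[m] V ≃ TotalSpace 𝔼[m] V}
    {w : sphereBundle m V ≃ sphereBundle m V} (h : ExtendsRadially W w) :
    ExtendsRadially W.symm w.symm := fun s r hr => by
  rw [W.symm_apply_eq, h _ r hr, w.apply_symm_apply]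

theorem ExtendsRadially.norm_le {W : TotalSpace 𝔼[m] V ≃ TotalSpace 𝔼[m] V}
    {w : sphereBundle m V ≃ sphereBundle m V} (h : ExtendsRadially W w) {v : TotalSpace 𝔼[m] V}
    (hv : ‖v.2‖ ≤ 1) : ‖(W v).2‖ ≤ 1 := by
  by_contra! hW
  have := h.symm.norm_eq hW.le
  rw [W.symm_apply_apply] at this
  linarith

end Polar

/-! ### The height function and its level sets, the leaves -/

section Height

variable {d₁ m₁ d₂ m₂ : ℕ}
  {M₁ : Type*} [TopologicalSpace M₁] [ChartedSpace 𝔼[d₁] M₁]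
  {V₁ : M₁ → Type*} [∀ x, NormedAddCommGroup (V₁ x)] [∀ x, InnerProductSpace ℝ (V₁ x)]
  [TopologicalSpace (TotalSpace 𝔼[m₁] V₁)] [FiberBundle 𝔼[m₁] V₁]
  {M₂ : Type*} [TopologicalSpace M₂] [ChartedSpace 𝔼[d₂] M₂]
  {V₂ : M₂ → Type*} [∀ x, NormedAddCommGroup (V₂ x)] [∀ x, InnerProductSpace ℝ (V₂ x)]
  [TopologicalSpace (TotalSpace 𝔼[m₂] V₂)] [FiberBundle 𝔼[m₂] V₂]
  (φ : SetDiffeo 𝓑[d₁, m₁] 𝓑[d₂, m₂] (sphereBundle m₁ V₁) (sphereBundle m₂ V₂))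

/-- The signed distance to the seam of `E₊ ∪_φ E₋`, whose level sets are the leaves. -/
def Glued.height : Glued φ → ℝ :=
  Quot.lift (Sum.elim (fun x => ‖x.1.2‖ - 1) (fun y => 1 - ‖y.1.2‖)) (by
    rintro _ _ ⟨s⟩
    have h1 : ‖s.1.2‖ = 1 := s.2
    have h2 : ‖(φ s).1.2‖ = 1 := (φ s).2
    simp [sphereToDisk, h1, h2])

theorem Glued.height_inl (x : diskBundle m₁ V₁) :
    Glued.height φ (Glued.inl φ x) = ‖x.1.2‖ - 1 := rfl

theorem Glued.height_inr (y : diskBundle m₂ V₂) :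
    Glued.height φ (Glued.inr φ y) = 1 - ‖y.1.2‖ := rfl

theorem Glued.exists_rep (g : Glued φ) :
    (∃ x, Glued.inl φ x = g) ∨ ∃ y, Glued.inr φ y = g := by
  induction g using Quot.ind with | mk p =>
  rcases p with x | y
  · exact .inl ⟨x, rfl⟩
  · exact .inr ⟨y, rfl⟩

theorem Glued.height_mem_Icc (g : Glued φ) : Glued.height φ g ∈ Icc (-1 : ℝ) 1 := by
  rcases Glued.exists_rep φ g with ⟨x, rfl⟩ | ⟨y, rfl⟩
  · have h1 : ‖x.1.2‖ ≤ 1 := x.2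
    have := norm_nonneg x.1.2
    rw [Glued.height_inl]
    constructor <;> linarith
  · have h1 : ‖y.1.2‖ ≤ 1 := y.2
    have := norm_nonneg y.1.2
    rw [Glued.height_inr]
    constructor <;> linarith

theorem Glued.exists_inl_of_height_nonpos {g : Glued φ} (h : Glued.height φ g ≤ 0) :
    ∃ x, Glued.inl φ x = g := by
  rcases Glued.exists_rep φ g with ⟨x, rfl⟩ | ⟨y, rfl⟩
  · exact ⟨x, rfl⟩
  · rw [Glued.height_inr] at h
    have h1 : ‖y.1.2‖ = 1 := le_antisymm y.2 (by linarith)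
    refine ⟨sphereToDisk (φ.symm ⟨y.1, h1⟩), ?_⟩
    rw [Glued.inl_eq_inr, show φ (φ.symm ⟨y.1, h1⟩) = _ from φ.toEquiv.apply_symm_apply _]
    rfl

theorem Glued.exists_inr_of_height_nonneg {g : Glued φ} (h : 0 ≤ Glued.height φ g) :
    ∃ y, Glued.inr φ y = g := by
  rcases Glued.exists_rep φ g with ⟨x, rfl⟩ | ⟨y, rfl⟩
  · rw [Glued.height_inl] at h
    have h1 : ‖x.1.2‖ = 1 := le_antisymm x.2 (by linarith)
    exact ⟨sphereToDisk (φ ⟨x.1, h1⟩), (Glued.inl_eq_inr φ ⟨x.1, h1⟩).symm⟩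
  · exact ⟨y, rfl⟩

theorem Glued.inl_image_eq {r : ℝ} (hr : r ≤ 1) :
    Glued.inl φ '' {x | ‖x.1.2‖ = r} = {g | Glued.height φ g = r - 1} := by
  ext g
  constructor
  · rintro ⟨x, hx, rfl⟩
    simp only [mem_ofPred_eq] at hx ⊢
    rw [Glued.height_inl, hx]
  · intro (hg : Glued.height φ g = r - 1)
    obtain ⟨x, rfl⟩ := Glued.exists_inl_of_height_nonpos φ (g := g) (by linarith)
    rw [Glued.height_inl] at hg
    exact ⟨x, by simp only [mem_ofPred_eq]; linarith, rfl⟩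

theorem Glued.inr_image_eq {r : ℝ} (hr : r ≤ 1) :
    Glued.inr φ '' {x | ‖x.1.2‖ = r} = {g | Glued.height φ g = 1 - r} := by
  ext g
  constructor
  · rintro ⟨x, hx, rfl⟩
    simp only [mem_ofPred_eq] at hx ⊢
    rw [Glued.height_inr, hx]
  · intro (hg : Glued.height φ g = 1 - r)
    obtain ⟨x, rfl⟩ := Glued.exists_inr_of_height_nonneg φ (g := g) (by linarith)
    rw [Glued.height_inr] at hg
    exact ⟨x, by simp only [mem_ofPred_eq]; linarith, rfl⟩

theorem mem_leaves_iff {L : Set (Glued φ)} :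
    L ∈ leaves φ ↔ ∃ c ∈ Icc (-1 : ℝ) 1, L = {g | Glued.height φ g = c} := by
  constructor
  · rintro ⟨r, ⟨hr0, hr1⟩, rfl | rfl⟩
    · exact ⟨r - 1, ⟨by linarith, by linarith⟩, Glued.inl_image_eq φ hr1⟩
    · exact ⟨1 - r, ⟨by linarith, by linarith⟩, Glued.inr_image_eq φ hr1⟩
  · rintro ⟨c, ⟨h1, h2⟩, rfl⟩
    rcases le_total c 0 with hc | hc
    · refine ⟨c + 1, ⟨by linarith, by linarith⟩, .inl ?_⟩
      rw [Glued.inl_image_eq φ (by linarith), add_sub_cancel_right]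
    · refine ⟨1 - c, ⟨by linarith, by linarith⟩, .inr ?_⟩
      rw [Glued.inr_image_eq φ (by linarith), sub_sub_cancel]

theorem Glued.height_swapHomeo (g : Glued φ.symm) :
    Glued.height φ (Glued.swapHomeo φ g) = -Glued.height φ.symm g := by
  induction g using Quot.ind with | mk p =>
  rcases p with x | y
  · change 1 - ‖x.1.2‖ = -(‖x.1.2‖ - 1)
    ring
  · change ‖y.1.2‖ - 1 = -(1 - ‖y.1.2‖)
    ring

theorem Glued.height_param₁ (v : TotalSpace 𝔼[m₁] V₁) :
    Glued.height φ (Glued.param₁ φ v) = if ‖v.2‖ ≤ 1 then ‖v.2‖ - 1 else 1 - ‖v.2‖⁻¹ := by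
  split_ifs with h
  · rw [Glued.param₁_of_le φ h, Glued.height_inl]
  · rw [Glued.param₁_of_ge φ (ne_zero_of_not_le h) (not_le.1 h).le, Glued.height_inr, norm_inversion]

theorem Glued.height_param₂ (v : TotalSpace 𝔼[m₂] V₂) :
    Glued.height φ (Glued.param₂ φ v) = -if ‖v.2‖ ≤ 1 then ‖v.2‖ - 1 else 1 - ‖v.2‖⁻¹ := by
  rw [Glued.swap_param₁, Function.comp_apply, Glued.height_swapHomeo, Glued.height_param₁]

/-- The function is the height in `param₁` in terms of the norm `r`: beyond the seam, `param₁` runs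
through E₋ at radius `r⁻¹`. -/
theorem heightProfile_injOn :
    InjOn (fun r : ℝ => if r ≤ 1 then r - 1 else 1 - r⁻¹) (Ici 0) := by
  intro r _ s _ h
  simp only at h
  split_ifs at h with h1 h2 h2
  · linarith
  · have := inv_lt_one_of_one_lt₀ (not_le.1 h2)
    linarith
  · have := inv_lt_one_of_one_lt₀ (not_le.1 h1)
    linarith
  · exact inv_injective (by linarith)

theorem Glued.height_param₁_eq_iff {ψ : SetDiffeo 𝓑[d₁, m₁] 𝓑[d₂, m₂] (sphereBundle m₁ V₁)
    (sphereBundle m₂ V₂)} {v w : TotalSpace 𝔼[m₁] V₁} :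
    Glued.height φ (Glued.param₁ φ v) = Glued.height ψ (Glued.param₁ ψ w) ↔ ‖v.2‖ = ‖w.2‖ := by
  rw [Glued.height_param₁, Glued.height_param₁]
  exact heightProfile_injOn.eq_iff (norm_nonneg _) (norm_nonneg _)

theorem Glued.height_param₁_eq_neg_one {v : TotalSpace 𝔼[m₁] V₁} :
    Glued.height φ (Glued.param₁ φ v) = -1 ↔ v.2 = 0 := by
  have := heightProfile_injOn.eq_iff (norm_nonneg v.2) (le_refl (0 : ℝ))
  rw [Glued.height_param₁, ← norm_eq_zero, ← this]
  norm_num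

theorem Glued.range_param₁ : range (Glued.param₁ φ) = {g | Glued.height φ g ≠ 1} := by
  ext g
  constructor
  · rintro ⟨v, rfl⟩
    simp only [mem_ofPred_eq, Glued.height_param₁]
    split_ifs with h
    · linarith
    · have := inv_pos.2 (zero_lt_one.trans (not_le.1 h))
      linarith
  · intro (hg : Glued.height φ g ≠ 1)
    rcases Glued.exists_rep φ g with ⟨x, rfl⟩ | ⟨y, rfl⟩
    · exact ⟨x.1, Glued.param₁_of_le φ x.2⟩
    · have hy : y.1.2 ≠ 0 := fun h => hg (by rw [Glued.height_inr, h, norm_zero, sub_zero])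
      exact ⟨_, Glued.param₁_of_back φ _ _ (Glued.back_inr φ hy)⟩

variable {φ}

/-- The map `E₊ ∪_φ E₋ → E₊ ∪_ψ E₋` that is the identity on `E₊` and `W` on `E₋`. -/
def Glued.mapInr {ψ : SetDiffeo 𝓑[d₁, m₁] 𝓑[d₂, m₂] (sphereBundle m₁ V₁) (sphereBundle m₂ V₂)}
    {W : TotalSpace 𝔼[m₂] V₂ ≃ TotalSpace 𝔼[m₂] V₂} {w : sphereBundle m₂ V₂ ≃ sphereBundle m₂ V₂}
    (hW : ExtendsRadially W w) (hw : ∀ s, ψ s = w (φ s)) : Glued φ → Glued ψ :=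
  Quot.lift (Sum.elim (Glued.inl ψ) (fun y => Glued.inr ψ ⟨W y, hW.norm_le y.2⟩)) (by
    rintro _ _ ⟨s⟩
    simp only [Sum.elim_inl, Sum.elim_inr]
    rw [Glued.inl_eq_inr]
    congr 1
    ext1
    have := hW (φ s) 1 le_rfl
    rw [scale_one, scale_one] at this
    exact ((congrArg Subtype.val (hw s)).trans this.symm))

variable {ψ : SetDiffeo 𝓑[d₁, m₁] 𝓑[d₂, m₂] (sphereBundle m₁ V₁) (sphereBundle m₂ V₂)}
    {W : TotalSpace 𝔼[m₂] V₂ ≃ TotalSpace 𝔼[m₂] V₂} {w : sphereBundle m₂ V₂ ≃ sphereBundle m₂ V₂}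
    (hW : ExtendsRadially W w) (hw : ∀ s, ψ s = w (φ s))

theorem Glued.mapInr_param₁ {v : TotalSpace 𝔼[m₁] V₁} (hv : ‖v.2‖ ≤ 1) :
    Glued.mapInr hW hw (Glued.param₁ φ v) = Glued.param₁ ψ v := by
  rw [Glued.param₁_of_le φ hv, Glued.param₁_of_le ψ hv]
  rfl

/-- Outside the disk bundle `param₂` runs through E₊, where the map is the identity. There the
formula holds since `W` is radial and ψ⁻¹ (w s) = φ⁻¹ s. This is what makes the map smooth across
the seam. -/
theorem Glued.mapInr_param₂ (v : TotalSpace 𝔼[m₂] V₂) :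
    Glued.mapInr hW hw (Glued.param₂ φ v) = Glued.param₂ ψ (W v) := by
  by_cases hv : ‖v.2‖ ≤ 1
  · rw [Glued.param₂_of_le φ hv, Glued.param₂_of_le ψ (hW.norm_le hv)]
    rfl
  · have hv1 : 1 < ‖v.2‖ := not_le.1 hv
    have hW1 : ¬ ‖(W v).2‖ ≤ 1 := by rwa [hW.norm_eq hv1.le]
    rw [Glued.param₂, dif_neg hv, Glued.param₂, dif_neg hW1]
    obtain ⟨s, hs⟩ := exists_eq_scale (ne_zero_of_not_le hv)
    have hWs := hW s _ hv1.le
    rw [← hs] at hWs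
    refine congrArg (Glued.inl ψ) (Subtype.ext ?_)
    simp only
    rw [inversion_eq φ.symm _ (zero_lt_one.trans hv1) s hs,
      inversion_eq ψ.symm _ (zero_lt_one.trans hv1) (w s) hWs]
    congr 2
    refine (φ.toEquiv.symm_apply_eq.2 (w.injective ?_))
    rw [← hw]
    exact (ψ.toEquiv.apply_symm_apply _).symm

theorem Glued.mapInr_symm (hw' : ∀ s, φ s = w.symm (ψ s)) (g : Glued φ) :
    Glued.mapInr hW.symm hw' (Glued.mapInr hW hw g) = g := by
  rcases Glued.exists_rep φ g with ⟨x, rfl⟩ | ⟨y, rfl⟩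
  · rfl
  · exact congrArg (Glued.inr φ) (Subtype.ext (W.symm_apply_apply _))

theorem Glued.height_mapInr (hn : ∀ v, ‖(W v).2‖ = ‖v.2‖) (g : Glued φ) :
    Glued.height ψ (Glued.mapInr hW hw g) = Glued.height φ g := by
  rcases Glued.exists_rep φ g with ⟨x, rfl⟩ | ⟨y, rfl⟩
  · rfl
  · change 1 - ‖(W y.1).2‖ = 1 - ‖y.1.2‖
    rw [hn]

end Height

/-! ### Diffeomorphisms between glued manifolds -/

section GluedDiffeomorph

variable {d₁ m₁ d₂ m₂ n : ℕ} [Fact (d₁ + m₁ = n)] [Fact (d₂ + m₂ = n)]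
  {M₁ : Type*} [TopologicalSpace M₁] [ChartedSpace 𝔼[d₁] M₁] [IsManifold (𝓡 d₁) ∞ M₁]
  {V₁ : M₁ → Type*} [∀ x, NormedAddCommGroup (V₁ x)] [∀ x, InnerProductSpace ℝ (V₁ x)]
  [TopologicalSpace (TotalSpace 𝔼[m₁] V₁)] [FiberBundle 𝔼[m₁] V₁] [VectorBundle ℝ 𝔼[m₁] V₁]
  [ContMDiffVectorBundle ∞ 𝔼[m₁] V₁ (𝓡 d₁)] [IsContMDiffRiemannianBundle (𝓡 d₁) ∞ 𝔼[m₁] V₁]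
  {M₂ : Type*} [TopologicalSpace M₂] [ChartedSpace 𝔼[d₂] M₂] [IsManifold (𝓡 d₂) ∞ M₂]
  {V₂ : M₂ → Type*} [∀ x, NormedAddCommGroup (V₂ x)] [∀ x, InnerProductSpace ℝ (V₂ x)]
  [TopologicalSpace (TotalSpace 𝔼[m₂] V₂)] [FiberBundle 𝔼[m₂] V₂] [VectorBundle ℝ 𝔼[m₂] V₂]
  [ContMDiffVectorBundle ∞ 𝔼[m₂] V₂ (𝓡 d₂)] [IsContMDiffRiemannianBundle (𝓡 d₂) ∞ 𝔼[m₂] V₂]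
  {φ ψ : SetDiffeo 𝓑[d₁, m₁] 𝓑[d₂, m₂] (sphereBundle m₁ V₁) (sphereBundle m₂ V₂)}

theorem Glued.contMDiff_mapInr {W : TotalSpace 𝔼[m₂] V₂ ≃ TotalSpace 𝔼[m₂] V₂}
    {w : sphereBundle m₂ V₂ ≃ sphereBundle m₂ V₂} (hW : ExtendsRadially W w)
    (hw : ∀ s, ψ s = w (φ s)) (hs : ContMDiff 𝓑[d₂, m₂] 𝓑[d₂, m₂] ∞ W) :
    ContMDiff (𝓡 n) (𝓡 n) ∞ (Glued.mapInr hW hw) := by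
  refine Glued.contMDiff_of_comp (fun v hv => ?_) ?_
  · refine (Glued.contMDiff_param₁ ψ v).congr_of_eventuallyEq ?_
    filter_upwards [(continuous_norm_bundle (m := m₁) (V := V₁) d₁).continuousAt.eventually_lt
      continuousAt_const hv] with u hu
    exact Glued.mapInr_param₁ hW hw hu.le
  · simp_rw [Glued.mapInr_param₂]
    exact (Glued.contMDiff_param₂ ψ).comp hs

/-- Composing the gluing map with a diffeomorphism `w` of `∂E₋` that is radially extended by a
diffeomorphism `W` does not change the diffeomorphism type. -/
theorem Glued.exists_diffeomorph (W : TotalSpace 𝔼[m₂] V₂ ≃ₘ^∞⟮𝓑[d₂, m₂], 𝓑[d₂, m₂]⟯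
      TotalSpace 𝔼[m₂] V₂) {w : sphereBundle m₂ V₂ ≃ sphereBundle m₂ V₂}
    (hW : ExtendsRadially W.toEquiv w) (hw : ∀ s, ψ s = w (φ s)) :
    ∃ F : Glued φ ≃ₘ^∞⟮𝓡 n, 𝓡 n⟯ Glued ψ,
      (∀ v, ‖(W v).2‖ = ‖v.2‖) → ∀ g, Glued.height ψ (F g) = Glued.height φ g := by
  have hw' : ∀ s, φ s = w.symm (ψ s) := fun s => by rw [hw, w.symm_apply_apply]
  exact ⟨{  toFun := Glued.mapInr hW hw
            invFun := Glued.mapInr hW.symm hw'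
            left_inv := Glued.mapInr_symm hW hw hw'
            right_inv := Glued.mapInr_symm hW.symm hw' hw
            contMDiff_toFun := Glued.contMDiff_mapInr hW hw W.contMDiff
            contMDiff_invFun := Glued.contMDiff_mapInr hW.symm hw' W.symm.contMDiff },
    fun hn g => Glued.height_mapInr hW hw hn g⟩

variable (n φ) in
theorem Glued.contMDiff_swap : ContMDiff (𝓡 n) (𝓡 n) ∞ (Glued.swapHomeo φ) := by
  refine Glued.contMDiff_of_comp (fun v _ => ?_) ?_
  · refine (Glued.contMDiff_param₂ φ v).congr_of_eventuallyEq (.of_forall fun u => ?_)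
    rw [Glued.swap_param₁, Function.comp_apply]
  · refine (Glued.contMDiff_param₁ φ).congr fun u => ?_
    rw [Glued.swap_param₁ φ.symm]
    exact (Glued.swapHomeo φ).apply_symm_apply (Glued.param₁ φ u)

variable (n φ) in
/-- Exchanging the two sides, as a diffeomorphism. -/
def Glued.swapDiffeomorph : Glued φ.symm ≃ₘ^∞⟮𝓡 n, 𝓡 n⟯ Glued φ where
  toEquiv := (Glued.swapHomeo φ).toEquiv
  contMDiff_toFun := Glued.contMDiff_swap n φ
  contMDiff_invFun := Glued.contMDiff_swap n φ.symm

variable (n φ) in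
theorem Glued.height_swapDiffeomorph (g : Glued φ.symm) :
    Glued.height φ (Glued.swapDiffeomorph n φ g) = -Glued.height φ.symm g :=
  Glued.height_swapHomeo φ g

variable (n φ ψ) in
/-- There is a diffeomorphism of glued manifolds that preserves the height. -/
def HeightEquivalent : Prop :=
  ∃ F : Glued φ ≃ₘ^∞⟮𝓡 n, 𝓡 n⟯ Glued ψ, ∀ g, Glued.height ψ (F g) = Glued.height φ g

theorem HeightEquivalent.symm (h : HeightEquivalent n φ ψ) : HeightEquivalent n ψ φ := by
  obtain ⟨F, hF⟩ := h
  refine ⟨F.symm, fun g => ?_⟩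
  rw [← hF, F.apply_symm_apply]

theorem HeightEquivalent.trans
    {χ : SetDiffeo 𝓑[d₁, m₁] 𝓑[d₂, m₂] (sphereBundle m₁ V₁) (sphereBundle m₂ V₂)}
    (h : HeightEquivalent n φ ψ) (h' : HeightEquivalent n ψ χ) : HeightEquivalent n φ χ := by
  obtain ⟨F, hF⟩ := h
  obtain ⟨F', hF'⟩ := h'
  exact ⟨F.trans F', fun g => (hF' _).trans (hF g)⟩

/-- Exchanging the sides reverses the sign of the height, and the two reversals cancel. Results on
composing the gluing map with a diffeomorphism of ∂E₋ thereby carry over to ∂E₊. -/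
theorem HeightEquivalent.swap (h : HeightEquivalent n φ.symm ψ.symm) : HeightEquivalent n φ ψ := by
  obtain ⟨F, hF⟩ := h
  refine ⟨((Glued.swapDiffeomorph n φ).symm.trans F).trans (Glued.swapDiffeomorph n ψ), fun g => ?_⟩
  have h1 := Glued.height_swapDiffeomorph n ψ (F ((Glued.swapDiffeomorph n φ).symm g))
  have h2 := Glued.height_swapDiffeomorph n φ ((Glued.swapDiffeomorph n φ).symm g)
  rw [(Glued.swapDiffeomorph n φ).apply_symm_apply] at h2
  rw [hF, ← h2] at h1
  exact h1

theorem HeightEquivalent.foliatedEquivalent (h : HeightEquivalent n φ ψ) :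
    FoliatedEquivalent n φ ψ := by
  obtain ⟨F, hF⟩ := h
  refine ⟨F, fun L hL => ?_⟩
  obtain ⟨c, hc, rfl⟩ := (mem_leaves_iff φ).1 hL
  refine (mem_leaves_iff ψ).2 ⟨c, hc, ?_⟩
  ext g
  constructor
  · rintro ⟨g, hg, rfl⟩
    exact (hF g).trans hg
  · intro hg
    exact ⟨F.symm g, by rw [mem_ofPred_eq, ← hF, F.apply_symm_apply]; exact hg, F.apply_symm_apply g⟩

end GluedDiffeomorph

/-! ### Radius-dependent diffeomorphisms of the sphere bundle -/

section RadialDiffeomorphisms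

variable {d m : ℕ} {M : Type*} [TopologicalSpace M] [ChartedSpace 𝔼[d] M] [IsManifold (𝓡 d) ∞ M]
  {V : M → Type*} [∀ x, NormedAddCommGroup (V x)] [∀ x, InnerProductSpace ℝ (V x)]
  [TopologicalSpace (TotalSpace 𝔼[m] V)] [FiberBundle 𝔼[m] V] [VectorBundle ℝ 𝔼[m] V]
  [ContMDiffVectorBundle ∞ 𝔼[m] V (𝓡 d)] [IsContMDiffRiemannianBundle (𝓡 d) ∞ 𝔼[m] V]

theorem SetDiffeo.ext_apply {f g : SphereDiffeo d m V} (h : ∀ s, f s = g s) : f = g := by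
  obtain ⟨f, _, _⟩ := f
  obtain ⟨g, _, _⟩ := g
  obtain rfl : f = g := Equiv.ext h
  rfl

variable (d) in
theorem contMDiffOn_direction :
    ContMDiffOn 𝓑[d, m] 𝓑[d, m] ∞ (direction : TotalSpace 𝔼[m] V → _) {v | v.2 ≠ 0} :=
  contMDiffOn_scale (contMDiffOn_norm_inv d) contMDiffOn_id

variable (d) in
theorem contMDiffOn_norm :
    ContMDiffOn 𝓑[d, m] 𝓘(ℝ, ℝ) ∞ (fun v : TotalSpace 𝔼[m] V => ‖v.2‖) {v | v.2 ≠ 0} := by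
  intro v hv
  have hv' : inner ℝ v.2 v.2 ≠ 0 := by simpa using hv
  refine (((Real.contDiffAt_sqrt hv').contMDiffAt.comp v
    (contMDiff_normSq (V := V) d v)).congr_of_eventuallyEq (.of_forall fun u => ?_)).contMDiffWithinAt
  rw [Function.comp_apply, norm_eq_sqrt_real_inner]

open Classical in
/-- The map `r • s ↦ r • J r s`, the identity on the zero section. -/
def radialMap (J : ℝ → sphereBundle m V → sphereBundle m V) (v : TotalSpace 𝔼[m] V) :
    TotalSpace 𝔼[m] V :=
  if h : v.2 = 0 then v else scale ‖v.2‖ (J ‖v.2‖ ⟨direction v, direction_mem h⟩)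

theorem radialMap_of_eq_zero {J : ℝ → sphereBundle m V → sphereBundle m V} {v : TotalSpace 𝔼[m] V}
    (h : v.2 = 0) : radialMap J v = v :=
  dif_pos h

theorem radialMap_scale {J : ℝ → sphereBundle m V → sphereBundle m V} (s : sphereBundle m V) {r : ℝ}
    (hr : 0 < r) : radialMap J (scale r s) = scale r (J r s) := by
  have hn : ‖(scale r s.1).2‖ = r := norm_scale_sphere s.2 hr.le
  have h : (scale r s.1).2 ≠ 0 := by
    rw [← norm_ne_zero_iff, hn]
    exact hr.ne'
  have hs : (⟨direction (scale r s.1), direction_mem h⟩ : sphereBundle m V) = s :=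
    Subtype.ext ((direction_scale hr).trans (direction_of_mem s.2))
  rw [radialMap, dif_neg h, hn, hs]

theorem radialMap_radialMap {J J' : ℝ → sphereBundle m V → sphereBundle m V}
    (hJ : ∀ r s, J' r (J r s) = s) (v : TotalSpace 𝔼[m] V) :
    radialMap J' (radialMap J v) = v := by
  by_cases h : v.2 = 0
  · rw [radialMap_of_eq_zero h, radialMap_of_eq_zero h]
  · obtain ⟨s, hs⟩ := exists_eq_scale h
    have h' := norm_pos_iff.2 h
    rw [hs, radialMap_scale s h', radialMap_scale _ h', hJ]

/-- The bijection `r • s ↦ r • J r s`, the identity on the zero section. -/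
def radialEquiv (J : ℝ → sphereBundle m V ≃ sphereBundle m V) :
    TotalSpace 𝔼[m] V ≃ TotalSpace 𝔼[m] V where
  toFun := radialMap fun r => J r
  invFun := radialMap fun r => (J r).symm
  left_inv := radialMap_radialMap fun r => (J r).symm_apply_apply
  right_inv := radialMap_radialMap fun r => (J r).apply_symm_apply

section

variable {J : ℝ → sphereBundle m V ≃ sphereBundle m V}

theorem radialEquiv_apply {v : TotalSpace 𝔼[m] V} (h : v.2 ≠ 0) :
    radialEquiv J v = scale ‖v.2‖ (J ‖v.2‖ ⟨direction v, direction_mem h⟩ : sphereBundle m V) :=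
  dif_neg h

theorem radialEquiv_scale (s : sphereBundle m V) {r : ℝ} (hr : 0 < r) :
    radialEquiv J (scale r s) = scale r (J r s) :=
  radialMap_scale (J := fun r => J r) s hr

theorem radialEquiv_of_eq_zero {v : TotalSpace 𝔼[m] V} (h : v.2 = 0) : radialEquiv J v = v :=
  dif_pos h

theorem norm_radialEquiv (v : TotalSpace 𝔼[m] V) : ‖(radialEquiv J v).2‖ = ‖v.2‖ := by
  by_cases h : v.2 = 0
  · rw [radialEquiv_of_eq_zero h]
  · rw [radialEquiv_apply h, norm_scale_sphere (J _ _).2 (norm_nonneg _)]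

theorem radialEquiv_of_eq_refl {v : TotalSpace 𝔼[m] V} (h : ∀ s, J ‖v.2‖ s = s) :
    radialEquiv J v = v := by
  by_cases hv : v.2 = 0
  · exact radialEquiv_of_eq_zero hv
  · rw [radialEquiv_apply hv, h, scale_direction hv]

end

theorem contMDiffOn_radialEquiv_const (w : SphereDiffeo d m V) :
    ContMDiffOn 𝓑[d, m] 𝓑[d, m] ∞ (radialEquiv fun _ => w.toEquiv) {v | v.2 ≠ 0} := by
  obtain ⟨g, hg, hgw⟩ := w.smooth_toFun
  refine (contMDiffOn_scale (contMDiffOn_norm d)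
    (hg.comp (contMDiffOn_direction d) fun v hv => direction_mem hv)).congr fun v hv => ?_
  rw [radialEquiv_apply hv, ← hgw]
  rfl

/-- Since the map preserves the norm, a vector in the kernel of its derivative is tangent to a
sphere bundle of constant radius. In such directions the derivative equals that of the map with the
radius parameter frozen at `‖v‖`, which has a smooth inverse. -/
theorem mfderiv_radialEquiv_injective {J : ℝ → SphereDiffeo d m V}
    {k : ℝ × TotalSpace 𝔼[m] V → TotalSpace 𝔼[m] V}
    (hk : ContMDiffOn (𝓘(ℝ, ℝ).prod 𝓑[d, m]) 𝓑[d, m] ∞ k (univ ×ˢ sphereBundle m V))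
    (hkJ : ∀ r (s : sphereBundle m V), k (r, s) = J r s) {v : TotalSpace 𝔼[m] V} (hv : v.2 ≠ 0) :
    ContMDiffAt 𝓑[d, m] 𝓑[d, m] ∞ (radialEquiv fun r => (J r).toEquiv) v ∧
    ∀ w : TangentSpace 𝓑[d, m] v,
      mfderiv 𝓑[d, m] 𝓑[d, m] (radialEquiv fun r => (J r).toEquiv) v w = 0 → w = 0 := by
  set e := radialEquiv fun r => (J r).toEquiv with he
  set U : Set (TotalSpace 𝔼[m] V) := {v | v.2 ≠ 0}
  have hU : U ∈ 𝓝 v := (isOpen_ne_zero d).mem_nhds hv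
  set N : TotalSpace 𝔼[m] V → ℝ := fun v => ‖v.2‖
  -- `Q` separates the radius parameter from the point: `e` is `u ↦ Q (‖u‖, u)`, and the frozen map
  -- is `u ↦ Q (‖v‖, u)`.
  set Q : ℝ × TotalSpace 𝔼[m] V → TotalSpace 𝔼[m] V := fun p => scale ‖p.2.2‖ (k (p.1, direction p.2))
  have hQJ : ∀ r, ∀ u ∈ U, Q (r, u) = radialEquiv (fun _ => (J r).toEquiv) u := fun r u hu => by
    rw [radialEquiv_apply hu]
    exact congrArg (scale _) (hkJ r ⟨direction u, direction_mem hu⟩)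
  have hQ : ContMDiffOn (𝓘(ℝ, ℝ).prod 𝓑[d, m]) 𝓑[d, m] ∞ Q (univ ×ˢ U) := by
    refine contMDiffOn_scale ((contMDiffOn_norm d).comp contMDiffOn_snd fun p hp => hp.2)
      (hk.comp (contMDiffOn_fst.prodMk ((contMDiffOn_direction d).comp contMDiffOn_snd
        fun p hp => hp.2)) fun p hp => ⟨trivial, direction_mem hp.2⟩)
  have hQv : ContMDiffAt (𝓘(ℝ, ℝ).prod 𝓑[d, m]) 𝓑[d, m] ∞ Q (N v, v) :=
    hQ.contMDiffAt (prod_mem_nhds Filter.univ_mem hU)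
  have hN : ∀ u ∈ U, ContMDiffAt 𝓑[d, m] 𝓘(ℝ, ℝ) ∞ N u := fun u hu =>
    (contMDiffOn_norm d).contMDiffAt ((isOpen_ne_zero d).mem_nhds hu)
  have heQ : e =ᶠ[𝓝 v] fun u => Q (N u, u) := by
    filter_upwards [hU] with u hu
    rw [hQJ _ u hu, he, radialEquiv_apply hu, radialEquiv_apply hu]
  have hes : ContMDiffAt 𝓑[d, m] 𝓑[d, m] ∞ e v :=
    (ContMDiffAt.comp (f := fun u => (N u, u)) v hQv ((hN v hv).prodMk
      contMDiffAt_id)).congr_of_eventuallyEq heQ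
  refine ⟨hes, fun w hw => ?_⟩
  have hev : e v ∈ U := by
    change (e v).2 ≠ 0
    rw [← norm_ne_zero_iff, he, norm_radialEquiv]
    exact norm_ne_zero_iff.2 hv
  -- Differentiate `N ∘ e = N`.
  have hdN : mfderiv 𝓑[d, m] 𝓘(ℝ, ℝ) N v w = 0 := by
    have h1 := ((hN _ hev).mdifferentiableAt (by simp)).hasMFDerivAt.comp v
      (hes.mdifferentiableAt (by simp)).hasMFDerivAt
    have h2 : N ∘ e = N := funext fun u => norm_radialEquiv u
    rw [h2] at h1
    rw [h1.mfderiv]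
    change mfderiv 𝓑[d, m] 𝓘(ℝ, ℝ) N (e v) (mfderiv 𝓑[d, m] 𝓑[d, m] e v w) = 0
    rw [hw, map_zero]
  have hdQ := (hQv.mdifferentiableAt (by simp)).hasMFDerivAt
  have hde : mfderiv 𝓑[d, m] 𝓑[d, m] e v w =
      mfderiv (𝓘(ℝ, ℝ).prod 𝓑[d, m]) 𝓑[d, m] Q (N v, v) ((0 : ℝ), w) := by
    have h1 := HasMFDerivAt.comp (f := fun u => (N u, u)) v hdQ
      (((hN v hv).mdifferentiableAt (by simp)).hasMFDerivAt.prodMk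
      (hasMFDerivAt_id v))
    rw [(h1.congr_of_eventuallyEq heQ).mfderiv]
    change mfderiv (𝓘(ℝ, ℝ).prod 𝓑[d, m]) 𝓑[d, m] Q (N v, v)
      (mfderiv 𝓑[d, m] 𝓘(ℝ, ℝ) N v w, w) = _
    rw [hdN]
    rfl
  set e₀ := radialEquiv (fun _ => (J (N v)).toEquiv)
  have he₀ : mfderiv 𝓑[d, m] 𝓑[d, m] e₀ v w =
      mfderiv (𝓘(ℝ, ℝ).prod 𝓑[d, m]) 𝓑[d, m] Q (N v, v) ((0 : ℝ), w) := by
    have h1 := hdQ.comp v ((hasMFDerivAt_const (N v) v).prodMk (hasMFDerivAt_id v))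
    have heq : e₀ =ᶠ[𝓝 v] Q ∘ fun u => (N v, u) := by
      filter_upwards [hU] with u hu
      exact (hQJ _ u hu).symm
    rw [(h1.congr_of_eventuallyEq heq).mfderiv]
    rfl
  have he₀0 : mfderiv 𝓑[d, m] 𝓑[d, m] e₀ v w = 0 := by rw [he₀, ← hde, hw]; rfl
  have he₀s : ContMDiffAt 𝓑[d, m] 𝓑[d, m] ∞ e₀ v :=
    (contMDiffOn_radialEquiv_const (J (N v))).contMDiffAt hU
  have he₀v : e₀ v ∈ U := by
    change (e₀ v).2 ≠ 0
    rw [← norm_ne_zero_iff, norm_radialEquiv]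
    exact norm_ne_zero_iff.2 hv
  have he₀i : ContMDiffAt 𝓑[d, m] 𝓑[d, m] ∞ e₀.symm (e₀ v) :=
    (contMDiffOn_radialEquiv_const (J (N v)).symm).contMDiffAt ((isOpen_ne_zero d).mem_nhds he₀v)
  have h1 := (he₀i.mdifferentiableAt (by simp)).hasMFDerivAt.comp v
    (he₀s.mdifferentiableAt (by simp)).hasMFDerivAt
  have h2 : e₀.symm ∘ e₀ = id := funext e₀.symm_apply_apply
  rw [h2] at h1
  have h3 := hasMFDerivAt_unique h1 (hasMFDerivAt_id v)
  have h4 := congrArg (fun L => L w) h3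
  change mfderiv 𝓑[d, m] 𝓑[d, m] e₀.symm (e₀ v) (mfderiv 𝓑[d, m] 𝓑[d, m] e₀ v w) = w at h4
  rw [← h4, he₀0, map_zero]
  rfl

/-- The hypothesis `hJ` makes the map the identity near the zero section, where polar coordinates
are singular. Elsewhere the inverse function theorem gives smoothness of the inverse. -/
theorem exists_diffeomorph_of_radial_family {J : ℝ → SphereDiffeo d m V}
    {k : ℝ × TotalSpace 𝔼[m] V → TotalSpace 𝔼[m] V}
    (hk : ContMDiffOn (𝓘(ℝ, ℝ).prod 𝓑[d, m]) 𝓑[d, m] ∞ k (univ ×ˢ sphereBundle m V))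
    (hkJ : ∀ r (s : sphereBundle m V), k (r, s) = J r s) (hJ : ∀ r ≤ 1 / 2, ∀ s, J r s = s) :
    ∃ W : TotalSpace 𝔼[m] V ≃ₘ^∞⟮𝓑[d, m], 𝓑[d, m]⟯ TotalSpace 𝔼[m] V,
      W.toEquiv = radialEquiv fun r => (J r).toEquiv := by
  set e := radialEquiv fun r => (J r).toEquiv with he
  have hnear : ∀ v : TotalSpace 𝔼[m] V, v.2 = 0 → ∀ᶠ u in 𝓝 v, e u = u := fun v hv => by
    have hc := (continuous_norm_bundle (m := m) (V := V) d).continuousAt (x := v)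
    filter_upwards [hc.eventually_lt (g := fun _ => (1 / 2 : ℝ)) continuousAt_const (by simp [hv])]
      with u hu
    exact radialEquiv_of_eq_refl (hJ _ hu.le)
  have hs : ContMDiff 𝓑[d, m] 𝓑[d, m] ∞ e := fun v => by
    by_cases hv : v.2 = 0
    · exact contMDiffAt_id.congr_of_eventuallyEq (hnear v hv)
    · exact (mfderiv_radialEquiv_injective hk hkJ hv).1
  have hi : ContMDiff 𝓑[d, m] 𝓑[d, m] ∞ e.symm := fun v => by
    by_cases hv : v.2 = 0
    · refine contMDiffAt_id.congr_of_eventuallyEq ?_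
      filter_upwards [hnear v hv] with u hu
      exact e.symm_apply_eq.2 hu.symm
    · obtain ⟨u, rfl⟩ := e.surjective v
      have hu : u.2 ≠ 0 := fun h => hv (by rw [he, radialEquiv_of_eq_zero h, h])
      exact (hs u).equiv_symm (mfderiv_radialEquiv_injective hk hkJ hu).2
  exact ⟨⟨e, hs, hi⟩, rfl⟩

/-- A smooth isotopy of sphere bundle diffeomorphisms can be performed along the radius. -/
theorem exists_diffeomorph_of_isotopy {K : ℝ → SphereDiffeo d m V}
    {k : ℝ × TotalSpace 𝔼[m] V → TotalSpace 𝔼[m] V}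
    (hk : ContMDiffOn (𝓘(ℝ, ℝ).prod 𝓑[d, m]) 𝓑[d, m] ∞ k (Icc (0 : ℝ) 1 ×ˢ sphereBundle m V))
    (hkK : ∀ t ∈ Icc (0 : ℝ) 1, ∀ s : sphereBundle m V, k (t, s) = K t s) :
    ∃ W : TotalSpace 𝔼[m] V ≃ₘ^∞⟮𝓑[d, m], 𝓑[d, m]⟯ TotalSpace 𝔼[m] V,
      (∀ v, ‖(W v).2‖ = ‖v.2‖) ∧
      ExtendsRadially W.toEquiv ((K 0).symm.toEquiv.trans (K 1).toEquiv) := by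
  obtain ⟨g, hg, hgK⟩ := (K 0).smooth_invFun
  -- `l` is `0` for `r ≤ 1/2` and `1` for `r ≥ 1`: the family K (l r) ∘ K₀⁻¹ is the identity near
  -- the zero section and constant outside the disk bundle.
  set l : ℝ → ℝ := fun r => Real.smoothTransition (2 * r - 1)
  have hl : ContMDiff 𝓘(ℝ, ℝ) 𝓘(ℝ, ℝ) ∞ l := by
    refine ContDiff.contMDiff (Real.smoothTransition.contDiff.comp ?_)
    fun_prop
  have hl01 : ∀ r, l r ∈ Icc (0 : ℝ) 1 := fun r =>
    ⟨Real.smoothTransition.nonneg _, Real.smoothTransition.le_one _⟩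
  have hgS : ∀ s ∈ sphereBundle m V, g s ∈ sphereBundle m V := fun s hs => by
    rw [show g s = _ from hgK ⟨s, hs⟩]
    exact Subtype.coe_prop _
  obtain ⟨W, hW⟩ := exists_diffeomorph_of_radial_family
    (J := fun r => (K (l r)).comp (K 0).symm) (k := fun p => k (l p.1, g p.2))
    (hk.comp ((hl.comp_contMDiffOn contMDiffOn_fst).prodMk (hg.comp contMDiffOn_snd
      fun p hp => hp.2)) fun p hp => ⟨hl01 _, hgS _ hp.2⟩)
    (fun r s => by
      have h1 : g s = ((K 0).symm s : sphereBundle m V) := hgK s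
      change k (l r, g s) = _
      rw [h1, hkK _ (hl01 r)]
      rfl)
    (fun r hr s => by
      have h1 : l r = 0 := Real.smoothTransition.zero_of_nonpos (by linarith)
      simp only [h1]
      exact (K 0).toEquiv.apply_symm_apply s)
  refine ⟨W, fun v => ?_, fun s r hr => ?_⟩
  · change ‖(W.toEquiv v).2‖ = _
    rw [hW, norm_radialEquiv]
  · have h1 : l r = 1 := Real.smoothTransition.one_of_one_le (by linarith)
    rw [hW, radialEquiv_scale s (zero_lt_one.trans_le hr)]
    simp only [h1]
    rfl

end RadialDiffeomorphisms

/-! ### Extending disk bundle maps radially to the total space -/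

section RadialExtension

variable {d m : ℕ} {M : Type*} [TopologicalSpace M] [ChartedSpace 𝔼[d] M] [IsManifold (𝓡 d) ∞ M]
  {V : M → Type*} [∀ x, NormedAddCommGroup (V x)] [∀ x, InnerProductSpace ℝ (V x)]
  [TopologicalSpace (TotalSpace 𝔼[m] V)] [FiberBundle 𝔼[m] V] [VectorBundle ℝ 𝔼[m] V]
  [ContMDiffVectorBundle ∞ 𝔼[m] V (𝓡 d)] [IsContMDiffRiemannianBundle (𝓡 d) ∞ 𝔼[m] V]

open Classical in
/-- The map that is `F` on the disk bundle and the radial extension of `h` outside. -/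
def diskRadialMap (F : diskBundle m V → diskBundle m V) (h : sphereBundle m V → sphereBundle m V)
    (v : TotalSpace 𝔼[m] V) : TotalSpace 𝔼[m] V :=
  if hv : ‖v.2‖ ≤ 1 then F ⟨v, hv⟩ else radialMap (fun _ => h) v

theorem norm_radialMap {J : ℝ → sphereBundle m V → sphereBundle m V} (v : TotalSpace 𝔼[m] V) :
    ‖(radialMap J v).2‖ = ‖v.2‖ := by
  by_cases h : v.2 = 0
  · rw [radialMap_of_eq_zero h]
  · obtain ⟨s, hs⟩ := exists_eq_scale h
    rw [hs, radialMap_scale s (norm_pos_iff.2 h), norm_scale_sphere (J _ _).2 (norm_nonneg _),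
      norm_scale_sphere s.2 (norm_nonneg _)]

theorem diskRadialMap_diskRadialMap {F F' : diskBundle m V → diskBundle m V}
    {h h' : sphereBundle m V → sphereBundle m V} (hF : ∀ x, F' (F x) = x) (hh : ∀ s, h' (h s) = s)
    (v : TotalSpace 𝔼[m] V) : diskRadialMap F' h' (diskRadialMap F h v) = v := by
  by_cases hv : ‖v.2‖ ≤ 1
  · have h1 : diskRadialMap F h v = F ⟨v, hv⟩ := dif_pos hv
    rw [h1]
    exact (dif_pos (F ⟨v, hv⟩).2).trans (congrArg Subtype.val (hF ⟨v, hv⟩))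
  · have h1 : diskRadialMap F h v = radialMap (fun _ => h) v := dif_neg hv
    rw [h1, diskRadialMap, dif_neg (by rwa [norm_radialMap]), radialMap_radialMap fun _ => hh]

/-- The bijection that is `F` on the disk bundle and the radial extension of `h` outside. -/
def diskRadialEquiv (F : diskBundle m V ≃ diskBundle m V) (h : sphereBundle m V ≃ sphereBundle m V) :
    TotalSpace 𝔼[m] V ≃ TotalSpace 𝔼[m] V where
  toFun := diskRadialMap F h
  invFun := diskRadialMap F.symm h.symm
  left_inv := diskRadialMap_diskRadialMap F.symm_apply_apply h.symm_apply_apply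
  right_inv := diskRadialMap_diskRadialMap F.apply_symm_apply h.apply_symm_apply

variable {F : diskBundle m V ≃ diskBundle m V} {h : sphereBundle m V ≃ sphereBundle m V}

theorem diskRadialEquiv_of_le {v : TotalSpace 𝔼[m] V} (hv : ‖v.2‖ ≤ 1) :
    diskRadialEquiv F h v = F ⟨v, hv⟩ := dif_pos hv

theorem diskRadialEquiv_of_ge (hF : ∀ s, F (sphereToDisk s) = sphereToDisk (h s))
    {v : TotalSpace 𝔼[m] V} (hv : 1 ≤ ‖v.2‖) :
    diskRadialEquiv F h v = radialEquiv (fun _ => h) v := by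
  rcases hv.eq_or_lt with h1 | h1
  · rw [diskRadialEquiv_of_le h1.symm.le]
    have h2 : v ∈ sphereBundle m V := h1.symm
    have h3 := radialEquiv_scale (J := fun _ => h) ⟨v, h2⟩ one_pos
    rw [scale_one, scale_one] at h3
    exact (congrArg Subtype.val (hF ⟨v, h2⟩)).trans h3.symm
  · exact dif_neg (not_le.2 h1)

theorem extendsRadially_diskRadialEquiv (hF : ∀ s, F (sphereToDisk s) = sphereToDisk (h s)) :
    ExtendsRadially (diskRadialEquiv F h) h := fun s r hr => by
  have hr0 : 0 < r := zero_lt_one.trans_le hr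
  rw [diskRadialEquiv_of_ge hF (by rwa [norm_scale_sphere s.2 hr0.le]), radialEquiv_scale s hr0]

theorem contMDiffAt_diskRadialEquiv_of_lt {v : TotalSpace 𝔼[m] V} (hv : ‖v.2‖ < 1)
    (hF : SmoothBetween 𝓑[d, m] 𝓑[d, m] (diskBundle m V) (diskBundle m V) F) :
    ContMDiffAt 𝓑[d, m] 𝓑[d, m] ∞ (diskRadialEquiv F h) v := by
  obtain ⟨g, hg, hgF⟩ := hF
  have hc := (continuous_norm_bundle (m := m) (V := V) d).continuousAt (x := v)
  have hev := hc.eventually_lt (g := fun _ => (1 : ℝ)) continuousAt_const hv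
  have hmem : diskBundle m V ∈ 𝓝 v := by
    filter_upwards [hev] with u hu
    exact hu.le
  refine (hg.contMDiffAt hmem).congr_of_eventuallyEq ?_
  filter_upwards [hmem] with u hu
  rw [diskRadialEquiv_of_le hu]
  exact (hgF ⟨u, hu⟩).symm

theorem contMDiffAt_diskRadialEquiv_of_gt {w : SphereDiffeo d m V}
    (hF : ∀ s, F (sphereToDisk s) = sphereToDisk (w s))
    {v : TotalSpace 𝔼[m] V} (hv : 1 < ‖v.2‖) :
    ContMDiffAt 𝓑[d, m] 𝓑[d, m] ∞ (diskRadialEquiv F w.toEquiv) v := by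
  have hc := (continuous_norm_bundle (m := m) (V := V) d).continuousAt (x := v)
  have hev := continuousAt_const.eventually_lt (f := fun _ => (1 : ℝ)) hc hv
  refine ((contMDiffOn_radialEquiv_const w).contMDiffAt
    ((isOpen_ne_zero d).mem_nhds (ne_zero_of_one_le hv.le))).congr_of_eventuallyEq ?_
  filter_upwards [hev] with u hu
  exact diskRadialEquiv_of_ge hF hu.le

/-- A homogeneous `F` coincides with the radial extension of `w` on the whole complement of the zero
section, so the boundary of the disk bundle is invisible. Near the zero section the map is `F`. -/
theorem contMDiff_diskRadialEquiv_of_radial {F : DiskDiffeo d m V} {w : SphereDiffeo d m V}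
    (hF : ∀ (s : sphereBundle m V) (r : ℝ) (hr : ‖(scale r s.1).2‖ ≤ 1), 0 < r →
      (F ⟨scale r s, hr⟩ : TotalSpace 𝔼[m] V) = scale r (w s)) :
    ContMDiff 𝓑[d, m] 𝓑[d, m] ∞ (diskRadialEquiv F.toEquiv w.toEquiv) := by
  have hrad : ∀ v : TotalSpace 𝔼[m] V, v.2 ≠ 0 →
      diskRadialEquiv F.toEquiv w.toEquiv v = radialEquiv (fun _ => w.toEquiv) v := fun v hv => by
    rcases le_or_gt ‖v.2‖ 1 with h1 | h1
    · obtain ⟨s, hs⟩ := exists_eq_scale hv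
      have h2 : ‖(scale ‖v.2‖ s.1).2‖ ≤ 1 := by rwa [← hs]
      rw [hs, radialEquiv_scale s (norm_pos_iff.2 hv), diskRadialEquiv_of_le h2,
        hF s _ h2 (norm_pos_iff.2 hv)]
    · exact dif_neg (not_le.2 h1)
  intro v
  by_cases hv : v.2 = 0
  · exact contMDiffAt_diskRadialEquiv_of_lt (by simp [hv]) F.smooth_toFun
  · have hU := (isOpen_ne_zero (m := m) (V := V) d).mem_nhds hv
    refine ((contMDiffOn_radialEquiv_const w).contMDiffAt hU).congr_of_eventuallyEq ?_
    filter_upwards [hU] with u hu using hrad u hu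

variable {f g : SphereDiffeo d m V}

theorem comp_mem_extendableDiffeos (hf : f ∈ extendableDiffeos d m V)
    (hg : g ∈ extendableDiffeos d m V) : f.comp g ∈ extendableDiffeos d m V := by
  obtain ⟨F, hF⟩ := hf
  obtain ⟨G, hG⟩ := hg
  refine ⟨F.comp G, fun s => ?_⟩
  change F (G _) = _
  rw [hG, hF]
  rfl

theorem symm_mem_extendableDiffeos (hf : f ∈ extendableDiffeos d m V) :
    f.symm ∈ extendableDiffeos d m V := by
  obtain ⟨F, hF⟩ := hf
  refine ⟨F.symm, fun s => F.toEquiv.symm_apply_eq.2 ?_⟩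
  rw [hF]
  exact congrArg sphereToDisk (f.toEquiv.apply_symm_apply s).symm

theorem comp_mem_sphereBundleIsometries (hf : f ∈ sphereBundleIsometries d m V)
    (hg : g ∈ sphereBundleIsometries d m V) : f.comp g ∈ sphereBundleIsometries d m V := by
  obtain ⟨F, ⟨a, L, hL⟩, hF⟩ := hf
  obtain ⟨G, ⟨b, L', hL'⟩, hG⟩ := hg
  refine ⟨F.comp G, ⟨a ∘ b, fun x => (L' x).trans (L (b x)), fun v => ?_⟩, fun s => ?_⟩
  · change (F (G v) : TotalSpace 𝔼[m] V) = _
    rw [hL, hL']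
    rfl
  · change F (G _) = _
    rw [hG, hF]
    rfl

theorem mem_extendableDiffeos_of_extendsRadially
    {W : TotalSpace 𝔼[m] V ≃ₘ^∞⟮𝓑[d, m], 𝓑[d, m]⟯ TotalSpace 𝔼[m] V}
    (hW : ExtendsRadially W.toEquiv f.toEquiv) : f ∈ extendableDiffeos d m V := by
  refine ⟨⟨⟨fun v => ⟨W v, hW.norm_le v.2⟩, fun v => ⟨W.symm v, hW.symm.norm_le v.2⟩,
    fun v => Subtype.ext (W.symm_apply_apply _), fun v => Subtype.ext (W.apply_symm_apply _)⟩,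
    ⟨W, W.contMDiff.contMDiffOn, fun _ => rfl⟩, ⟨W.symm, W.symm.contMDiff.contMDiffOn, fun _ => rfl⟩⟩,
    fun s => Subtype.ext ?_⟩
  have := hW s 1 le_rfl
  rw [scale_one, scale_one] at this
  exact this

/-- A diffeomorphism of the sphere bundle isotopic to an extendable one is extendable. -/
theorem mem_extendableDiffeos_of_isotopy {K : ℝ → SphereDiffeo d m V}
    {k : ℝ × TotalSpace 𝔼[m] V → TotalSpace 𝔼[m] V}
    (hk : ContMDiffOn (𝓘(ℝ, ℝ).prod 𝓑[d, m]) 𝓑[d, m] ∞ k (Icc (0 : ℝ) 1 ×ˢ sphereBundle m V))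
    (hkK : ∀ t ∈ Icc (0 : ℝ) 1, ∀ s : sphereBundle m V, k (t, s) = K t s)
    (h0 : K 0 ∈ extendableDiffeos d m V) : K 1 ∈ extendableDiffeos d m V := by
  obtain ⟨W, -, hW⟩ := exists_diffeomorph_of_isotopy hk hkK
  -- The restriction of `W` to the disk bundle extends K₁ ∘ K₀⁻¹.
  have h1 : (K 1).comp (K 0).symm ∈ extendableDiffeos d m V :=
    mem_extendableDiffeos_of_extendsRadially hW
  have h2 := comp_mem_extendableDiffeos h1 h0
  have h3 : ((K 1).comp (K 0).symm).comp (K 0) = K 1 :=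
    SetDiffeo.ext_apply fun s => congrArg (K 1) ((K 0).toEquiv.symm_apply_apply s)
  rwa [h3] at h2

/-- The elements of `Isom_b(∂E)` extend to norm preserving diffeomorphisms of the total space. -/
theorem exists_diffeomorph_of_isometry (hf : f ∈ sphereBundleIsometries d m V) :
    ∃ W : TotalSpace 𝔼[m] V ≃ₘ^∞⟮𝓑[d, m], 𝓑[d, m]⟯ TotalSpace 𝔼[m] V,
      (∀ v, ‖(W v).2‖ = ‖v.2‖) ∧ ExtendsRadially W.toEquiv f.toEquiv := by
  obtain ⟨F, ⟨a, L, hL⟩, hF⟩ := hf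
  have hscale : ∀ (s : sphereBundle m V) (r : ℝ) (hr : ‖(scale r s.1).2‖ ≤ 1), 0 < r →
      (F ⟨scale r s, hr⟩ : TotalSpace 𝔼[m] V) = scale r (f s) := fun s r hr _ => by
    have h1 : (f s : TotalSpace 𝔼[m] V) = F (sphereToDisk s) := (congrArg Subtype.val (hF s)).symm
    rw [h1, hL, hL]
    exact congrArg (TotalSpace.mk _) (map_smul (L s.1.1) r s.1.2)
  have hscale' : ∀ (s : sphereBundle m V) (r : ℝ) (hr : ‖(scale r s.1).2‖ ≤ 1), 0 < r →
      (F.symm ⟨scale r s, hr⟩ : TotalSpace 𝔼[m] V) = scale r (f.symm s) := fun s r hr hr0 => by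
    have hr' : ‖(scale r (f.symm s).1).2‖ ≤ 1 := by
      rw [norm_scale_sphere s.2 hr0.le] at hr
      rwa [norm_scale_sphere (f.symm s).2 hr0.le]
    have h1 := hscale (f.symm s) r hr' hr0
    rw [show f (f.symm s) = s from f.toEquiv.apply_symm_apply s] at h1
    have h2 : F.symm ⟨scale r s, hr⟩ = ⟨scale r (f.symm s).1, hr'⟩ :=
      F.toEquiv.symm_apply_eq.2 (Subtype.ext h1.symm)
    rw [h2]
  refine ⟨⟨diskRadialEquiv F.toEquiv f.toEquiv, contMDiff_diskRadialEquiv_of_radial hscale,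
    contMDiff_diskRadialEquiv_of_radial (F := F.symm) (w := f.symm) hscale'⟩, fun v => ?_,
    extendsRadially_diskRadialEquiv hF⟩
  change ‖(diskRadialEquiv F.toEquiv f.toEquiv v).2‖ = _
  rcases le_or_gt ‖v.2‖ 1 with h1 | h1
  · rw [diskRadialEquiv_of_le h1, hL]
    exact (L v.1).norm_map v.2
  · rw [diskRadialEquiv_of_ge hF h1.le, norm_radialEquiv]

end RadialExtension

/-! ### Statement (1): gluing maps changed by isometries and isotopies -/

section FoliatedEquivalence

variable {d₁ m₁ d₂ m₂ n : ℕ} [Fact (d₁ + m₁ = n)] [Fact (d₂ + m₂ = n)]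
  {M₁ : Type*} [TopologicalSpace M₁] [ChartedSpace 𝔼[d₁] M₁] [IsManifold (𝓡 d₁) ∞ M₁]
  {V₁ : M₁ → Type*} [∀ x, NormedAddCommGroup (V₁ x)] [∀ x, InnerProductSpace ℝ (V₁ x)]
  [TopologicalSpace (TotalSpace 𝔼[m₁] V₁)] [FiberBundle 𝔼[m₁] V₁] [VectorBundle ℝ 𝔼[m₁] V₁]
  [ContMDiffVectorBundle ∞ 𝔼[m₁] V₁ (𝓡 d₁)] [IsContMDiffRiemannianBundle (𝓡 d₁) ∞ 𝔼[m₁] V₁]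
  {M₂ : Type*} [TopologicalSpace M₂] [ChartedSpace 𝔼[d₂] M₂] [IsManifold (𝓡 d₂) ∞ M₂]
  {V₂ : M₂ → Type*} [∀ x, NormedAddCommGroup (V₂ x)] [∀ x, InnerProductSpace ℝ (V₂ x)]
  [TopologicalSpace (TotalSpace 𝔼[m₂] V₂)] [FiberBundle 𝔼[m₂] V₂] [VectorBundle ℝ 𝔼[m₂] V₂]
  [ContMDiffVectorBundle ∞ 𝔼[m₂] V₂ (𝓡 d₂)] [IsContMDiffRiemannianBundle (𝓡 d₂) ∞ 𝔼[m₂] V₂]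

/-- Surjectivity joins `h` to an isometry `i` by isotopies. Both `i` and each single isotopy provide
a norm preserving `W`, hence a height preserving diffeomorphism. -/
theorem heightEquivalent_comp_of_surjective
    (hsurj : Function.Surjective (piZeroInclusion d₂ m₂ V₂)) {h : SphereDiffeo d₂ m₂ V₂}
    (hh : h ∈ extendableDiffeos d₂ m₂ V₂)
    (φ : SetDiffeo 𝓑[d₁, m₁] 𝓑[d₂, m₂] (sphereBundle m₁ V₁) (sphereBundle m₂ V₂)) :
    HeightEquivalent n φ (h.comp φ) := by
  obtain ⟨q, hq⟩ := hsurj (PiZero.mk ⟨h, hh⟩)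
  induction q using Quot.ind with | mk i =>
  have hi : HeightEquivalent n φ (i.1.comp φ) := by
    obtain ⟨W, hn, hW⟩ := exists_diffeomorph_of_isometry i.2
    obtain ⟨F, hF⟩ := Glued.exists_diffeomorph (n := n) (φ := φ) (ψ := i.1.comp φ) W hW fun _ => rfl
    exact ⟨F, hF hn⟩
  refine hi.trans ?_
  -- Equality in the quotient only gives a zigzag of isotopies, treated by induction on the
  -- generated equivalence relation.
  have hgen := Quot.eqvGen_exact hq
  have key : ∀ a b : extendableDiffeos d₂ m₂ V₂, Relation.EqvGen (IsotopicIn _) a b →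
      HeightEquivalent n (a.1.comp φ) (b.1.comp φ) := fun a b hab => by
    induction hab with
    | rel a b hab =>
      obtain ⟨K, -, h0, h1, k, hk, hkK⟩ := hab
      obtain ⟨W, hn, hW⟩ := exists_diffeomorph_of_isotopy hk hkK
      obtain ⟨F, hF⟩ := Glued.exists_diffeomorph (n := n) (φ := a.1.comp φ) (ψ := b.1.comp φ) W hW
        fun s => by
          rw [← h0, ← h1]
          exact congrArg (K 1) ((K 0).toEquiv.symm_apply_apply (φ s)).symm
      exact ⟨F, hF hn⟩
    | refl a =>
      exact ⟨Diffeomorph.refl _ _ _, fun _ => rfl⟩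
    | symm a b _ ih => exact ih.symm
    | trans a b c _ _ ih ih' => exact ih.trans ih'
  exact key _ _ hgen

/-- After changing `φ` by `hm`, the change by `hp` is one on the second side of the inverse gluing
map, because ((hm ∘ φ) ∘ hp⁻¹)⁻¹ is hp ∘ (hm ∘ φ)⁻¹. -/
theorem heightEquivalent_of_surjective
    (hsurj₁ : Function.Surjective (piZeroInclusion d₁ m₁ V₁))
    (hsurj₂ : Function.Surjective (piZeroInclusion d₂ m₂ V₂))
    {hp : SphereDiffeo d₁ m₁ V₁} (hhp : hp ∈ extendableDiffeos d₁ m₁ V₁)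
    {hm : SphereDiffeo d₂ m₂ V₂} (hhm : hm ∈ extendableDiffeos d₂ m₂ V₂)
    (φ : SetDiffeo 𝓑[d₁, m₁] 𝓑[d₂, m₂] (sphereBundle m₁ V₁) (sphereBundle m₂ V₂)) :
    HeightEquivalent n φ ((hm.comp φ).comp hp.symm) :=
  (heightEquivalent_comp_of_surjective hsurj₂ hhm φ).trans
    (HeightEquivalent.swap (heightEquivalent_comp_of_surjective hsurj₁ hhp (hm.comp φ).symm))

end FoliatedEquivalence

/-! ### A doubly exponentially flat profile -/

section CollarProfile

open Filter

/-- A smooth function that vanishes to the left of `0` and tends to `0` like `exp (- exp (1 / σ))`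
to the right of `0`. -/
def collarRoot (σ : ℝ) : ℝ := Real.exp (Real.exp 1 / 2) * expNegInvGlue (2 * expNegInvGlue σ)

/-- The square of `collarRoot`. -/
def collarProfile (σ : ℝ) : ℝ := collarRoot σ ^ 2

/-- The inverse of `collarProfile` on `[0, 1]`. -/
def collarProfileInv (τ : ℝ) : ℝ := if τ ≤ 0 then 0 else (Real.log (Real.exp 1 - Real.log τ))⁻¹

theorem contDiff_collarRoot : ContDiff ℝ ∞ collarRoot :=
  contDiff_const.mul (expNegInvGlue.contDiff.comp (contDiff_const.mul expNegInvGlue.contDiff))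

theorem contDiff_collarProfile : ContDiff ℝ ∞ collarProfile := contDiff_collarRoot.pow 2

theorem collarRoot_of_nonpos {σ : ℝ} (h : σ ≤ 0) : collarRoot σ = 0 := by
  simp [collarRoot, expNegInvGlue.zero_of_nonpos h]

theorem collarProfile_of_nonpos {σ : ℝ} (h : σ ≤ 0) : collarProfile σ = 0 := by
  simp [collarProfile, collarRoot_of_nonpos h]

theorem expNegInvGlue_of_pos {σ : ℝ} (h : 0 < σ) : expNegInvGlue σ = Real.exp (-σ⁻¹) := by
  simp [expNegInvGlue, h.not_ge]

theorem collarProfile_of_pos {σ : ℝ} (h : 0 < σ) :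
    collarProfile σ = Real.exp (Real.exp 1 - Real.exp σ⁻¹) := by
  have h1 : 0 < 2 * expNegInvGlue σ := by
    have := expNegInvGlue.pos_of_pos h
    positivity
  rw [collarProfile, collarRoot, expNegInvGlue_of_pos h1, expNegInvGlue_of_pos h, ← Real.exp_add,
    ← Real.exp_nat_mul]
  congr 1
  rw [mul_inv, ← Real.exp_neg, neg_neg]
  push_cast
  ring

theorem collarProfile_nonneg (σ : ℝ) : 0 ≤ collarProfile σ := sq_nonneg _

theorem collarProfile_pos {σ : ℝ} (h : 0 < σ) : 0 < collarProfile σ := by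
  rw [collarProfile_of_pos h]
  exact Real.exp_pos _

theorem collarProfile_lt_one {σ : ℝ} (h : σ < 1) : collarProfile σ < 1 := by
  rcases le_or_gt σ 0 with h0 | h0
  · rw [collarProfile_of_nonpos h0]
    exact zero_lt_one
  · rw [collarProfile_of_pos h0, Real.exp_lt_one_iff, sub_neg, Real.exp_lt_exp]
    exact (one_lt_inv₀ h0).2 h

theorem collarProfile_one : collarProfile 1 = 1 := by
  rw [collarProfile_of_pos one_pos, inv_one, sub_self, Real.exp_zero]

theorem collarProfileInv_of_nonpos {τ : ℝ} (h : τ ≤ 0) : collarProfileInv τ = 0 := if_pos h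

theorem collarProfileInv_of_pos {τ : ℝ} (h : 0 < τ) :
    collarProfileInv τ = (Real.log (Real.exp 1 - Real.log τ))⁻¹ := if_neg h.not_ge

theorem collarProfileInv_collarProfile {σ : ℝ} (h : 0 ≤ σ) :
    collarProfileInv (collarProfile σ) = σ := by
  rcases h.eq_or_lt with rfl | h0
  · rw [collarProfile_of_nonpos le_rfl, collarProfileInv_of_nonpos le_rfl]
  · rw [collarProfileInv_of_pos (collarProfile_pos h0), collarProfile_of_pos h0, Real.log_exp,
      sub_sub_cancel, Real.log_exp, inv_inv]

theorem one_le_log_collar {τ : ℝ} (h0 : 0 < τ) (h1 : τ ≤ 1) :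
    1 ≤ Real.log (Real.exp 1 - Real.log τ) := by
  rw [Real.le_log_iff_exp_le]
  · linarith [Real.log_nonpos h0.le h1]
  · linarith [Real.log_nonpos h0.le h1, Real.exp_pos 1]

theorem collarProfileInv_pos {τ : ℝ} (h0 : 0 < τ) (h1 : τ ≤ 1) : 0 < collarProfileInv τ := by
  rw [collarProfileInv_of_pos h0]
  exact inv_pos.2 (zero_lt_one.trans_le (one_le_log_collar h0 h1))

theorem collarProfileInv_nonneg {τ : ℝ} (h1 : τ ≤ 1) : 0 ≤ collarProfileInv τ := by
  rcases le_or_gt τ 0 with h0 | h0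
  · rw [collarProfileInv_of_nonpos h0]
  · exact (collarProfileInv_pos h0 h1).le

theorem collarProfileInv_le_one {τ : ℝ} (h1 : τ ≤ 1) : collarProfileInv τ ≤ 1 := by
  rcases le_or_gt τ 0 with h0 | h0
  · rw [collarProfileInv_of_nonpos h0]
    exact zero_le_one
  · rw [collarProfileInv_of_pos h0]
    exact inv_le_one_of_one_le₀ (one_le_log_collar h0 h1)

theorem collarProfile_collarProfileInv {τ : ℝ} (h0 : 0 ≤ τ) (h1 : τ ≤ 1) :
    collarProfile (collarProfileInv τ) = τ := by
  rcases h0.eq_or_lt with rfl | h0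
  · rw [collarProfileInv_of_nonpos le_rfl, collarProfile_of_nonpos le_rfl]
  · have h2 := one_le_log_collar h0 h1
    rw [collarProfile_of_pos (collarProfileInv_pos h0 h1), collarProfileInv_of_pos h0, inv_inv,
      Real.exp_log, sub_sub_cancel, Real.exp_log h0]
    linarith [Real.log_nonpos h0.le h1, Real.exp_pos 1]

theorem contDiffAt_collarProfileInv {τ : ℝ} (h0 : 0 < τ) (h1 : τ ≤ 1) :
    ContDiffAt ℝ ∞ collarProfileInv τ := by
  have h2 := one_le_log_collar h0 h1
  have h3 : Real.exp 1 - Real.log τ ≠ 0 := by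
    have := Real.log_nonpos h0.le h1
    have := Real.exp_pos 1
    linarith
  have h4 : ContDiffAt ℝ ∞ (fun τ => (Real.log (Real.exp 1 - Real.log τ))⁻¹) τ :=
    ((contDiffAt_const.sub (Real.contDiffAt_log.2 h0.ne')).log h3).inv (by linarith)
  refine h4.congr_of_eventuallyEq ?_
  filter_upwards [lt_mem_nhds h0] with t ht using collarProfileInv_of_pos ht

theorem contDiffAt_dslope_zero {f : ℝ → ℝ} {q : ℝ} (hf : ContDiffAt ℝ ∞ f q) (h0 : f 0 = 0) :
    ContDiffAt ℝ ∞ (dslope f 0) q := by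
  rcases eq_or_ne q 0 with rfl | hq
  · have h1 : ContDiffAt ℝ ∞ (fun p : ℝ × ℝ => f p.1) (0, 0) := hf.comp (0, 0) contDiffAt_fst
    have h2 := ContDiffAt.dslope_fst h1 (.of_forall fun _ => h0)
    exact h2.comp (f := fun t : ℝ => (t, (0 : ℝ))) 0 (contDiffAt_id.prodMk contDiffAt_const)
  · have h1 : ContDiffAt ℝ ∞ (fun t => t⁻¹ * f t) q := (contDiffAt_id.inv hq).mul hf
    refine h1.congr_of_eventuallyEq ?_
    filter_upwards [isOpen_ne.mem_nhds hq] with t ht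
    rw [dslope_of_ne _ ht, slope_def_field, h0, sub_zero, sub_zero, div_eq_inv_mul]

end CollarProfile

/-! ### Radial maps with a prescribed profile -/

section ProfileMap

open Filter

variable {d m : ℕ} {M : Type*} [TopologicalSpace M] [ChartedSpace 𝔼[d] M] [IsManifold (𝓡 d) ∞ M]
  {V : M → Type*} [∀ x, NormedAddCommGroup (V x)] [∀ x, InnerProductSpace ℝ (V x)]
  [TopologicalSpace (TotalSpace 𝔼[m] V)] [FiberBundle 𝔼[m] V] [VectorBundle ℝ 𝔼[m] V]
  [ContMDiffVectorBundle ∞ 𝔼[m] V (𝓡 d)] [IsContMDiffRiemannianBundle (𝓡 d) ∞ 𝔼[m] V]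

theorem scale_of_eq_zero {v : TotalSpace 𝔼[m] V} (hv : v.2 = 0) (c : ℝ) : scale c v = v := by
  obtain ⟨x, v⟩ := v
  obtain rfl : v = 0 := hv
  exact congrArg (TotalSpace.mk x) (smul_zero c)

theorem contMDiffAt_scale {E' : Type*} [NormedAddCommGroup E'] [NormedSpace ℝ E']
    {H' : Type*} [TopologicalSpace H'] {I' : ModelWithCorners ℝ E' H'} {W : Type*}
    [TopologicalSpace W] [ChartedSpace H' W] {x : W} {c : W → ℝ} {g : W → TotalSpace 𝔼[m] V}
    (hc : ContMDiffAt I' 𝓘(ℝ, ℝ) ∞ c x) (hg : ContMDiffAt I' 𝓑[d, m] ∞ g x) :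
    ContMDiffAt I' 𝓑[d, m] ∞ (fun x => scale (c x) (g x)) x := by
  rw [contMDiffAt_totalSpace] at hg ⊢
  refine ⟨hg.1, ?_⟩
  set e := trivializationAt 𝔼[m] V (g x).1
  have hev : ∀ y, (g y).1 ∈ e.baseSet → (e (scale (c y) (g y))).2 = c y • (e (g y)).2 :=
    fun y hy => (e.linear ℝ hy).map_smul (c y) (g y).2
  refine (hc.smul hg.2).congr_of_eventuallyEq ?_
  filter_upwards [hg.1.continuousAt.preimage_mem_nhds
    (e.open_baseSet.mem_nhds (FiberBundle.mem_baseSet_trivializationAt' (g x).1))]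
    with y hy using hev y hy

/-- The radial map that transforms the square of the norm by `f`. -/
def profileMap (f : ℝ → ℝ) (v : TotalSpace 𝔼[m] V) : TotalSpace 𝔼[m] V :=
  scale (√(dslope f 0 (‖v.2‖ ^ 2))) v

theorem profileMap_of_ne_zero {f : ℝ → ℝ} (h0 : f 0 = 0) {v : TotalSpace 𝔼[m] V} (hv : v.2 ≠ 0) :
    profileMap f v = scale (√(f (‖v.2‖ ^ 2))) (direction v) := by
  have h := norm_pos_iff.2 hv
  rw [profileMap, dslope_of_ne _ (by positivity), slope_def_field, h0, sub_zero, sub_zero,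
    Real.sqrt_div' _ (by positivity), Real.sqrt_sq h.le, direction, scale_scale, div_eq_mul_inv]

theorem profileMap_of_eq_zero {f : ℝ → ℝ} {v : TotalSpace 𝔼[m] V} (hv : v.2 = 0) :
    profileMap f v = v := scale_of_eq_zero hv _

theorem norm_profileMap {f : ℝ → ℝ} (h0 : f 0 = 0) (v : TotalSpace 𝔼[m] V) :
    ‖(profileMap f v).2‖ = √(f (‖v.2‖ ^ 2)) := by
  by_cases hv : v.2 = 0
  · rw [profileMap_of_eq_zero hv, hv, norm_zero, zero_pow two_ne_zero, h0, Real.sqrt_zero]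
  · rw [profileMap_of_ne_zero h0 hv, norm_scale_sphere (direction_mem hv) (Real.sqrt_nonneg _)]

theorem profileMap_profileMap {f g : ℝ → ℝ} (hf0 : f 0 = 0) (hg0 : g 0 = 0)
    {v : TotalSpace 𝔼[m] V} (hf : v.2 ≠ 0 → 0 < f (‖v.2‖ ^ 2))
    (hgf : g (f (‖v.2‖ ^ 2)) = ‖v.2‖ ^ 2) : profileMap g (profileMap f v) = v := by
  by_cases hv : v.2 = 0
  · rw [profileMap_of_eq_zero hv, profileMap_of_eq_zero hv]
  · have h1 : 0 < √(f (‖v.2‖ ^ 2)) := Real.sqrt_pos.2 (hf hv)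
    have h2 : (profileMap f v).2 ≠ 0 := by
      rw [← norm_ne_zero_iff, norm_profileMap hf0]
      exact h1.ne'
    rw [profileMap_of_ne_zero hg0 h2, norm_profileMap hf0, Real.sq_sqrt (hf hv).le, hgf,
      Real.sqrt_sq (norm_nonneg _), profileMap_of_ne_zero hf0 hv, direction_scale h1,
      direction_of_mem (direction_mem hv), scale_direction hv]

/-- Prescribing the squared norm `q` keeps the zero section harmless: the factor is the root of
f(q)/q, smooth at `q = 0` by Hadamard's lemma. It must not vanish for the root to be smooth. -/
theorem contMDiffAt_profileMap {f : ℝ → ℝ} (h0 : f 0 = 0) {v : TotalSpace 𝔼[m] V}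
    (hf : ContDiffAt ℝ ∞ f (‖v.2‖ ^ 2)) (hne : dslope f 0 (‖v.2‖ ^ 2) ≠ 0) :
    ContMDiffAt 𝓑[d, m] 𝓑[d, m] ∞ (profileMap f) v := by
  simp_rw [← real_inner_self_eq_norm_sq] at hf hne
  have h1 := ContMDiffAt.comp (g := fun q => √(dslope f 0 q)) v
    ((contDiffAt_dslope_zero hf h0).sqrt hne).contMDiffAt (contMDiff_normSq d v)
  refine (contMDiffAt_scale h1 contMDiffAt_id).congr_of_eventuallyEq (.of_forall fun u => ?_)
  rw [profileMap, ← real_inner_self_eq_norm_sq]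
  rfl

end ProfileMap

/-! ### Boundary behaviour of disk bundle diffeomorphisms in squared collar coordinates -/

section CollarStraightening

open Filter

/-- This is the reason for the double exponential. In the squeezed coordinate, multiplying the
defining function by a positive `a` changes `σ` only by terms flat at `σ = 0`. A profile like
exp(-1/σ) would give σ / (1 - σ log a), which agrees with `σ` only to first order. -/
theorem collarProfileInv_collarProfile_mul {σ a : ℝ} (hσ : 0 ≤ σ) (ha : 0 < a)
    (h : 0 < 1 - expNegInvGlue σ * Real.log a) :
    collarProfileInv (collarProfile σ * a) =
      σ / (1 + σ * Real.log (1 - expNegInvGlue σ * Real.log a)) := by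
  rcases hσ.eq_or_lt with rfl | h0
  · rw [collarProfile_of_nonpos le_rfl, zero_mul, collarProfileInv_of_nonpos le_rfl, zero_div]
  · have h1 : Real.exp 1 - Real.log (collarProfile σ * a) =
        Real.exp σ⁻¹ * (1 - expNegInvGlue σ * Real.log a) := by
      rw [Real.log_mul (collarProfile_pos h0).ne' ha.ne', collarProfile_of_pos h0, Real.log_exp,
        expNegInvGlue_of_pos h0, mul_sub, ← mul_assoc, ← Real.exp_add, add_neg_cancel, Real.exp_zero]
      ring
    rw [collarProfileInv_of_pos (mul_pos (collarProfile_pos h0) ha), h1,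
      Real.log_mul (Real.exp_pos _).ne' h.ne', Real.log_exp, ← inv_div]
    congr 1
    field_simp

variable {d m : ℕ} {M : Type*} [TopologicalSpace M] [ChartedSpace 𝔼[d] M] [IsManifold (𝓡 d) ∞ M]
  {V : M → Type*} [∀ x, NormedAddCommGroup (V x)] [∀ x, InnerProductSpace ℝ (V x)]
  [TopologicalSpace (TotalSpace 𝔼[m] V)] [FiberBundle 𝔼[m] V] [VectorBundle ℝ 𝔼[m] V]
  [ContMDiffVectorBundle ∞ 𝔼[m] V (𝓡 d)] [IsContMDiffRiemannianBundle (𝓡 d) ∞ 𝔼[m] V]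

theorem collarProfileMap_zero : 1 - collarProfile (1 - 0) = 0 := by
  rw [sub_zero, collarProfile_one, sub_self]

theorem collarProfileInv_one : collarProfileInv 1 = 1 := by
  have := collarProfileInv_collarProfile zero_le_one
  rwa [collarProfile_one] at this

theorem collarProfileInvMap_zero : 1 - collarProfileInv (1 - 0) = 0 := by
  rw [sub_zero, collarProfileInv_one, sub_self]

theorem sq_norm_le_one {v : TotalSpace 𝔼[m] V} (hv : ‖v.2‖ ≤ 1) : ‖v.2‖ ^ 2 ≤ 1 :=
  pow_le_one₀ (norm_nonneg _) hv

/-- The radial homeomorphism of the disk bundle that squeezes the collar of the boundary by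
`collarProfile`. -/
def diskProfileEquiv : diskBundle m V ≃ diskBundle m V where
  toFun v := ⟨profileMap (fun q => 1 - collarProfile (1 - q)) v, by
    change ‖_‖ ≤ 1
    rw [norm_profileMap collarProfileMap_zero, Real.sqrt_le_one]
    linarith [collarProfile_nonneg (1 - ‖v.1.2‖ ^ 2)]⟩
  invFun v := ⟨profileMap (fun q => 1 - collarProfileInv (1 - q)) v, by
    change ‖_‖ ≤ 1
    rw [norm_profileMap collarProfileInvMap_zero, Real.sqrt_le_one]
    linarith [collarProfileInv_nonneg (τ := 1 - ‖v.1.2‖ ^ 2) (by linarith [sq_nonneg ‖v.1.2‖])]⟩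
  left_inv v := Subtype.ext (by
    have h1 := sq_norm_le_one v.2
    refine profileMap_profileMap collarProfileMap_zero collarProfileInvMap_zero (fun hv => ?_) ?_
    · have := norm_pos_iff.2 hv
      have := collarProfile_lt_one (σ := 1 - ‖v.1.2‖ ^ 2) (by linarith [pow_pos this 2])
      linarith
    · rw [sub_sub_cancel, collarProfileInv_collarProfile (by linarith), sub_sub_cancel])
  right_inv v := Subtype.ext (by
    have h1 := sq_norm_le_one v.2
    have h2 := sq_nonneg ‖v.1.2‖
    have h3 := collarProfile_collarProfileInv (τ := 1 - ‖v.1.2‖ ^ 2) (by linarith) (by linarith)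
    refine profileMap_profileMap collarProfileInvMap_zero collarProfileMap_zero (fun hv => ?_) ?_
    · have := norm_pos_iff.2 hv
      have h4 := collarProfileInv_le_one (τ := 1 - ‖v.1.2‖ ^ 2) (by linarith)
      rcases h4.eq_or_lt with h5 | h5
      · rw [h5, collarProfile_one] at h3
        have := pow_pos this 2
        linarith
      · linarith
    · rw [sub_sub_cancel, h3, sub_sub_cancel])

/-- The point at distance `√(1 - z²)` from the zero section on the ray through `u`. -/
def collarRay (p : ℝ × TotalSpace 𝔼[m] V) : TotalSpace 𝔼[m] V :=
  scale (√(1 - p.1 ^ 2)) (direction p.2)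

theorem norm_collarRay {z : ℝ} {u : TotalSpace 𝔼[m] V} (hu : u.2 ≠ 0) :
    ‖(collarRay (z, u)).2‖ = √(1 - z ^ 2) :=
  norm_scale_sphere (direction_mem hu) (Real.sqrt_nonneg _)

/-- No bound on `z` is needed: for `|z| > 1` the real square root is `0` by convention and the point
lies on the zero section. -/
theorem norm_collarRay_le {z : ℝ} {u : TotalSpace 𝔼[m] V} (hu : u.2 ≠ 0) :
    ‖(collarRay (z, u)).2‖ ≤ 1 := by
  rw [norm_collarRay hu, Real.sqrt_le_one]
  linarith [sq_nonneg z]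

theorem collarRay_zero (u : TotalSpace 𝔼[m] V) : collarRay (0, u) = direction u := by
  rw [collarRay, zero_pow two_ne_zero, sub_zero, Real.sqrt_one, scale_one]

theorem contMDiffOn_collarRay :
    ContMDiffOn (𝓘(ℝ, ℝ).prod 𝓑[d, m]) 𝓑[d, m] ∞ (collarRay (m := m) (V := V))
      (Ioo (-1) 1 ×ˢ {u | u.2 ≠ 0}) := by
  refine contMDiffOn_scale ?_ ((contMDiffOn_direction d).comp contMDiffOn_snd fun p hp => hp.2)
  have h1 : ContDiffOn ℝ ∞ (fun z : ℝ => √(1 - z ^ 2)) (Ioo (-1) 1) := by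
    refine ContDiffOn.sqrt (by fun_prop) fun z hz => ?_
    nlinarith [hz.1, hz.2]
  exact h1.contMDiffOn.comp contMDiffOn_fst fun p hp => hp.1

/-- The rays turn the defining function 1 - ‖v‖² into z², so a full neighbourhood of `z = 0` is
mapped into the disk bundle. One-sided smoothness of `g` at the boundary becomes ordinary
smoothness. -/
theorem contMDiffAt_comp_collarRay {g : TotalSpace 𝔼[m] V → TotalSpace 𝔼[m] V}
    (hg : ContMDiffOn 𝓑[d, m] 𝓑[d, m] ∞ g (diskBundle m V)) {u : TotalSpace 𝔼[m] V}
    (hu : u.2 ≠ 0) :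
    ContMDiffAt (𝓘(ℝ, ℝ).prod 𝓑[d, m]) 𝓑[d, m] ∞ (fun p => g (collarRay p)) (0, u) :=
  (hg.comp contMDiffOn_collarRay fun p hp => norm_collarRay_le hp.2).contMDiffAt
    (prod_mem_nhds (Ioo_mem_nhds (by norm_num) (by norm_num)) ((isOpen_ne_zero d).mem_nhds hu))

/-- `c` is the quotient of the defining functions `1 - ‖g v‖²` and `1 - ‖v‖²` of the boundary of the
disk bundle, in the coordinates given by `collarRay`. -/
def IsCollarQuotient (d : ℕ) [ChartedSpace 𝔼[d] M] (g : TotalSpace 𝔼[m] V → TotalSpace 𝔼[m] V)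
    (c : ℝ × TotalSpace 𝔼[m] V → ℝ) : Prop :=
  ∀ u : TotalSpace 𝔼[m] V, u.2 ≠ 0 → ContMDiffAt (𝓘(ℝ, ℝ).prod 𝓑[d, m]) 𝓘(ℝ, ℝ) ∞ c (0, u) ∧
    ∀ z, 1 - ‖(g (collarRay (z, u))).2‖ ^ 2 = z ^ 2 * c (z, u)

/-- As a function of `z`, 1 - ‖g‖² is nonnegative and vanishes at `z = 0`, so its first derivative
vanishes there as well. Hadamard's lemma can be applied twice and splits off z². -/
theorem exists_isCollarQuotient {g : TotalSpace 𝔼[m] V → TotalSpace 𝔼[m] V}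
    (hg : ContMDiffOn 𝓑[d, m] 𝓑[d, m] ∞ g (diskBundle m V))
    (hg1 : ∀ v, ‖v.2‖ ≤ 1 → ‖(g v).2‖ ≤ 1) (hg2 : ∀ v, ‖v.2‖ = 1 → ‖(g v).2‖ = 1) :
    ∃ c, IsCollarQuotient d g c := by
  set f : ℝ × TotalSpace 𝔼[m] V → ℝ := fun p => 1 - ‖(g (collarRay p)).2‖ ^ 2 with hf
  have hfs : ∀ u : TotalSpace 𝔼[m] V, u.2 ≠ 0 →
      ContMDiffAt (𝓘(ℝ, ℝ).prod 𝓑[d, m]) 𝓘(ℝ, ℝ) ∞ f (0, u) := fun u hu => by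
    have h1 := ContMDiffAt.comp (0, u) (contMDiff_normSq d _) (contMDiffAt_comp_collarRay hg hu)
    refine ((contMDiffAt_const (c := (1 : ℝ))).sub h1).congr_of_eventuallyEq
      (.of_forall fun p => ?_)
    simp only [hf, ← real_inner_self_eq_norm_sq]
    rfl
  have hf0 : ∀ u : TotalSpace 𝔼[m] V, u.2 ≠ 0 → f (0, u) = 0 := fun u hu => by
    change 1 - ‖(g (collarRay (0, u))).2‖ ^ 2 = 0
    rw [collarRay_zero, hg2 _ (direction_mem hu), one_pow, sub_self]
  have hfpos : ∀ (z : ℝ) (u : TotalSpace 𝔼[m] V), u.2 ≠ 0 → 0 ≤ f (z, u) := fun z u hu => by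
    have := sq_norm_le_one (hg1 _ (norm_collarRay_le (z := z) hu))
    simp only [hf]
    linarith
  set f₁ : ℝ × TotalSpace 𝔼[m] V → ℝ := fun p => dslope (fun t => f (t, p.2)) 0 p.1 with hf₁
  have hf₁0 : ∀ u : TotalSpace 𝔼[m] V, u.2 ≠ 0 → f₁ (0, u) = 0 := fun u hu => by
    simp only [hf₁, dslope_same]
    refine IsLocalMin.deriv_eq_zero (.of_forall fun t => ?_)
    exact (hf0 u hu).trans_le (hfpos t u hu)
  have hev : ∀ u : TotalSpace 𝔼[m] V, u.2 ≠ 0 → ∀ᶠ w : TotalSpace 𝔼[m] V in 𝓝 u, w.2 ≠ 0 :=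
    fun u hu => (isOpen_ne_zero d).mem_nhds hu
  refine ⟨fun p => dslope (fun t => f₁ (t, p.2)) 0 p.1, fun u hu => ⟨?_, fun z => ?_⟩⟩
  · exact ((hfs u hu).dslope_fst ((hev u hu).mono hf0)).dslope_fst ((hev u hu).mono hf₁0)
  · have h1 := sub_smul_dslope (fun t => f (t, u)) 0 z
    have h2 := sub_smul_dslope (fun t => f₁ (t, u)) 0 z
    simp only [hf0 u hu, hf₁0 u hu, sub_zero, smul_eq_mul] at h1 h2
    change f (z, u) = _
    rw [← h1, sq, mul_assoc, h2]

/-- The quotients of `g` and its inverse multiply to `1` along the rays, so c(0, s) c'(0, g s) = 1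
in the limit. Since `c` is nonnegative for small `z > 0`, its limit is positive. -/
theorem IsCollarQuotient.pos {g g' : TotalSpace 𝔼[m] V → TotalSpace 𝔼[m] V}
    {c c' : ℝ × TotalSpace 𝔼[m] V → ℝ} (hc : IsCollarQuotient d g c)
    (hc' : IsCollarQuotient d g' c') (hg : ContMDiffOn 𝓑[d, m] 𝓑[d, m] ∞ g (diskBundle m V))
    (hg1 : ∀ v, ‖v.2‖ ≤ 1 → ‖(g v).2‖ ≤ 1) (hg2 : ∀ v, ‖v.2‖ = 1 → ‖(g v).2‖ = 1)
    (hgg : ∀ v, ‖v.2‖ ≤ 1 → g' (g v) = v) {s : TotalSpace 𝔼[m] V} (hs : ‖s.2‖ = 1) :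
    0 < c (0, s) := by
  have hs0 : s.2 ≠ 0 := ne_zero_of_mem_sphereBundle hs
  have hds : direction s = s := direction_of_mem hs
  have hgs : (g s).2 ≠ 0 := ne_zero_of_mem_sphereBundle (hg2 s hs)
  have hline : Tendsto (fun z : ℝ => (z, s)) (𝓝[>] 0) (𝓝 (0, s)) :=
    ((by fun_prop : Continuous fun z : ℝ => (z, s)).tendsto' _ _ rfl).mono_left nhdsWithin_le_nhds
  set y : ℝ → TotalSpace 𝔼[m] V := fun z => g (collarRay (z, s)) with hy
  have hyt : Tendsto y (𝓝[>] 0) (𝓝 (g s)) := by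
    have := (contMDiffAt_comp_collarRay hg hs0).continuousAt.tendsto.comp hline
    rwa [collarRay_zero, hds] at this
  have hct : Tendsto (fun z => c (z, s)) (𝓝[>] 0) (𝓝 (c (0, s))) :=
    (hc s hs0).1.continuousAt.tendsto.comp hline
  -- The collar coordinate of the image point `y z`: for small `z > 0`, `collarRay (z' z, y z) = y
  -- z`.
  set z' : ℝ → ℝ := fun z => √(z ^ 2 * c (z, s))
  have hzt : Tendsto z' (𝓝[>] 0) (𝓝 0) := by
    have h1 : Tendsto (fun z : ℝ => z ^ 2) (𝓝[>] 0) (𝓝 0) :=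
      ((continuous_pow 2).tendsto' _ _ (by norm_num)).mono_left nhdsWithin_le_nhds
    have h2 := (h1.mul hct).sqrt
    rwa [zero_mul, Real.sqrt_zero] at h2
  have hct' : Tendsto (fun z => c' (z' z, y z)) (𝓝[>] 0) (𝓝 (c' (0, g s))) :=
    (hc' _ hgs).1.continuousAt.tendsto.comp (hzt.prodMk_nhds hyt)
  have hy0 : ∀ᶠ z in 𝓝[>] 0, (y z).2 ≠ 0 :=
    hyt.eventually ((isOpen_ne_zero d).mem_nhds hgs)
  have hnn : ∀ᶠ z in 𝓝[>] (0 : ℝ), 0 ≤ c (z, s) := by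
    filter_upwards [self_mem_nhdsWithin] with z (hz : 0 < z)
    have h1 := (hc s hs0).2 z
    have h2 := sq_norm_le_one (hg1 _ (norm_collarRay_le (z := z) hs0))
    have h3 : 0 ≤ z ^ 2 * c (z, s) := by linarith
    exact nonneg_of_mul_nonneg_right h3 (by positivity)
  have hprod : ∀ᶠ z in 𝓝[>] (0 : ℝ), c (z, s) * c' (z' z, y z) = 1 := by
    filter_upwards [self_mem_nhdsWithin, hy0, hnn, Ioo_mem_nhdsGT (zero_lt_one (α := ℝ))]
      with z (hz : 0 < z) h1 h2 h3
    have e1 : 1 - ‖(y z).2‖ ^ 2 = z ^ 2 * c (z, s) := (hc s hs0).2 z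
    have e2 : z' z ^ 2 = z ^ 2 * c (z, s) := Real.sq_sqrt (by positivity)
    have e3 : collarRay (z' z, y z) = y z := by
      rw [collarRay]
      simp only
      rw [e2, ← e1, sub_sub_cancel, Real.sqrt_sq (norm_nonneg _), scale_direction h1]
    have e4 := (hc' _ h1).2 (z' z)
    rw [e3, hy, hgg _ (norm_collarRay_le hs0), norm_collarRay hs0, Real.sq_sqrt, sub_sub_cancel]
      at e4
    · change z ^ 2 = z' z ^ 2 * c' (z' z, y z) at e4
      rw [e2, mul_assoc] at e4
      exact (mul_left_cancel₀ (pow_ne_zero 2 hz.ne') (by rw [mul_one]; exact e4)).symm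
    · nlinarith [h3.1, h3.2]
  have h1 : c (0, s) * c' (0, g s) = 1 :=
    tendsto_nhds_unique ((hct.mul hct').congr' hprod) tendsto_const_nhds
  have h2 : 0 ≤ c (0, s) := ge_of_tendsto hct hnn
  exact h2.lt_of_ne fun h => by rw [← h, zero_mul] at h1; exact zero_ne_one h1

end CollarStraightening

/-! ### Straightening an extendable diffeomorphism along the boundary -/

section StraightenedDiffeomorphism

open Filter

variable {d m : ℕ} {M : Type*} [TopologicalSpace M] [ChartedSpace 𝔼[d] M] [IsManifold (𝓡 d) ∞ M]
  {V : M → Type*} [∀ x, NormedAddCommGroup (V x)] [∀ x, InnerProductSpace ℝ (V x)]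
  [TopologicalSpace (TotalSpace 𝔼[m] V)] [FiberBundle 𝔼[m] V] [VectorBundle ℝ 𝔼[m] V]
  [ContMDiffVectorBundle ∞ 𝔼[m] V (𝓡 d)] [IsContMDiffRiemannianBundle (𝓡 d) ∞ 𝔼[m] V]

/-- The conjugate of a map of the disk bundle by the squeezing `diskProfileEquiv`. -/
def straighten (F : diskBundle m V ≃ diskBundle m V) : diskBundle m V ≃ diskBundle m V :=
  (diskProfileEquiv.trans F).trans diskProfileEquiv.symm

theorem diskProfileEquiv_sphereToDisk (s : sphereBundle m V) :
    diskProfileEquiv (sphereToDisk s) = sphereToDisk s := by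
  refine Subtype.ext ?_
  change profileMap (fun q => 1 - collarProfile (1 - q)) s.1 = s.1
  rw [profileMap_of_ne_zero collarProfileMap_zero (ne_zero_of_mem_sphereBundle s.2),
    show ‖s.1.2‖ = 1 from s.2, one_pow, sub_self, collarProfile_of_nonpos le_rfl, sub_zero,
    Real.sqrt_one, scale_one, direction_of_mem s.2]

theorem straighten_sphereToDisk {F : diskBundle m V ≃ diskBundle m V}
    {h : sphereBundle m V → sphereBundle m V}
    (hF : ∀ s, F (sphereToDisk s) = sphereToDisk (h s)) (s : sphereBundle m V) :
    straighten F (sphereToDisk s) = sphereToDisk (h s) := by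
  change diskProfileEquiv.symm (F (diskProfileEquiv (sphereToDisk s))) = _
  rw [diskProfileEquiv_sphereToDisk, hF, Equiv.symm_apply_eq, diskProfileEquiv_sphereToDisk]

theorem profileMap_collarProfile_eq_collarRay {u : TotalSpace 𝔼[m] V} (hu : u.2 ≠ 0) :
    profileMap (fun q => 1 - collarProfile (1 - q)) u =
      collarRay (collarRoot (1 - ‖u.2‖ ^ 2), u) :=
  profileMap_of_ne_zero collarProfileMap_zero hu

/-- The two profiles are inverse to each other near `0`, so by the chain rule their derivatives at
`0` multiply to `1`. -/
theorem dslope_collarProfile_ne_zero :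
    dslope (fun q => 1 - collarProfile (1 - q)) 0 0 ≠ 0 ∧
      dslope (fun q => 1 - collarProfileInv (1 - q)) 0 0 ≠ 0 := by
  rw [dslope_same, dslope_same]
  have h1 : DifferentiableAt ℝ (fun q => 1 - collarProfile (1 - q)) 0 :=
    ((contDiff_const.sub (contDiff_collarProfile.comp
      (contDiff_const.sub contDiff_id))).differentiable (by simp)).differentiableAt
  have h2 : DifferentiableAt ℝ (fun q => 1 - collarProfileInv (1 - q))
      (1 - collarProfile (1 - 0)) := by
    rw [collarProfileMap_zero]
    have h3 : ContDiffAt ℝ ∞ collarProfileInv (1 - 0) := by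
      rw [sub_zero]
      exact contDiffAt_collarProfileInv one_pos le_rfl
    exact (contDiffAt_const.sub (h3.comp (0 : ℝ)
      (contDiffAt_const.sub contDiffAt_id))).differentiableAt (by simp)
  have h3 := h2.hasDerivAt.comp (0 : ℝ) h1.hasDerivAt
  have h4 : (fun q => 1 - collarProfileInv (1 - q)) ∘ (fun q => 1 - collarProfile (1 - q))
      =ᶠ[𝓝 0] id := by
    filter_upwards [gt_mem_nhds (zero_lt_one (α := ℝ))] with q hq
    simp only [Function.comp_apply, id]
    rw [sub_sub_cancel, collarProfileInv_collarProfile (by linarith), sub_sub_cancel]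
  have h5 := (h3.congr_of_eventuallyEq h4.symm).unique (hasDerivAt_id 0)
  rw [collarProfileMap_zero] at h5
  constructor <;> intro h <;> rw [h] at h5 <;> simp at h5

theorem contMDiffAt_profileMap_collarProfile {v : TotalSpace 𝔼[m] V} :
    ContMDiffAt 𝓑[d, m] 𝓑[d, m] ∞ (profileMap fun q => 1 - collarProfile (1 - q)) v := by
  refine contMDiffAt_profileMap collarProfileMap_zero (contDiff_const.sub
    (contDiff_collarProfile.comp (contDiff_const.sub contDiff_id))).contDiffAt ?_
  by_cases h0 : ‖v.2‖ = 0
  · rw [h0, zero_pow two_ne_zero]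
    exact dslope_collarProfile_ne_zero.1
  · have h1 : 0 < ‖v.2‖ := lt_of_le_of_ne (norm_nonneg _) (Ne.symm h0)
    rw [dslope_of_ne _ (by positivity), slope_def_field, collarProfileMap_zero, sub_zero, sub_zero]
    have h2 := collarProfile_lt_one (σ := 1 - ‖v.2‖ ^ 2) (by linarith [pow_pos h1 2])
    exact div_ne_zero (by linarith) (by positivity)

/-- Restricted to the open disk bundle: as the inverse of a flat function, `collarProfileInv` is not
differentiable at `0`. The boundary needs the separate argument of `contMDiffAt_straighten_of_eq`.
-/
theorem contMDiffAt_profileMap_collarProfileInv {v : TotalSpace 𝔼[m] V} (hv : ‖v.2‖ < 1) :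
    ContMDiffAt 𝓑[d, m] 𝓑[d, m] ∞ (profileMap fun q => 1 - collarProfileInv (1 - q)) v := by
  have hsq : ‖v.2‖ ^ 2 < 1 := pow_lt_one₀ (norm_nonneg _) hv two_ne_zero
  have hτ : ContDiffAt ℝ ∞ collarProfileInv (1 - ‖v.2‖ ^ 2) :=
    contDiffAt_collarProfileInv (by linarith) (by linarith [sq_nonneg ‖v.2‖])
  refine contMDiffAt_profileMap collarProfileInvMap_zero (contDiffAt_const.sub
    (hτ.comp _ (contDiffAt_const.sub contDiffAt_id))) ?_
  by_cases h0 : ‖v.2‖ = 0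
  · rw [h0, zero_pow two_ne_zero]
    exact dslope_collarProfile_ne_zero.2
  · have h1 : 0 < ‖v.2‖ := lt_of_le_of_ne (norm_nonneg _) (Ne.symm h0)
    rw [dslope_of_ne _ (by positivity), slope_def_field, collarProfileInvMap_zero, sub_zero,
      sub_zero]
    refine div_ne_zero (fun h => ?_) (by positivity)
    have h2 := collarProfile_collarProfileInv (τ := 1 - ‖v.2‖ ^ 2) (by linarith)
      (by linarith [sq_nonneg ‖v.2‖])
    rw [← sub_eq_zero.1 h, collarProfile_one] at h2
    linarith [pow_pos h1 2]

variable {F : DiskDiffeo d m V} {h : SphereDiffeo d m V}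

theorem norm_lt_one_of_norm_lt_one (hF : ∀ s, F (sphereToDisk s) = sphereToDisk (h s))
    {v : diskBundle m V} (hv : ‖v.1.2‖ < 1) : ‖(F v).1.2‖ < 1 := by
  refine lt_of_le_of_ne (F v).2 fun h1 => hv.ne ?_
  have h2 := hF (h.symm ⟨F v, h1⟩)
  rw [show h (h.symm ⟨F v, h1⟩) = _ from h.toEquiv.apply_symm_apply _] at h2
  have h3 : sphereToDisk (h.symm ⟨F v, h1⟩) = v := F.toEquiv.injective h2
  rw [← h3]
  exact (h.symm ⟨F v, h1⟩).2

theorem contMDiffAt_straighten_of_lt (hF : ∀ s, F (sphereToDisk s) = sphereToDisk (h s))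
    {v : TotalSpace 𝔼[m] V} (hv : ‖v.2‖ < 1) :
    ContMDiffAt 𝓑[d, m] 𝓑[d, m] ∞ (diskRadialEquiv (straighten F.toEquiv) h.toEquiv) v := by
  obtain ⟨g, hg, hgF⟩ := F.smooth_toFun
  have hdisk : ∀ u : TotalSpace 𝔼[m] V, ‖u.2‖ < 1 → diskBundle m V ∈ 𝓝 u := fun u hu => by
    filter_upwards [(continuous_norm_bundle (m := m) (V := V) d).continuousAt.eventually_lt
      (g := fun _ => (1 : ℝ)) continuousAt_const hu] with w hw
    exact hw.le
  set θ : TotalSpace 𝔼[m] V → TotalSpace 𝔼[m] V := profileMap fun q => 1 - collarProfile (1 - q)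
  have hθ : ‖(θ v).2‖ < 1 := by
    rw [norm_profileMap collarProfileMap_zero, Real.sqrt_lt' one_pos, one_pow]
    have hsq : ‖v.2‖ ^ 2 < 1 := pow_lt_one₀ (norm_nonneg _) hv two_ne_zero
    linarith [collarProfile_pos (σ := 1 - ‖v.2‖ ^ 2) (by linarith)]
  have hgθ : ‖(g (θ v)).2‖ < 1 := by
    rw [show g (θ v) = _ from hgF ⟨θ v, hθ.le⟩]
    exact norm_lt_one_of_norm_lt_one hF hθ
  have h1 := (contMDiffAt_profileMap_collarProfileInv (d := d) hgθ).comp v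
    ((hg.contMDiffAt (hdisk _ hθ)).comp v contMDiffAt_profileMap_collarProfile)
  refine h1.congr_of_eventuallyEq ?_
  filter_upwards [hdisk v hv] with u hu
  rw [diskRadialEquiv_of_le hu]
  have h2 := hgF (diskProfileEquiv ⟨u, hu⟩)
  change profileMap _ (F (diskProfileEquiv ⟨u, hu⟩)).1 = profileMap _ (g (θ u))
  rw [← h2]
  rfl

/-- With σ = 1 - ‖u‖², one smooth formula describes the map on both sides of the boundary: the
direction is that of `F` at collar coordinate `collarRoot σ`, and the squared norm is 1 - R(σ, a)
with `a` the positive collar quotient of `F`. The singular inverse profile has disappeared from it.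
-/
theorem contMDiffAt_straighten_of_eq (hF : ∀ s, F (sphereToDisk s) = sphereToDisk (h s))
    {v : TotalSpace 𝔼[m] V} (hv : ‖v.2‖ = 1) :
    ContMDiffAt 𝓑[d, m] 𝓑[d, m] ∞ (diskRadialEquiv (straighten F.toEquiv) h.toEquiv) v := by
  obtain ⟨g, hg, hgF⟩ := F.smooth_toFun
  obtain ⟨g', hg', hgF'⟩ := F.smooth_invFun
  have hgle : ∀ u, ‖u.2‖ ≤ 1 → ‖(g u).2‖ ≤ 1 := fun u hu => by
    rw [show g u = _ from hgF ⟨u, hu⟩]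
    exact (F ⟨u, hu⟩).2
  have hgle' : ∀ u, ‖u.2‖ ≤ 1 → ‖(g' u).2‖ ≤ 1 := fun u hu => by
    rw [show g' u = _ from hgF' ⟨u, hu⟩]
    exact (F.symm ⟨u, hu⟩).2
  have hgs : ∀ s : sphereBundle m V, g s = h s := fun s =>
    (hgF (sphereToDisk s)).trans (congrArg Subtype.val (hF s))
  have hF' : ∀ s, F.symm (sphereToDisk s) = sphereToDisk (h.symm s) := fun s => by
    refine F.toEquiv.symm_apply_eq.2 ?_
    rw [hF]
    exact congrArg sphereToDisk (h.toEquiv.apply_symm_apply s).symm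
  have hgs' : ∀ s : sphereBundle m V, g' s = h.symm s := fun s =>
    (hgF' (sphereToDisk s)).trans (congrArg Subtype.val (hF' s))
  have hgeq : ∀ u, ‖u.2‖ = 1 → ‖(g u).2‖ = 1 := fun u hu => by
    rw [show g u = _ from hgs ⟨u, hu⟩]
    exact (h ⟨u, hu⟩).2
  have hgeq' : ∀ u, ‖u.2‖ = 1 → ‖(g' u).2‖ = 1 := fun u hu => by
    rw [show g' u = _ from hgs' ⟨u, hu⟩]
    exact (h.symm ⟨u, hu⟩).2
  have hgg : ∀ u, ‖u.2‖ ≤ 1 → g' (g u) = u := fun u hu => by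
    rw [show g u = _ from hgF ⟨u, hu⟩]
    exact (hgF' _).trans (congrArg Subtype.val (F.toEquiv.symm_apply_apply ⟨u, hu⟩))
  obtain ⟨c, hc⟩ := exists_isCollarQuotient (d := d) hg hgle hgeq
  obtain ⟨c', hc'⟩ := exists_isCollarQuotient (d := d) hg' hgle' hgeq'
  have hcv := hc.pos hc' hg hgle hgeq hgg hv
  have hv0 : v.2 ≠ 0 := ne_zero_of_mem_sphereBundle hv
  set σ : TotalSpace 𝔼[m] V → ℝ := fun u => 1 - ‖u.2‖ ^ 2 with hσ
  have hσs : ContMDiffAt 𝓑[d, m] 𝓘(ℝ, ℝ) ∞ σ v := by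
    refine ((contMDiffAt_const (c := (1 : ℝ))).sub (contMDiff_normSq d v)).congr_of_eventuallyEq
      (.of_forall fun u => ?_)
    simp only [hσ, ← real_inner_self_eq_norm_sq]
  have hσv : σ v = 0 := by simp only [hσ, hv, one_pow, sub_self]
  set p : TotalSpace 𝔼[m] V → ℝ × TotalSpace 𝔼[m] V := fun u => (collarRoot (σ u), u)
  have hpv : p v = (0, v) := by simp only [p, hσv, collarRoot_of_nonpos le_rfl]
  have hp : ContMDiffAt 𝓑[d, m] (𝓘(ℝ, ℝ).prod 𝓑[d, m]) ∞ p v :=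
    (contDiff_collarRoot.contMDiff.contMDiffAt.comp v hσs).prodMk contMDiffAt_id
  set a : TotalSpace 𝔼[m] V → ℝ := fun u => c (p u)
  have hav : 0 < a v := by simp only [a, hpv]; exact hcv
  have ha : ContMDiffAt 𝓑[d, m] 𝓘(ℝ, ℝ) ∞ a v := by
    refine ContMDiffAt.comp v ?_ hp
    rw [hpv]
    exact (hc v hv0).1
  set l : ℝ × ℝ → ℝ := fun q => 1 - expNegInvGlue q.1 * Real.log q.2 with hl
  have hlv : l (σ v, a v) = 1 := by
    simp only [hl, hσv, expNegInvGlue.zero_of_nonpos le_rfl, zero_mul, sub_zero]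
  have hls : ContDiffAt ℝ ∞ l (σ v, a v) :=
    contDiffAt_const.sub ((expNegInvGlue.contDiff.contDiffAt.comp _ contDiffAt_fst).mul
      (contDiffAt_snd.log hav.ne'))
  set R : ℝ × ℝ → ℝ := fun q => q.1 / (1 + q.1 * Real.log (l q)) with hR
  have hRs : ContDiffAt ℝ ∞ R (σ v, a v) := by
    refine contDiffAt_fst.div (contDiffAt_const.add (contDiffAt_fst.mul (hls.log ?_))) ?_
    · rw [hlv]
      exact one_ne_zero
    · rw [hlv, Real.log_one, mul_zero, add_zero]
      exact one_ne_zero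
  have hRv : R (σ v, a v) = 0 := by simp only [hR, hσv, zero_div]
  have hRm : ContMDiffAt 𝓑[d, m] 𝓘(ℝ, ℝ) ∞ (fun u => √(1 - R (σ u, a u))) v := by
    have h1 : ContDiffAt ℝ ∞ (fun q => √(1 - R q)) (σ v, a v) := by
      refine (contDiffAt_const.sub hRs).sqrt ?_
      rw [hRv, sub_zero]
      exact one_ne_zero
    exact ContMDiffAt.comp (g := fun q => √(1 - R q)) (f := fun u => (σ u, a u)) v h1.contMDiffAt
      (hσs.prodMk_space ha)
  set y : TotalSpace 𝔼[m] V → TotalSpace 𝔼[m] V := fun u => g (collarRay (p u)) with hy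
  have hys : ContMDiffAt 𝓑[d, m] 𝓑[d, m] ∞ y v := by
    refine ContMDiffAt.comp (g := fun q => g (collarRay q)) v ?_ hp
    rw [hpv]
    exact contMDiffAt_comp_collarRay hg hv0
  have hyv : (y v).2 ≠ 0 := by
    have : y v = g v := by
      simp only [hy, hpv]
      rw [collarRay_zero, direction_of_mem hv]
    rw [this]
    exact ne_zero_of_mem_sphereBundle (hgeq v hv)
  have hds : ContMDiffAt 𝓑[d, m] 𝓑[d, m] ∞ (fun u => direction (y u)) v :=
    ((contMDiffOn_direction d).contMDiffAt ((isOpen_ne_zero d).mem_nhds hyv)).comp v hys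
  refine (contMDiffAt_scale hRm hds).congr_of_eventuallyEq ?_
  have hev0 : ∀ᶠ u in 𝓝 v, u.2 ≠ 0 := (isOpen_ne_zero d).mem_nhds hv0
  have hevy : ∀ᶠ u in 𝓝 v, (y u).2 ≠ 0 := hys.continuousAt ((isOpen_ne_zero d).mem_nhds hyv)
  have heva : ∀ᶠ u in 𝓝 v, 0 < a u := ha.continuousAt (lt_mem_nhds hav)
  have hevl : ∀ᶠ u in 𝓝 v, 0 < l (σ u, a u) := by
    have h1 : ContinuousAt (fun u => l (σ u, a u)) v :=
      ContinuousAt.comp (f := fun u => (σ u, a u)) hls.continuousAt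
        (hσs.continuousAt.prodMk ha.continuousAt)
    exact h1 (lt_mem_nhds (by simp only [hlv]; exact one_pos))
  filter_upwards [hev0, hevy, heva, hevl] with u hu0 huy hua hul
  -- Inside, 1 - ‖F‖² at the squeezed point is `collarProfile σ * a`, and the inverse profile turns
  -- this into `R (σ, a)`. Outside, `collarRoot` and `expNegInvGlue` vanish at `σ`, and the formula
  -- becomes the radial extension of `h`.
  rcases le_or_gt ‖u.2‖ 1 with hu | hu
  · have hσu : 0 ≤ σ u := by
      have := sq_norm_le_one hu
      simp only [hσ]
      linarith
    have h1 : (diskProfileEquiv ⟨u, hu⟩ : diskBundle m V).1 = collarRay (p u) :=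
      profileMap_collarProfile_eq_collarRay hu0
    have h2 : (F (diskProfileEquiv ⟨u, hu⟩)).1 = y u := by
      rw [← hgF, h1]
    have h3 : 1 - ‖(y u).2‖ ^ 2 = collarProfile (σ u) * a u := (hc u hu0).2 (collarRoot (σ u))
    rw [diskRadialEquiv_of_le hu]
    change profileMap _ (F (diskProfileEquiv ⟨u, hu⟩)).1 = _
    rw [h2, profileMap_of_ne_zero collarProfileInvMap_zero huy, h3,
      collarProfileInv_collarProfile_mul hσu hua hul]
  · have hσu : σ u ≤ 0 := by
      simp only [hσ]
      nlinarith
    have h1 : y u = h ⟨direction u, direction_mem hu0⟩ := by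
      have : p u = (0, u) := by simp only [p, collarRoot_of_nonpos hσu]
      simp only [hy, this]
      rw [collarRay_zero]
      exact hgs ⟨direction u, direction_mem hu0⟩
    have h2 : R (σ u, a u) = σ u := by
      simp only [hR, hl, expNegInvGlue.zero_of_nonpos hσu, zero_mul, sub_zero, Real.log_one,
        mul_zero, add_zero, div_one]
    rw [diskRadialEquiv_of_ge (straighten_sphereToDisk hF) hu.le, radialEquiv_apply hu0, h1, h2,
      direction_of_mem (h _).2, sub_sub_cancel, Real.sqrt_sq (norm_nonneg _)]

/-- A diffeomorphism of the sphere bundle that extends to the disk bundle has an extension to a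
diffeomorphism of the total space that is radial outside the disk bundle. -/
theorem exists_diffeomorph_of_mem_extendableDiffeos (hh : h ∈ extendableDiffeos d m V) :
    ∃ W : TotalSpace 𝔼[m] V ≃ₘ^∞⟮𝓑[d, m], 𝓑[d, m]⟯ TotalSpace 𝔼[m] V,
      ExtendsRadially W.toEquiv h.toEquiv := by
  obtain ⟨F, hF⟩ := hh
  have key : ∀ (F : DiskDiffeo d m V) (h : SphereDiffeo d m V),
      (∀ s, F (sphereToDisk s) = sphereToDisk (h s)) →
      ContMDiff 𝓑[d, m] 𝓑[d, m] ∞ (diskRadialEquiv (straighten F.toEquiv) h.toEquiv) := by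
    intro F h hF v
    rcases lt_trichotomy ‖v.2‖ 1 with hv | hv | hv
    · exact contMDiffAt_straighten_of_lt hF hv
    · exact contMDiffAt_straighten_of_eq hF hv
    · exact contMDiffAt_diskRadialEquiv_of_gt (straighten_sphereToDisk hF) hv
  refine ⟨⟨_, key F h hF, key F.symm h.symm fun s => F.toEquiv.symm_apply_eq.2 ?_⟩,
    extendsRadially_diskRadialEquiv (straighten_sphereToDisk hF)⟩
  rw [hF]
  exact congrArg sphereToDisk (h.toEquiv.apply_symm_apply s).symm

end StraightenedDiffeomorphism

/-! ### Dividing curves from the zero section by their parameter -/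

section BlowUp

open Filter

variable {d m : ℕ} {M : Type*} [TopologicalSpace M] [ChartedSpace 𝔼[d] M] [IsManifold (𝓡 d) ∞ M]
  {V : M → Type*} [∀ x, NormedAddCommGroup (V x)] [∀ x, InnerProductSpace ℝ (V x)]
  [TopologicalSpace (TotalSpace 𝔼[m] V)] [FiberBundle 𝔼[m] V] [VectorBundle ℝ 𝔼[m] V]
  [ContMDiffVectorBundle ∞ 𝔼[m] V (𝓡 d)] [IsContMDiffRiemannianBundle (𝓡 d) ∞ 𝔼[m] V]

theorem t2Space_totalSpace [T2Space M] : T2Space (TotalSpace 𝔼[m] V) := by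
  refine t2_iff_nhds.2 fun {x y} hxy => ?_
  have hc := FiberBundle.continuous_proj 𝔼[m] V
  have hx : Tendsto (TotalSpace.proj : TotalSpace 𝔼[m] V → M) (𝓝 x ⊓ 𝓝 y) (𝓝 x.1) :=
    (hc.tendsto x).mono_left inf_le_left
  have hy : Tendsto (TotalSpace.proj : TotalSpace 𝔼[m] V → M) (𝓝 x ⊓ 𝓝 y) (𝓝 y.1) :=
    (hc.tendsto y).mono_left inf_le_right
  have hb : x.1 = y.1 := tendsto_nhds_unique hx hy
  set e := trivializationAt 𝔼[m] V x.1
  have hbx : x ∈ e.source := e.mem_source.2 (FiberBundle.mem_baseSet_trivializationAt' _)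
  have hby : y ∈ e.source :=
    e.mem_source.2 (hb ▸ FiberBundle.mem_baseSet_trivializationAt' (F := 𝔼[m]) (E := V) x.1)
  exact e.injOn hbx hby (tendsto_nhds_unique ((e.continuousAt hbx).mono_left inf_le_left)
    ((e.continuousAt hby).mono_left inf_le_right))

theorem trivialization_scale (e : Trivialization 𝔼[m] (TotalSpace.proj : TotalSpace 𝔼[m] V → M))
    [MemTrivializationAtlas e] (c : ℝ) {v : TotalSpace 𝔼[m] V} (hv : v.1 ∈ e.baseSet) :
    (e (scale c v)).2 = c • (e v).2 :=
  (e.linear ℝ hv).map_smul c v.2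

theorem trivialization_of_eq_zero
    (e : Trivialization 𝔼[m] (TotalSpace.proj : TotalSpace 𝔼[m] V → M))
    [MemTrivializationAtlas e] {v : TotalSpace 𝔼[m] V} (hv : v.1 ∈ e.baseSet) (h0 : v.2 = 0) :
    (e v).2 = 0 := by
  have h := trivialization_scale e 0 hv
  rwa [zero_smul, show scale 0 v = v from congrArg (TotalSpace.mk v.1) (by rw [h0, smul_zero])] at h

theorem trivialization_symm_scale
    (e : Trivialization 𝔼[m] (TotalSpace.proj : TotalSpace 𝔼[m] V → M))
    [MemTrivializationAtlas e] (c : ℝ) {v : TotalSpace 𝔼[m] V} (hv : v.1 ∈ e.baseSet) :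
    e.toOpenPartialHomeomorph.symm (v.1, c • (e v).2) = scale c v := by
  have h : (v.1, c • (e v).2) = e (scale c v) := by
    refine Prod.ext ?_ (trivialization_scale e c hv).symm
    exact (e.coe_fst' (x := scale c v) hv).symm
  rw [h]
  exact e.toOpenPartialHomeomorph.left_inv (e.mem_source.2 (show (scale c v).1 ∈ e.baseSet from hv))

variable {E : Type} [NormedAddCommGroup E] [NormedSpace ℝ E] [FiniteDimensional ℝ E]
  {H : Type*} [TopologicalSpace H] {I : ModelWithCorners ℝ E H} [I.Boundaryless]
  {W : Type*} [TopologicalSpace W] [ChartedSpace H W] [IsManifold I ∞ W]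

/-- Describes the initial fibre velocity as a limit in the total space. Uniqueness of limits then
shows that computing it in another trivialization gives the same vector. -/
theorem tendsto_scale_inv {Γ : ℝ → TotalSpace 𝔼[m] V} (hΓ : ContMDiffAt 𝓘(ℝ, ℝ) 𝓑[d, m] ∞ Γ 0)
    (h0 : (Γ 0).2 = 0) (e : Trivialization 𝔼[m] (TotalSpace.proj : TotalSpace 𝔼[m] V → M))
    [MemTrivializationAtlas e] (he : (Γ 0).1 ∈ e.baseSet) :
    Tendsto (fun r => scale r⁻¹ (Γ r)) (𝓝[≠] 0)
      (𝓝 (e.toOpenPartialHomeomorph.symm ((Γ 0).1, deriv (fun r => (e (Γ r)).2) 0))) := by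
  have hs : Γ 0 ∈ e.source := e.mem_source.2 he
  have h1 : ContMDiffAt 𝓘(ℝ, ℝ) 𝓑[d, m] ∞ (fun r => e (Γ r)) 0 :=
    ((e.contMDiffOn (n := ∞) (IB := 𝓡 d)).contMDiffAt (e.open_source.mem_nhds hs)).comp 0 hΓ
  have h2 : DifferentiableAt ℝ (fun r => (e (Γ r)).2) 0 :=
    (contMDiffAt_iff_contDiffAt.1 h1.snd).differentiableAt (by simp)
  have h3 := hasDerivAt_iff_tendsto_slope.1 h2.hasDerivAt
  have hb : ContinuousAt (fun r => (Γ r).1) 0 :=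
    (FiberBundle.continuous_proj 𝔼[m] V).continuousAt.comp hΓ.continuousAt
  have h4 : Tendsto (fun r => ((Γ r).1, slope (fun r => (e (Γ r)).2) 0 r)) (𝓝[≠] 0)
      (𝓝 ((Γ 0).1, deriv (fun r => (e (Γ r)).2) 0)) :=
    (hb.tendsto.mono_left nhdsWithin_le_nhds).prodMk_nhds h3
  have h5 : ContinuousAt e.toOpenPartialHomeomorph.symm
      ((Γ 0).1, deriv (fun r => (e (Γ r)).2) 0) :=
    e.toOpenPartialHomeomorph.symm.continuousAt (e.mem_target.2 he)
  refine (h5.tendsto.comp h4).congr' ?_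
  filter_upwards [nhdsWithin_le_nhds (hb.preimage_mem_nhds (e.open_baseSet.mem_nhds he))] with r hr
  simp only [Function.comp_apply]
  rw [slope_def_module, trivialization_of_eq_zero e he h0, sub_zero, sub_zero,
    trivialization_symm_scale e _ hr]

/-- A family of curves in a vector bundle that starts at the zero section can be divided by the
parameter of the curves. -/
theorem exists_eq_scale_contMDiff [T2Space M] {Γ : ℝ × W → TotalSpace 𝔼[m] V}
    (hΓ : ContMDiff (𝓘(ℝ, ℝ).prod I) 𝓑[d, m] ∞ Γ) (h0 : ∀ x, (Γ (0, x)).2 = 0) :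
    ∃ γ : ℝ × W → TotalSpace 𝔼[m] V, ContMDiff (𝓘(ℝ, ℝ).prod I) 𝓑[d, m] ∞ γ ∧
      ∀ r x, Γ (r, x) = scale r (γ (r, x)) := by
  classical
  have := t2Space_totalSpace (M := M) (V := V) (m := m)
  have hcurve : ∀ x, ContMDiffAt 𝓘(ℝ, ℝ) 𝓑[d, m] ∞ (fun r => Γ (r, x)) 0 := fun x =>
    (hΓ (0, x)).comp (f := fun r : ℝ => (r, x)) 0 (contMDiffAt_id.prodMk contMDiffAt_const)
  -- The value at `r = 0`. The trivialization used depends on `x`; by `hz` any other one gives the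
  -- same vector.
  set z : W → TotalSpace 𝔼[m] V := fun x =>
    (trivializationAt 𝔼[m] V (Γ (0, x)).1).toOpenPartialHomeomorph.symm ((Γ (0, x)).1,
      deriv (fun r => (trivializationAt 𝔼[m] V (Γ (0, x)).1 (Γ (r, x))).2) 0)
  have hz1 : ∀ x, (z x).1 = (Γ (0, x)).1 := fun x =>
    (trivializationAt 𝔼[m] V (Γ (0, x)).1).proj_symm_apply'
      (FiberBundle.mem_baseSet_trivializationAt' _)
  have hz : ∀ x (e : Trivialization 𝔼[m] (TotalSpace.proj : TotalSpace 𝔼[m] V → M))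
      [MemTrivializationAtlas e], (Γ (0, x)).1 ∈ e.baseSet →
      (e (z x)).2 = deriv (fun r => (e (Γ (r, x))).2) 0 := fun x e _ he => by
    have h1 : z x = _ := tendsto_nhds_unique
      (tendsto_scale_inv (hcurve x) (h0 x) _ (FiberBundle.mem_baseSet_trivializationAt' _))
      (tendsto_scale_inv (hcurve x) (h0 x) e he)
    rw [h1]
    exact congrArg Prod.snd (e.apply_symm_apply (e.mem_target.2 he))
  set γ : ℝ × W → TotalSpace 𝔼[m] V := fun p => if p.1 = 0 then z p.2 else scale p.1⁻¹ (Γ p)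
  have hγ1 : ∀ p, (γ p).1 = (Γ p).1 := fun ⟨r, x⟩ => by
    by_cases hr : r = 0
    · subst hr
      simp only [γ, if_true]
      exact hz1 x
    · simp only [γ, if_neg hr]
      rfl
  refine ⟨γ, fun p => ?_, fun r x => ?_⟩
  · obtain ⟨r, x⟩ := p
    by_cases hr : r = 0
    · subst hr
      have hΓx := contMDiffAt_totalSpace.1 (hΓ (0, x))
      refine contMDiffAt_totalSpace.2 ⟨hΓx.1.congr_of_eventuallyEq (.of_forall hγ1), ?_⟩
      rw [hγ1]
      set e := trivializationAt 𝔼[m] V (Γ (0, x)).1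
      have hb : (Γ (0, x)).1 ∈ e.baseSet := FiberBundle.mem_baseSet_trivializationAt' _
      have hc : Continuous fun p => (Γ p).1 :=
        (FiberBundle.continuous_proj 𝔼[m] V).comp hΓ.continuous
      have hev : ∀ᶠ p in 𝓝 (0, x), (Γ p).1 ∈ e.baseSet :=
        hc.continuousAt.preimage_mem_nhds (e.open_baseSet.mem_nhds hb)
      have hc' : Continuous fun y => (Γ (0, y)).1 := hc.comp (Continuous.prodMk_right 0)
      have hev' : ∀ᶠ y in 𝓝 x, (Γ (0, y)).1 ∈ e.baseSet :=
        hc'.continuousAt.preimage_mem_nhds (e.open_baseSet.mem_nhds hb)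
      -- In one fixed trivialization the fibre coordinate of `γ` is the `dslope` of that of `Γ`.
      have hd := ContMDiffAt.dslope_fst hΓx.2 (by
        filter_upwards [hev'] with y hy using trivialization_of_eq_zero e hy (h0 y))
      refine hd.congr_of_eventuallyEq ?_
      filter_upwards [hev, continuousAt_snd.eventually hev'] with ⟨r, y⟩ hp hy
      by_cases hr : r = 0
      · subst hr
        simp only [γ, if_true, dslope_same]
        exact hz y e hp
      · simp only [γ, if_neg hr]
        rw [dslope_of_ne _ hr, slope_def_module, trivialization_of_eq_zero e hy (h0 y), sub_zero,
          sub_zero, trivialization_scale e _ hp]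
    · have h1 : ContMDiffAt (𝓘(ℝ, ℝ).prod I) 𝓘(ℝ, ℝ) ∞ (fun p : ℝ × W => p.1⁻¹) (r, x) :=
        (contDiffAt_inv ℝ hr).contMDiffAt.comp (r, x) contMDiffAt_fst
      refine (contMDiffAt_scale h1 (hΓ (r, x))).congr_of_eventuallyEq ?_
      filter_upwards [continuousAt_fst.eventually_ne hr] with p hp
      exact if_neg hp
  · by_cases hr : r = 0
    · subst hr
      simp only [γ, if_true]
      refine TotalSpace.ext (hz1 x).symm ?_
      -- Both sides are zero vectors, but over base points that are only propositionally equal.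
      have : ∀ (b : M) (u : TotalSpace 𝔼[m] V) (a : V b), a = 0 → b = u.1 →
          HEq a ((0 : ℝ) • u.2) := by
        rintro b u a rfl rfl
        rw [zero_smul]
      exact this _ _ _ (h0 x) (hz1 x).symm
    · simp only [γ, if_neg hr]
      rw [scale_scale, mul_inv_cancel₀ hr, scale_one]

end BlowUp

/-! ### Linearization along the zero section -/

section Linearization

open Filter

variable {d m : ℕ} {M : Type*} [TopologicalSpace M] [ChartedSpace 𝔼[d] M] [IsManifold (𝓡 d) ∞ M]
  {V : M → Type*} [∀ x, NormedAddCommGroup (V x)] [∀ x, InnerProductSpace ℝ (V x)]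
  [TopologicalSpace (TotalSpace 𝔼[m] V)] [FiberBundle 𝔼[m] V] [VectorBundle ℝ 𝔼[m] V]
  [ContMDiffVectorBundle ∞ 𝔼[m] V (𝓡 d)] [IsContMDiffRiemannianBundle (𝓡 d) ∞ 𝔼[m] V]

/-- `A` maps vectors of equal length, and only those, to vectors of equal length, and maps the zero
section to itself. -/
structure RespectsNorm (A : TotalSpace 𝔼[m] V → TotalSpace 𝔼[m] V) : Prop where
  norm_eq_iff : ∀ {v w}, ‖(A v).2‖ = ‖(A w).2‖ ↔ ‖v.2‖ = ‖w.2‖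
  eq_zero : ∀ {v}, v.2 = 0 → (A v).2 = 0

theorem RespectsNorm.eq_zero_iff {A : TotalSpace 𝔼[m] V → TotalSpace 𝔼[m] V} (hA : RespectsNorm A)
    {v : TotalSpace 𝔼[m] V} : (A v).2 = 0 ↔ v.2 = 0 := by
  refine ⟨fun h => ?_, hA.eq_zero⟩
  have h0 : (scale 0 v).2 = 0 := zero_smul ℝ v.2
  have h1 := hA.norm_eq_iff (v := v) (w := scale 0 v)
  rw [h, hA.eq_zero h0, h0, norm_zero, norm_zero, norm_zero] at h1
  exact norm_eq_zero.1 (h1.1 rfl)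

theorem RespectsNorm.symm {A : TotalSpace 𝔼[m] V ≃ TotalSpace 𝔼[m] V} (hA : RespectsNorm A) :
    RespectsNorm A.symm where
  norm_eq_iff {v w} := by
    rw [← hA.norm_eq_iff, A.apply_symm_apply, A.apply_symm_apply]
  eq_zero {v} h := by
    rwa [← hA.eq_zero_iff, A.apply_symm_apply]

/-- `T` maps fibres linearly to fibres. -/
def FiberwiseLinear (T : TotalSpace 𝔼[m] V → TotalSpace 𝔼[m] V) : Prop :=
  ∃ (f : M → M) (L : ∀ x, V x →ₗ[ℝ] V (f x)), ∀ v, T v = ⟨f v.1, L v.1 v.2⟩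

theorem FiberwiseLinear.map_scale {T : TotalSpace 𝔼[m] V → TotalSpace 𝔼[m] V}
    (hT : FiberwiseLinear T) (c : ℝ) (v : TotalSpace 𝔼[m] V) : T (scale c v) = scale c (T v) := by
  obtain ⟨f, L, hL⟩ := hT
  rw [hL, hL]
  exact congrArg (TotalSpace.mk (f v.1)) ((L v.1).map_smul c v.2)

theorem FiberwiseLinear.scale_comp {T : TotalSpace 𝔼[m] V → TotalSpace 𝔼[m] V}
    (hT : FiberwiseLinear T) (c : ℝ) : FiberwiseLinear fun v => scale c (T v) := by
  obtain ⟨f, L, hL⟩ := hT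
  refine ⟨f, fun x => c • L x, fun v => ?_⟩
  change scale c (T v) = _
  rw [hL]
  rfl

/-- The restriction to the unit sphere bundle of a diffeomorphism that preserves the norm. -/
def sphereRestriction (W : TotalSpace 𝔼[m] V ≃ₘ^∞⟮𝓑[d, m], 𝓑[d, m]⟯ TotalSpace 𝔼[m] V)
    (hn : ∀ v, ‖(W v).2‖ = ‖v.2‖) : SphereDiffeo d m V where
  toEquiv := W.toEquiv.subtypeEquiv fun v => by
    change ‖v.2‖ = 1 ↔ ‖(W v).2‖ = 1
    rw [hn]
  smooth_toFun := ⟨W, W.contMDiff.contMDiffOn, fun _ => rfl⟩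
  smooth_invFun := ⟨W.symm, W.symm.contMDiff.contMDiffOn, fun _ => rfl⟩

/-- Norm preservation makes the fibre maps linear isometries. Fibres have the same finite rank, so
these are invertible. -/
theorem sphereRestriction_mem {W : TotalSpace 𝔼[m] V ≃ₘ^∞⟮𝓑[d, m], 𝓑[d, m]⟯ TotalSpace 𝔼[m] V}
    (hn : ∀ v, ‖(W v).2‖ = ‖v.2‖) (hW : FiberwiseLinear W) :
    sphereRestriction W hn ∈ sphereBundleIsometries d m V := by
  obtain ⟨f, L, hL⟩ := hW
  have hrank : ∀ x, Module.finrank ℝ (V x) = m := fun x => by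
    rw [((trivializationAt 𝔼[m] V x).continuousLinearEquivAt ℝ x
      (FiberBundle.mem_baseSet_trivializationAt' x)).toLinearEquiv.finrank_eq,
      finrank_euclideanSpace_fin]
  have hfin : ∀ x, FiniteDimensional ℝ (V x) := fun x =>
    ((trivializationAt 𝔼[m] V x).continuousLinearEquivAt ℝ x
      (FiberBundle.mem_baseSet_trivializationAt' x)).symm.toLinearEquiv.finiteDimensional
  have hnorm : ∀ x (u : V x), ‖L x u‖ = ‖u‖ := fun x u => by
    have := hn ⟨x, u⟩
    rwa [hL] at this
  refine ⟨⟨W.toEquiv.subtypeEquiv fun v => by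
    change ‖v.2‖ ≤ 1 ↔ ‖(W v).2‖ ≤ 1
    rw [hn], ⟨W, W.contMDiff.contMDiffOn, fun _ => rfl⟩,
    ⟨W.symm, W.symm.contMDiff.contMDiffOn, fun _ => rfl⟩⟩, ⟨f, fun x =>
      LinearIsometry.toLinearIsometryEquiv ⟨L x, hnorm x⟩ ((hrank x).trans (hrank (f x)).symm),
      fun v => hL v⟩, fun s => rfl⟩

/-- The derivative of `A` along the zero section, in the direction of the fibres, is linear. -/
theorem fiberwiseLinear_of_eq_scale [T2Space M] {A : TotalSpace 𝔼[m] V → TotalSpace 𝔼[m] V}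
    (hA : ContMDiff 𝓑[d, m] 𝓑[d, m] ∞ A) (h0 : ∀ v, v.2 = 0 → (A v).2 = 0)
    {γ : ℝ × TotalSpace 𝔼[m] V → TotalSpace 𝔼[m] V} (hγ : Continuous γ)
    (hAγ : ∀ r v, A (scale r v) = scale r (γ (r, v))) :
    FiberwiseLinear fun v => γ (0, v) := by
  have := t2Space_totalSpace (M := M) (V := V) (m := m)
  set f : M → M := fun x => (A ⟨x, 0⟩).1
  have hz : ∀ v : TotalSpace 𝔼[m] V, scale 0 v = ⟨v.1, 0⟩ := fun v =>
    congrArg (TotalSpace.mk v.1) (zero_smul ℝ v.2)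
  suffices h : ∀ x, ∃ L : V x →ₗ[ℝ] V (f x), ∀ u : V x, γ (0, ⟨x, u⟩) = ⟨f x, L u⟩ by
    choose L hL using h
    exact ⟨f, L, fun v => hL v.1 v.2⟩
  intro x
  set e := trivializationAt 𝔼[m] V (f x)
  set e' := trivializationAt 𝔼[m] V x
  have hb : f x ∈ e.baseSet := FiberBundle.mem_baseSet_trivializationAt' _
  have hb' : x ∈ e'.baseSet := FiberBundle.mem_baseSet_trivializationAt' _
  -- `A` on the fibre over `x`, read in trivializations. The required linear map is its derivative
  -- at `0`; the motion of the base point does not enter.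
  set P : 𝔼[m] → 𝔼[m] := fun y => (e (A (e'.toOpenPartialHomeomorph.symm (x, y)))).2
  have hsymm : ∀ (r : ℝ) (u : V x),
      e'.toOpenPartialHomeomorph.symm (x, r • (e' ⟨x, u⟩).2) = scale r ⟨x, u⟩ := fun r u =>
    trivialization_symm_scale e' r (v := ⟨x, u⟩) hb'
  have hx0 : e'.toOpenPartialHomeomorph.symm (x, 0) = ⟨x, 0⟩ := by
    have := hsymm 0 0
    rwa [zero_smul, hz] at this
  have hP : DifferentiableAt ℝ P 0 := by
    have h1 : ContMDiffAt 𝓘(ℝ, 𝔼[m]) 𝓑[d, m] ∞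
        (fun y => e'.toOpenPartialHomeomorph.symm (x, y)) 0 :=
      ((e'.contMDiffOn_symm (n := ∞) (IB := 𝓡 d)).contMDiffAt
        (e'.open_target.mem_nhds (e'.mem_target.2 hb'))).comp (f := fun y : 𝔼[m] => (x, y)) 0
        (contMDiffAt_const.prodMk contMDiffAt_id)
    have h2 : ContMDiffAt 𝓑[d, m] 𝓑[d, m] ∞ e (A (e'.toOpenPartialHomeomorph.symm (x, 0))) := by
      rw [hx0]
      exact (e.contMDiffOn (n := ∞) (IB := 𝓡 d)).contMDiffAt
        (e.open_source.mem_nhds (e.mem_source.2 hb))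
    have h3 : ContMDiffAt 𝓘(ℝ, 𝔼[m]) ((𝓡 d).prod 𝓘(ℝ, 𝔼[m])) ∞
        (fun y => e (A (e'.toOpenPartialHomeomorph.symm (x, y)))) 0 :=
      h2.comp (0 : 𝔼[m]) ((hA _).comp (0 : 𝔼[m]) h1)
    exact (contMDiffAt_iff_contDiffAt.1 h3.snd).differentiableAt (by simp)
  refine ⟨(e.continuousLinearEquivAt ℝ (f x) hb).symm.toLinearMap ∘ₗ (fderiv ℝ P 0).toLinearMap ∘ₗ
    (e'.continuousLinearEquivAt ℝ x hb').toLinearMap, fun u => ?_⟩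
  have hcurve : ContMDiffAt 𝓘(ℝ, ℝ) 𝓑[d, m] ∞ (fun r => A (scale r ⟨x, u⟩)) 0 :=
    (hA _).comp (0 : ℝ) (contMDiffAt_scale contMDiffAt_id contMDiffAt_const)
  have hA0 : A (scale 0 ⟨x, u⟩) = A ⟨x, 0⟩ := by rw [hz]
  have hlim := tendsto_scale_inv (Γ := fun r => A (scale r ⟨x, u⟩)) hcurve
    (h0 _ (zero_smul ℝ u)) e (show (A (scale 0 ⟨x, u⟩)).1 ∈ e.baseSet by rw [hA0]; exact hb)
  have hlim' : Tendsto (fun r => scale r⁻¹ (A (scale r ⟨x, u⟩))) (𝓝[≠] 0) (𝓝 (γ (0, ⟨x, u⟩))) := by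
    have h1 : Tendsto (fun r : ℝ => γ (r, ⟨x, u⟩)) (𝓝[≠] 0) (𝓝 (γ (0, ⟨x, u⟩))) :=
      ((hγ.comp (Continuous.prodMk_left _)).tendsto (0 : ℝ)).mono_left nhdsWithin_le_nhds
    refine h1.congr' ?_
    filter_upwards [self_mem_nhdsWithin] with r hr
    rw [hAγ, scale_scale, inv_mul_cancel₀ hr, scale_one]
  have hderiv : HasDerivAt (fun r : ℝ => (e (A (scale r ⟨x, u⟩))).2)
      (fderiv ℝ P 0 (e' ⟨x, u⟩).2) 0 := by
    have h1 : HasDerivAt (fun r : ℝ => r • (e' ⟨x, u⟩).2) (e' ⟨x, u⟩).2 0 := by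
      simpa using (hasDerivAt_id (0 : ℝ)).smul_const (e' ⟨x, u⟩).2
    have h2 : HasFDerivAt P (fderiv ℝ P 0) ((0 : ℝ) • (e' ⟨x, u⟩).2) := by
      rw [zero_smul]
      exact hP.hasFDerivAt
    refine (h2.comp_hasDerivAt (0 : ℝ) h1).congr_of_eventuallyEq (.of_forall fun r => ?_)
    simp only [Function.comp_apply, P]
    rw [hsymm]
  -- The limit of r⁻¹ A(r v) is γ(0, v) by continuity and the directional derivative of `P` by the
  -- trivialization.
  have key := tendsto_nhds_unique hlim' hlim
  rw [key, hderiv.deriv]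
  simp only [hA0]
  exact e.symm_apply_eq_mk_continuousLinearEquivAt_symm (R := ℝ) (f x) hb _

end Linearization

/-! ### From norm respecting diffeomorphisms to isometries -/

section LinearizationIsotopy

open Filter

variable {d m : ℕ} {M : Type*} [TopologicalSpace M] [ChartedSpace 𝔼[d] M] [IsManifold (𝓡 d) ∞ M]
  {V : M → Type*} [∀ x, NormedAddCommGroup (V x)] [∀ x, InnerProductSpace ℝ (V x)]
  [TopologicalSpace (TotalSpace 𝔼[m] V)] [FiberBundle 𝔼[m] V] [VectorBundle ℝ 𝔼[m] V]
  [ContMDiffVectorBundle ∞ 𝔼[m] V (𝓡 d)] [IsContMDiffRiemannianBundle (𝓡 d) ∞ 𝔼[m] V]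

theorem contMDiff_scale_const (c : ℝ) :
    ContMDiff 𝓑[d, m] 𝓑[d, m] ∞ (scale c : TotalSpace 𝔼[m] V → TotalSpace 𝔼[m] V) := fun _ =>
  contMDiffAt_scale contMDiffAt_const contMDiffAt_id

theorem exists_blowUp [T2Space M] {A : TotalSpace 𝔼[m] V → TotalSpace 𝔼[m] V}
    (hA : ContMDiff 𝓑[d, m] 𝓑[d, m] ∞ A) (h0 : ∀ v, v.2 = 0 → (A v).2 = 0) :
    ∃ γ : ℝ × TotalSpace 𝔼[m] V → TotalSpace 𝔼[m] V,
      ContMDiff (𝓘(ℝ, ℝ).prod 𝓑[d, m]) 𝓑[d, m] ∞ γ ∧ ∀ r v, A (scale r v) = scale r (γ (r, v)) := by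
  have h1 : ContMDiff (𝓘(ℝ, ℝ).prod 𝓑[d, m]) 𝓑[d, m] ∞
      (fun p : ℝ × TotalSpace 𝔼[m] V => A (scale p.1 p.2)) :=
    hA.comp fun p => contMDiffAt_scale contMDiffAt_fst contMDiffAt_snd
  exact exists_eq_scale_contMDiff h1 fun v => h0 _ (zero_smul ℝ v.2)

/-- For `r ≠ 0` the maps γ(r, ·) and δ(r, ·) are conjugates of `A` and `B` by scaling. The case `r =
0` follows by density and continuity. -/
theorem blowUp_blowUp [T2Space M] {A B : TotalSpace 𝔼[m] V → TotalSpace 𝔼[m] V}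
    (hBA : ∀ v, B (A v) = v) {γ δ : ℝ × TotalSpace 𝔼[m] V → TotalSpace 𝔼[m] V} (hγ : Continuous γ)
    (hδ : Continuous δ) (hAγ : ∀ r v, A (scale r v) = scale r (γ (r, v)))
    (hBδ : ∀ r v, B (scale r v) = scale r (δ (r, v))) (r : ℝ) (v : TotalSpace 𝔼[m] V) :
    δ (r, γ (r, v)) = v := by
  have := t2Space_totalSpace (M := M) (V := V) (m := m)
  have h1 : ∀ r ∈ ({0}ᶜ : Set ℝ), δ (r, γ (r, v)) = v := fun r hr => by
    have h2 : scale r (δ (r, γ (r, v))) = scale r v := by rw [← hBδ, ← hAγ, hBA]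
    have h3 := congrArg (scale r⁻¹) h2
    rwa [scale_scale, scale_scale, inv_mul_cancel₀ hr, scale_one, scale_one] at h3
  have h4 : Continuous fun r => δ (r, γ (r, v)) :=
    hδ.comp (continuous_id.prodMk (hγ.comp (Continuous.prodMk_left v)))
  exact congrFun (h4.ext_on (dense_compl_singleton 0) continuous_const h1) r

theorem norm_blowUp_eq {A : TotalSpace 𝔼[m] V → TotalSpace 𝔼[m] V} (hA : RespectsNorm A)
    {γ : ℝ × TotalSpace 𝔼[m] V → TotalSpace 𝔼[m] V}
    (hγ : ContMDiff (𝓘(ℝ, ℝ).prod 𝓑[d, m]) 𝓑[d, m] ∞ γ)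
    (hAγ : ∀ r v, A (scale r v) = scale r (γ (r, v))) (r : ℝ) {v w : TotalSpace 𝔼[m] V}
    (h : ‖v.2‖ = ‖w.2‖) : ‖(γ (r, v)).2‖ = ‖(γ (r, w)).2‖ := by
  have hc : ∀ u, Continuous fun r => ‖(γ (r, u)).2‖ := fun u =>
    (continuous_norm_bundle (m := m) (V := V) d).comp (hγ.continuous.comp (Continuous.prodMk_left u))
  refine congrFun ((hc v).ext_on (dense_compl_singleton 0) (hc w) fun r hr => ?_) r
  have h1 : ‖(A (scale r v)).2‖ = ‖(A (scale r w)).2‖ :=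
    hA.norm_eq_iff.2 (by rw [norm_scale, norm_scale, h])
  rw [hAγ, hAγ, norm_scale, norm_scale] at h1
  exact mul_left_cancel₀ (abs_ne_zero.2 hr) h1

theorem direction_symm_scale_direction {A : TotalSpace 𝔼[m] V ≃ TotalSpace 𝔼[m] V} {r a : ℝ}
    (hr : 0 < r) (ha : 0 < a) (hAr : ∀ s ∈ sphereBundle m V, ‖(A (scale r s)).2‖ = a)
    {s : TotalSpace 𝔼[m] V} (hs : s ∈ sphereBundle m V) :
    direction (A.symm (scale a (direction (A (scale r s))))) = s := by
  have h1 : (A (scale r s)).2 ≠ 0 := norm_pos_iff.1 (by rwa [hAr s hs])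
  have h2 := scale_direction h1
  rw [hAr s hs] at h2
  rw [h2, A.symm_apply_apply, direction_scale hr, direction_of_mem hs]

theorem smoothBetween_direction_scale {A : TotalSpace 𝔼[m] V → TotalSpace 𝔼[m] V}
    (hA : ContMDiff 𝓑[d, m] 𝓑[d, m] ∞ A) {r : ℝ}
    (h : ∀ s ∈ sphereBundle m V, (A (scale r s)).2 ≠ 0) :
    SmoothBetween 𝓑[d, m] 𝓑[d, m] (sphereBundle m V) (sphereBundle m V)
      fun s => ⟨direction (A (scale r s)), direction_mem (h s s.2)⟩ :=
  ⟨fun s => direction (A (scale r s)), (contMDiffOn_direction d).comp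
    (hA.comp (contMDiff_scale_const r)).contMDiffOn h, fun _ => rfl⟩

/-- The maps `s ↦ A (r • s) / |A (r • s)|` are diffeomorphisms of the unit sphere bundle. -/
theorem exists_sphereDiffeo_direction
    (A : TotalSpace 𝔼[m] V ≃ₘ^∞⟮𝓑[d, m], 𝓑[d, m]⟯ TotalSpace 𝔼[m] V)
    (hA : RespectsNorm A) {r : ℝ} (hr : 0 < r) :
    ∃ f : SphereDiffeo d m V, ∀ s, (f s : TotalSpace 𝔼[m] V) = direction (A (scale r s)) := by
  -- `A` maps the sphere bundle of radius `r` onto that of some radius `a`, so the inverse is the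
  -- direction of `A.symm (a • s)`. If there are no unit vectors, any `a` will do.
  obtain ⟨a, ha, hAr, hBa⟩ : ∃ a > 0, (∀ s ∈ sphereBundle m V, ‖(A (scale r s)).2‖ = a) ∧
      ∀ s ∈ sphereBundle m V, ‖(A.symm (scale a s)).2‖ = r := by
    rcases (sphereBundle m V).eq_empty_or_nonempty with h | ⟨s₀, hs₀⟩
    · exact ⟨1, one_pos, by simp [h], by simp [h]⟩
    · have ha : 0 < ‖(A (scale r s₀)).2‖ := norm_pos_iff.2 fun h =>
        (norm_pos_iff.1 (by rwa [norm_scale_sphere hs₀ hr.le])) (hA.eq_zero_iff.1 h)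
      refine ⟨_, ha, fun s hs => hA.norm_eq_iff.2 ?_, fun s hs => ?_⟩
      · rw [norm_scale_sphere hs hr.le, norm_scale_sphere hs₀ hr.le]
      · have h1 : ‖(A.toEquiv.symm (scale ‖(A (scale r s₀)).2‖ s)).2‖ =
            ‖(A.toEquiv.symm (A.toEquiv (scale r s₀))).2‖ :=
          hA.symm (A := A.toEquiv) |>.norm_eq_iff.2 (norm_scale_sphere hs ha.le)
        rw [A.toEquiv.symm_apply_apply, norm_scale_sphere hs₀ hr.le] at h1
        exact h1
  have h1 : ∀ s ∈ sphereBundle m V, (A (scale r s)).2 ≠ 0 := fun s hs =>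
    norm_pos_iff.1 (by rwa [hAr s hs])
  have h2 : ∀ s ∈ sphereBundle m V, (A.symm (scale a s)).2 ≠ 0 := fun s hs =>
    norm_pos_iff.1 (by rwa [hBa s hs])
  exact ⟨⟨⟨fun s => ⟨direction (A (scale r s)), direction_mem (h1 s s.2)⟩,
    fun s => ⟨direction (A.symm (scale a s)), direction_mem (h2 s s.2)⟩,
    fun s => Subtype.ext (direction_symm_scale_direction (A := A.toEquiv) hr ha hAr s.2),
    fun s => Subtype.ext (direction_symm_scale_direction (A := A.toEquiv.symm) ha hr hBa s.2)⟩,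
    smoothBetween_direction_scale A.contMDiff h1, smoothBetween_direction_scale A.symm.contMDiff h2⟩,
    fun _ => rfl⟩

/-- The norm of γ(0, v) depends only on that of `v`, over the entire base, and is homogeneous by
linearity. One unit vector therefore determines the factor. -/
theorem exists_norm_blowUp_eq_mul [Nonempty (sphereBundle m V)]
    {A : TotalSpace 𝔼[m] V → TotalSpace 𝔼[m] V} (hA : RespectsNorm A)
    {γ : ℝ × TotalSpace 𝔼[m] V → TotalSpace 𝔼[m] V}
    (hγ : ContMDiff (𝓘(ℝ, ℝ).prod 𝓑[d, m]) 𝓑[d, m] ∞ γ)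
    (hAγ : ∀ r v, A (scale r v) = scale r (γ (r, v))) (hlin : FiberwiseLinear fun v => γ (0, v)) :
    ∃ c : ℝ, 0 ≤ c ∧ ∀ v, ‖(γ (0, v)).2‖ = c * ‖v.2‖ := by
  obtain ⟨s₀⟩ := ‹Nonempty (sphereBundle m V)›
  refine ⟨‖(γ (0, s₀)).2‖, norm_nonneg _, fun v => ?_⟩
  have h1 : ‖v.2‖ = ‖(scale ‖v.2‖ s₀.1).2‖ := (norm_scale_sphere s₀.2 (norm_nonneg _)).symm
  rw [norm_blowUp_eq hA hγ hAγ 0 h1, hlin.map_scale, norm_scale, abs_of_nonneg (norm_nonneg _),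
    mul_comm]

/-- The linearization of a norm respecting diffeomorphism along the zero section is, up to a
constant factor, an isomorphism of Euclidean vector bundles. -/
theorem exists_isometry_of_blowUp [T2Space M] [Nonempty (sphereBundle m V)]
    (A : TotalSpace 𝔼[m] V ≃ₘ^∞⟮𝓑[d, m], 𝓑[d, m]⟯ TotalSpace 𝔼[m] V) (hA : RespectsNorm A)
    {γ : ℝ × TotalSpace 𝔼[m] V → TotalSpace 𝔼[m] V}
    (hγ : ContMDiff (𝓘(ℝ, ℝ).prod 𝓑[d, m]) 𝓑[d, m] ∞ γ)
    (hAγ : ∀ r v, A (scale r v) = scale r (γ (r, v))) :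
    ∃ (c : ℝ) (ℓ : SphereDiffeo d m V), 0 < c ∧ ℓ ∈ sphereBundleIsometries d m V ∧
      ℓ.symm ∈ sphereBundleIsometries d m V ∧ ∀ s : sphereBundle m V, γ (0, s) = scale c (ℓ s) := by
  have hB : RespectsNorm A.symm := hA.symm (A := A.toEquiv)
  obtain ⟨δ, hδ, hBδ⟩ := exists_blowUp A.symm.contMDiff fun v h => hB.eq_zero h
  have hγl : FiberwiseLinear fun v => γ (0, v) :=
    fiberwiseLinear_of_eq_scale A.contMDiff (fun v h => hA.eq_zero h) hγ.continuous hAγ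
  have hδl : FiberwiseLinear fun v => δ (0, v) :=
    fiberwiseLinear_of_eq_scale A.symm.contMDiff (fun v h => hB.eq_zero h) hδ.continuous hBδ
  have hδγ : ∀ v, δ (0, γ (0, v)) = v :=
    blowUp_blowUp A.symm_apply_apply hγ.continuous hδ.continuous hAγ hBδ 0
  have hγδ : ∀ v, γ (0, δ (0, v)) = v :=
    blowUp_blowUp A.apply_symm_apply hδ.continuous hγ.continuous hBδ hAγ 0
  obtain ⟨c, hc, hcn⟩ := exists_norm_blowUp_eq_mul hA hγ hAγ hγl
  obtain ⟨c', hc', hcn'⟩ := exists_norm_blowUp_eq_mul hB hδ hBδ hδl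
  -- The linearizations of `A` and its inverse are inverse to each other, hence so are their
  -- factors.
  have hcc : c' * c = 1 := by
    obtain ⟨s₀⟩ := ‹Nonempty (sphereBundle m V)›
    have h1 := hcn' (γ (0, s₀))
    rw [hδγ, hcn, show ‖s₀.1.2‖ = 1 from s₀.2, mul_one] at h1
    exact h1.symm
  have hc0 : c ≠ 0 := right_ne_zero_of_mul_eq_one hcc
  have hsm : ∀ {η : ℝ × TotalSpace 𝔼[m] V → TotalSpace 𝔼[m] V},
      ContMDiff (𝓘(ℝ, ℝ).prod 𝓑[d, m]) 𝓑[d, m] ∞ η → ∀ a : ℝ,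
      ContMDiff 𝓑[d, m] 𝓑[d, m] ∞ fun v => scale a (η (0, v)) := fun {η} hη a =>
    (contMDiff_scale_const a).comp (hη.comp (f := fun v : TotalSpace 𝔼[m] V => ((0 : ℝ), v))
      (contMDiff_const.prodMk contMDiff_id))
  set T : TotalSpace 𝔼[m] V ≃ₘ^∞⟮𝓑[d, m], 𝓑[d, m]⟯ TotalSpace 𝔼[m] V :=
    { toFun := fun v => scale c⁻¹ (γ (0, v))
      invFun := fun v => scale c (δ (0, v))
      left_inv := fun v => by
        change scale c (δ (0, scale c⁻¹ (γ (0, v)))) = v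
        rw [hδl.map_scale, hδγ, scale_scale, mul_inv_cancel₀ hc0, scale_one]
      right_inv := fun v => by
        change scale c⁻¹ (γ (0, scale c (δ (0, v)))) = v
        rw [hγl.map_scale, hγδ, scale_scale, inv_mul_cancel₀ hc0, scale_one]
      contMDiff_toFun := hsm hγ _
      contMDiff_invFun := hsm hδ _ }
  have hTn : ∀ v, ‖(T v).2‖ = ‖v.2‖ := fun v => by
    change ‖(scale c⁻¹ (γ (0, v))).2‖ = _
    rw [norm_scale, hcn, abs_of_nonneg (inv_nonneg.2 hc), inv_mul_cancel_left₀ hc0]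
  have hTn' : ∀ v, ‖(T.symm v).2‖ = ‖v.2‖ := fun v => by
    rw [← hTn, T.apply_symm_apply]
  refine ⟨c, sphereRestriction T hTn, lt_of_le_of_ne hc hc0.symm,
    sphereRestriction_mem hTn (hγl.scale_comp _), ?_, fun s => ?_⟩
  · exact sphereRestriction_mem hTn' (hδl.scale_comp c)
  · change _ = scale c (scale c⁻¹ (γ (0, s)))
    rw [scale_scale, mul_inv_cancel₀ hc0, scale_one]

/-- The diffeomorphism of the unit sphere bundle induced by a norm respecting diffeomorphism is
isotopic to an isomorphism of Euclidean vector bundles. -/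
theorem exists_isotopicIn_isometry [T2Space M] [Nonempty (sphereBundle m V)]
    (A : TotalSpace 𝔼[m] V ≃ₘ^∞⟮𝓑[d, m], 𝓑[d, m]⟯ TotalSpace 𝔼[m] V) (hA : RespectsNorm A) :
    ∃ (ℓ : sphereBundleIsometries d m V) (f : extendableDiffeos d m V),
      ℓ.1.symm ∈ sphereBundleIsometries d m V ∧
      (∀ s, (f.1 s : TotalSpace 𝔼[m] V) = direction (A s)) ∧
      IsotopicIn (extendableDiffeos d m V)
        (inclusion (sphereBundleIsometries_subset d m V) ℓ) f := by
  classical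
  obtain ⟨γ, hγ, hAγ⟩ := exists_blowUp A.contMDiff fun v h => hA.eq_zero h
  obtain ⟨c, ℓ, hc, hℓ, hℓ', hγℓ⟩ := exists_isometry_of_blowUp A hA hγ hAγ
  choose f hf using fun (r : ℝ) (hr : 0 < r) => exists_sphereDiffeo_direction A hA hr
  -- For `r > 0` this is the direction of A(r s) = r γ(r, s), that is, of γ(r, s). The latter
  -- expression is smooth up to `r = 0`, where it gives `ℓ`.
  set K : ℝ → SphereDiffeo d m V := fun r => if hr : 0 < r then f r hr else ℓ
  set k : ℝ × TotalSpace 𝔼[m] V → TotalSpace 𝔼[m] V := fun p => direction (γ p)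
  have hK0 : K 0 = ℓ := dif_neg (lt_irrefl _)
  have hK1 : K 1 = f 1 one_pos := dif_pos one_pos
  have hγ0 : ∀ r, 0 ≤ r → ∀ s ∈ sphereBundle m V, (γ (r, s)).2 ≠ 0 := fun r hr s hs => by
    rcases hr.eq_or_lt with rfl | hr
    · rw [hγℓ ⟨s, hs⟩, ← norm_pos_iff, norm_scale_sphere (ℓ ⟨s, hs⟩).2 hc.le]
      exact hc
    · intro h
      have h1 : (A (scale r s)).2 = 0 := by
        rw [← norm_eq_zero, hAγ, norm_scale, h, norm_zero, mul_zero]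
      have h2 := norm_scale_sphere hs hr.le
      rw [hA.eq_zero_iff.1 h1, norm_zero] at h2
      exact hr.ne h2
  have hk : ContMDiffOn (𝓘(ℝ, ℝ).prod 𝓑[d, m]) 𝓑[d, m] ∞ k (Icc (0 : ℝ) 1 ×ˢ sphereBundle m V) :=
    (contMDiffOn_direction d).comp hγ.contMDiffOn fun p hp => hγ0 p.1 hp.1.1 p.2 hp.2
  have hkK : ∀ t ∈ Icc (0 : ℝ) 1, ∀ s : sphereBundle m V, k (t, s) = K t s := fun t ht s => by
    rcases ht.1.eq_or_lt with rfl | h0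
    · rw [hK0]
      change direction (γ (0, s)) = _
      rw [hγℓ, direction_scale hc, direction_of_mem (ℓ s).2]
    · rw [show K t = f t h0 from dif_pos h0, hf, hAγ, direction_scale h0]
  have hKmem : ∀ t ∈ Icc (0 : ℝ) 1, K t ∈ extendableDiffeos d m V := fun t ht => by
    -- Running the isotopy only up to time `t` joins the extendable `ℓ` to `K t`, so `K t` is
    -- extendable.
    have hmaps : ∀ u ∈ Icc (0 : ℝ) 1, u * t ∈ Icc (0 : ℝ) 1 := fun u hu =>
      ⟨mul_nonneg hu.1 ht.1, mul_le_one₀ hu.2 ht.1 ht.2⟩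
    have h1 : ContMDiff (𝓘(ℝ, ℝ).prod 𝓑[d, m]) (𝓘(ℝ, ℝ).prod 𝓑[d, m]) ∞
        fun p : ℝ × TotalSpace 𝔼[m] V => (p.1 * t, p.2) :=
      (contMDiff_fst.mul contMDiff_const).prodMk contMDiff_snd
    have h2 := mem_extendableDiffeos_of_isotopy (K := fun u => K (u * t))
      (k := fun p => k (p.1 * t, p.2))
      (hk.comp h1.contMDiffOn fun p hp => ⟨hmaps p.1 hp.1, hp.2⟩)
      (fun u hu s => hkK _ (hmaps u hu) s) (by
        simp only [zero_mul, hK0]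
        exact sphereBundleIsometries_subset d m V hℓ)
    simpa only [one_mul] using h2
  refine ⟨⟨ℓ, hℓ⟩, ⟨f 1 one_pos, hK1 ▸ hKmem 1 ⟨zero_le_one, le_rfl⟩⟩, hℓ', fun s => ?_,
    K, hKmem, hK0, hK1, k, hk, hkK⟩
  rw [hf, scale_one]

end LinearizationIsotopy

/-! ### Composition of path components -/

section PathComponents

variable {d m : ℕ} {M : Type*} [TopologicalSpace M] [ChartedSpace 𝔼[d] M] [IsManifold (𝓡 d) ∞ M]
  {V : M → Type*} [∀ x, NormedAddCommGroup (V x)] [∀ x, InnerProductSpace ℝ (V x)]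
  [TopologicalSpace (TotalSpace 𝔼[m] V)] [FiberBundle 𝔼[m] V] [VectorBundle ℝ 𝔼[m] V]
  [ContMDiffVectorBundle ∞ 𝔼[m] V (𝓡 d)] [IsContMDiffRiemannianBundle (𝓡 d) ∞ 𝔼[m] V]

/-- The composition of diffeomorphisms of `∂E` that extend to `E`. -/
def extendableComp (f g : extendableDiffeos d m V) : extendableDiffeos d m V :=
  ⟨f.1.comp g.1, comp_mem_extendableDiffeos f.2 g.2⟩

theorem IsotopicIn.comp_left {f g : extendableDiffeos d m V}
    (h : IsotopicIn (extendableDiffeos d m V) f g) (a : extendableDiffeos d m V) :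
    IsotopicIn (extendableDiffeos d m V) (extendableComp a f) (extendableComp a g) := by
  obtain ⟨K, hK, h0, h1, k, hk, hkK⟩ := h
  obtain ⟨G, hG, hGa⟩ := a.1.smooth_toFun
  refine ⟨fun t => a.1.comp (K t), fun t ht => comp_mem_extendableDiffeos a.2 (hK t ht),
    by simp only [h0]; rfl, by simp only [h1]; rfl, fun p => G (k p),
    hG.comp hk fun p hp => ?_, fun t ht s => ?_⟩
  · have h2 := hkK p.1 hp.1 ⟨p.2, hp.2⟩
    change k p = _ at h2
    rw [mem_preimage, h2]
    exact (K p.1 _).2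
  · simp only [hkK t ht s]
    exact hGa _

theorem IsotopicIn.comp_right {f g : extendableDiffeos d m V}
    (h : IsotopicIn (extendableDiffeos d m V) f g) (a : extendableDiffeos d m V) :
    IsotopicIn (extendableDiffeos d m V) (extendableComp f a) (extendableComp g a) := by
  obtain ⟨K, hK, h0, h1, k, hk, hkK⟩ := h
  obtain ⟨G, hG, hGa⟩ := a.1.smooth_toFun
  have hG' : ∀ s : sphereBundle m V, G s = a.1 s := hGa
  refine ⟨fun t => (K t).comp a.1, fun t ht => comp_mem_extendableDiffeos (hK t ht) a.2,
    by simp only [h0]; rfl, by simp only [h1]; rfl, fun p => k (p.1, G p.2),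
    hk.comp (contMDiffOn_fst.prodMk (hG.comp contMDiffOn_snd fun p hp => hp.2)) fun p hp => ?_,
    fun t ht s => ?_⟩
  · refine ⟨hp.1, ?_⟩
    change G p.2 ∈ _
    rw [show G p.2 = _ from hG' ⟨p.2, hp.2⟩]
    exact (a.1 _).2
  · simp only [hG' s]
    exact hkK t ht (a.1 s)

theorem PiZero.mk_comp_left {f g : extendableDiffeos d m V} (h : PiZero.mk f = PiZero.mk g)
    (a : extendableDiffeos d m V) :
    PiZero.mk (extendableComp a f) = PiZero.mk (extendableComp a g) :=
  congrArg (Quot.map (extendableComp a) fun _ _ h => h.comp_left a) h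

theorem PiZero.mk_comp_right {f g : extendableDiffeos d m V} (h : PiZero.mk f = PiZero.mk g)
    (a : extendableDiffeos d m V) :
    PiZero.mk (extendableComp f a) = PiZero.mk (extendableComp g a) :=
  congrArg (Quot.map (fun f => extendableComp f a) fun _ _ h => h.comp_right a) h

/-- The inclusion `Isom_b(∂E) → Diff_E(∂E)`. -/
abbrev isometryInclusion : sphereBundleIsometries d m V → extendableDiffeos d m V :=
  inclusion (sphereBundleIsometries_subset d m V)

/-- The class of `f` in `π₀(Diff_E(∂E))` is that of an invertible element of `Isom_b(∂E)`. -/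
def IsotopicToIsometry (f : extendableDiffeos d m V) : Prop :=
  ∃ ℓ : sphereBundleIsometries d m V, ℓ.1.symm ∈ sphereBundleIsometries d m V ∧
    PiZero.mk (isometryInclusion ℓ) = PiZero.mk f

theorem IsotopicToIsometry.comp {f g : extendableDiffeos d m V} (hf : IsotopicToIsometry f)
    (hg : IsotopicToIsometry g) : IsotopicToIsometry (extendableComp f g) := by
  obtain ⟨a, ha, haf⟩ := hf
  obtain ⟨b, hb, hbg⟩ := hg
  exact ⟨⟨a.1.comp b.1, comp_mem_sphereBundleIsometries a.2 b.2⟩,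
    comp_mem_sphereBundleIsometries hb ha,
    (PiZero.mk_comp_right haf (isometryInclusion b)).trans (PiZero.mk_comp_left hbg f)⟩

/-- With isometries `a`, `b` isotopic to `f`, `h`, the relation x ∘ f = h gives [x ∘ a] = [b], hence
[x] = [b ∘ a⁻¹]. -/
theorem IsotopicToIsometry.mk_mem_range {x f h : extendableDiffeos d m V}
    (hf : IsotopicToIsometry f) (hh : IsotopicToIsometry h) (hx : ∀ s, x.1 (f.1 s) = h.1 s) :
    PiZero.mk x ∈ range (piZeroInclusion d m V) := by
  obtain ⟨a, ha, haf⟩ := hf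
  obtain ⟨b, -, hbh⟩ := hh
  set a' : sphereBundleIsometries d m V := ⟨a.1.symm, ha⟩
  refine ⟨PiZero.mk ⟨b.1.comp a.1.symm, comp_mem_sphereBundleIsometries b.2 ha⟩, ?_⟩
  have h1 : extendableComp x f = h := Subtype.ext (SetDiffeo.ext_apply hx)
  have h2 : PiZero.mk (isometryInclusion b) = PiZero.mk (extendableComp x (isometryInclusion a)) := by
    rw [hbh, ← h1]
    exact (PiZero.mk_comp_left haf x).symm
  refine (PiZero.mk_comp_right h2 (isometryInclusion a')).trans (congrArg PiZero.mk ?_)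
  exact Subtype.ext (SetDiffeo.ext_apply fun s =>
    congrArg x.1.toEquiv (a.1.toEquiv.apply_symm_apply s))

theorem exists_isotopicToIsometry [T2Space M] [Nonempty (sphereBundle m V)]
    (A : TotalSpace 𝔼[m] V ≃ₘ^∞⟮𝓑[d, m], 𝓑[d, m]⟯ TotalSpace 𝔼[m] V) (hA : RespectsNorm A) :
    ∃ f : extendableDiffeos d m V, IsotopicToIsometry f ∧
      ∀ s, (f.1 s : TotalSpace 𝔼[m] V) = direction (A s) := by
  obtain ⟨ℓ, f, hℓ, hf, h⟩ := exists_isotopicIn_isometry A hA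
  exact ⟨f, ⟨ℓ, hℓ, Quot.sound h⟩, hf⟩

/-- The point is that the inverse must be an isometry too. Linearizing the norm preserving extension
of `i` yields an isometry for which this is known. -/
theorem isotopicToIsometry_of_mk_mem_range [T2Space M] [Nonempty (sphereBundle m V)]
    {f : extendableDiffeos d m V} (hf : PiZero.mk f ∈ range (piZeroInclusion d m V)) :
    IsotopicToIsometry f := by
  obtain ⟨q, hq⟩ := hf
  induction q using Quot.ind with | mk i =>
  obtain ⟨W, hn, hW⟩ := exists_diffeomorph_of_isometry i.2
  have hWn : RespectsNorm W := ⟨by simp only [hn, implies_true], fun {v} h => by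
    rw [← norm_eq_zero, hn, h, norm_zero]⟩
  obtain ⟨g, ⟨ℓ, hℓ, hℓg⟩, hg⟩ := exists_isotopicToIsometry W hWn
  have h1 : g = isometryInclusion i := Subtype.ext (SetDiffeo.ext_apply fun s => Subtype.ext (by
    have h2 := hW s 1 le_rfl
    rw [scale_one, scale_one] at h2
    rw [hg, show W s = _ from h2, direction_of_mem (i.1.toEquiv s).2]))
  exact ⟨ℓ, hℓ, hℓg.trans ((congrArg PiZero.mk h1).trans hq)⟩

theorem nonempty_sphereBundle [Nonempty M] (hm : 1 ≤ m) : Nonempty (sphereBundle m V) := by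
  obtain ⟨x⟩ := ‹Nonempty M›
  set e := (trivializationAt 𝔼[m] V x).continuousLinearEquivAt ℝ x
    (FiberBundle.mem_baseSet_trivializationAt' x)
  have : Nonempty (Fin m) := ⟨⟨0, hm⟩⟩
  obtain ⟨y, hy⟩ := exists_ne (0 : 𝔼[m])
  have h : (⟨x, e.symm y⟩ : TotalSpace 𝔼[m] V).2 ≠ 0 := fun h => hy (by
    simpa using congrArg e h)
  exact ⟨⟨_, direction_mem h⟩⟩

end PathComponents

/-! ### Structure of foliated diffeomorphisms -/

section FoliatedDiffeomorphisms

open Filter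

variable {d₁ m₁ d₂ m₂ n : ℕ} [Fact (d₁ + m₁ = n)] [Fact (d₂ + m₂ = n)]
  {M₁ : Type*} [TopologicalSpace M₁] [ChartedSpace 𝔼[d₁] M₁] [IsManifold (𝓡 d₁) ∞ M₁]
  {V₁ : M₁ → Type*} [∀ x, NormedAddCommGroup (V₁ x)] [∀ x, InnerProductSpace ℝ (V₁ x)]
  [TopologicalSpace (TotalSpace 𝔼[m₁] V₁)] [FiberBundle 𝔼[m₁] V₁] [VectorBundle ℝ 𝔼[m₁] V₁]
  [ContMDiffVectorBundle ∞ 𝔼[m₁] V₁ (𝓡 d₁)] [IsContMDiffRiemannianBundle (𝓡 d₁) ∞ 𝔼[m₁] V₁]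
  {M₂ : Type*} [TopologicalSpace M₂] [ChartedSpace 𝔼[d₂] M₂] [IsManifold (𝓡 d₂) ∞ M₂]
  {V₂ : M₂ → Type*} [∀ x, NormedAddCommGroup (V₂ x)] [∀ x, InnerProductSpace ℝ (V₂ x)]
  [TopologicalSpace (TotalSpace 𝔼[m₂] V₂)] [FiberBundle 𝔼[m₂] V₂] [VectorBundle ℝ 𝔼[m₂] V₂]
  [ContMDiffVectorBundle ∞ 𝔼[m₂] V₂ (𝓡 d₂)] [IsContMDiffRiemannianBundle (𝓡 d₂) ∞ 𝔼[m₂] V₂]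
  {φ ψ : SetDiffeo 𝓑[d₁, m₁] 𝓑[d₂, m₂] (sphereBundle m₁ V₁) (sphereBundle m₂ V₂)}

/-- `F` maps level sets of the height `h` to level sets of the height `k`, and the ends of the
height interval `[-1, 1]` to themselves. -/
structure RespectsHeight {X Y : Type*} (h : X → ℝ) (k : Y → ℝ) (F : X → Y) : Prop where
  height_eq_iff : ∀ {g g'}, k (F g) = k (F g') ↔ h g = h g'
  eq_neg_one_iff : ∀ {g}, k (F g) = -1 ↔ h g = -1
  eq_one_iff : ∀ {g}, k (F g) = 1 ↔ h g = 1

/-- The range of `param₁` is the complement of the level of height `1`, a condition that `F`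
preserves in both directions. -/
theorem exists_lift_param₁ (F : Glued φ ≃ₘ^∞⟮𝓡 n, 𝓡 n⟯ Glued ψ)
    (hF : RespectsHeight (Glued.height φ) (Glued.height ψ) F) :
    ∃ A : TotalSpace 𝔼[m₁] V₁ ≃ₘ^∞⟮𝓑[d₁, m₁], 𝓑[d₁, m₁]⟯ TotalSpace 𝔼[m₁] V₁,
      RespectsNorm A ∧ ∀ v, F (Glued.param₁ φ v) = Glued.param₁ ψ (A v) := by
  have h1 : ∀ v, ∃ w, F (Glued.param₁ φ v) = Glued.param₁ ψ w := fun v => by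
    have h2 : F (Glued.param₁ φ v) ∈ range (Glued.param₁ ψ) := by
      have h3 : Glued.param₁ φ v ∈ range (Glued.param₁ φ) := mem_range_self v
      rw [Glued.range_param₁] at h3 ⊢
      exact fun h => h3 (hF.eq_one_iff.1 h)
    obtain ⟨w, hw⟩ := h2
    exact ⟨w, hw.symm⟩
  have h1' : ∀ w, ∃ v, F.symm (Glued.param₁ ψ w) = Glued.param₁ φ v := fun w => by
    have h2 : F.symm (Glued.param₁ ψ w) ∈ range (Glued.param₁ φ) := by
      have h3 : Glued.param₁ ψ w ∈ range (Glued.param₁ ψ) := mem_range_self w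
      rw [Glued.range_param₁] at h3 ⊢
      intro h
      refine h3 ?_
      have h4 := hF.eq_one_iff.2 h
      rwa [F.apply_symm_apply] at h4
    obtain ⟨v, hv⟩ := h2
    exact ⟨v, hv.symm⟩
  choose a ha using h1
  choose b hb using h1'
  refine ⟨
    { toFun := a
      invFun := b
      left_inv := fun v => Glued.injective_param₁ φ (by
        rw [← hb, ← ha, F.symm_apply_apply])
      right_inv := fun w => Glued.injective_param₁ ψ (by
        rw [← ha, ← hb, F.apply_symm_apply])
      contMDiff_toFun := fun v => Glued.contMDiffAt_of_param₁_comp (n := n) (φ := ψ)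
        (((F.contMDiff _).comp v (Glued.contMDiff_param₁ φ v)).congr_of_eventuallyEq
          (.of_forall fun u => (ha u).symm))
      contMDiff_invFun := fun v => Glued.contMDiffAt_of_param₁_comp (n := n) (φ := φ)
        (((F.symm.contMDiff _).comp v (Glued.contMDiff_param₁ ψ v)).congr_of_eventuallyEq
          (.of_forall fun u => (hb u).symm)) },
    ⟨fun {v w} => ?_, fun {v} hv => ?_⟩, ha⟩
  · change ‖(a v).2‖ = ‖(a w).2‖ ↔ _
    rw [← Glued.height_param₁_eq_iff ψ (ψ := ψ), ← ha, ← ha, hF.height_eq_iff,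
      Glued.height_param₁_eq_iff]
  · change (a v).2 = 0
    rwa [← Glued.height_param₁_eq_neg_one ψ, ← ha, hF.eq_neg_one_iff,
      Glued.height_param₁_eq_neg_one]

theorem exists_lift_param₂ (F : Glued φ ≃ₘ^∞⟮𝓡 n, 𝓡 n⟯ Glued ψ)
    (hF : RespectsHeight (Glued.height φ) (Glued.height ψ) F) :
    ∃ B : TotalSpace 𝔼[m₂] V₂ ≃ₘ^∞⟮𝓑[d₂, m₂], 𝓑[d₂, m₂]⟯ TotalSpace 𝔼[m₂] V₂,
      RespectsNorm B ∧ ∀ v, F (Glued.param₂ φ v) = Glued.param₂ ψ (B v) := by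
  set F' : Glued φ.symm ≃ₘ^∞⟮𝓡 n, 𝓡 n⟯ Glued ψ.symm :=
    ((Glued.swapDiffeomorph n φ).trans F).trans (Glued.swapDiffeomorph n ψ).symm
  have h1 : ∀ g, Glued.swapDiffeomorph n ψ (F' g) = F (Glued.swapDiffeomorph n φ g) := fun g =>
    (Glued.swapDiffeomorph n ψ).apply_symm_apply _
  have h2 : ∀ g, Glued.height ψ.symm (F' g) =
      -Glued.height ψ (F (Glued.swapDiffeomorph n φ g)) := fun g => by
    rw [← h1, Glued.height_swapDiffeomorph, neg_neg]
  have h3 : ∀ g, Glued.height φ.symm g = -Glued.height φ (Glued.swapDiffeomorph n φ g) := fun g => by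
    rw [Glued.height_swapDiffeomorph, neg_neg]
  obtain ⟨B, hB, hFB⟩ := exists_lift_param₁ F'
    ⟨fun {g g'} => by rw [h2, h2, h3, h3, neg_inj, neg_inj, hF.height_eq_iff],
      fun {g} => by rw [h2, h3, neg_inj, neg_inj, hF.eq_one_iff],
      fun {g} => by rw [h2, h3, neg_eq_iff_eq_neg, neg_eq_iff_eq_neg, hF.eq_neg_one_iff]⟩
  refine ⟨B, hB, fun v => ?_⟩
  have h4 := h1 (Glued.param₁ φ.symm v)
  rw [hFB] at h4
  rw [Glued.swap_param₁, Glued.swap_param₁]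
  exact h4.symm

/-- A foliated diffeomorphism that does not exchange the zero sections induces diffeomorphisms of
the sphere bundles that conjugate the gluing maps. -/
theorem exists_conjugation (F : Glued φ ≃ₘ^∞⟮𝓡 n, 𝓡 n⟯ Glued ψ)
    (hF : RespectsHeight (Glued.height φ) (Glued.height ψ) F) :
    ∃ (A : TotalSpace 𝔼[m₁] V₁ ≃ₘ^∞⟮𝓑[d₁, m₁], 𝓑[d₁, m₁]⟯ TotalSpace 𝔼[m₁] V₁)
      (B : TotalSpace 𝔼[m₂] V₂ ≃ₘ^∞⟮𝓑[d₂, m₂], 𝓑[d₂, m₂]⟯ TotalSpace 𝔼[m₂] V₂),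
      RespectsNorm A ∧ RespectsNorm B ∧ ∀ s t : sphereBundle m₁ V₁,
        (t : TotalSpace 𝔼[m₁] V₁) = direction (A s) →
          (ψ t : TotalSpace 𝔼[m₂] V₂) = direction (B (φ s)) := by
  obtain ⟨A, hA, hFA⟩ := exists_lift_param₁ F hF
  obtain ⟨B, hB, hFB⟩ := exists_lift_param₂ F hF
  refine ⟨A, B, hA, hB, fun s t ht => ?_⟩
  have hs : s.1.2 ≠ 0 := ne_zero_of_mem_sphereBundle s.2
  have hAs : (A s).2 ≠ 0 := fun h => hs (hA.eq_zero_iff.1 h)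
  -- A seam point has coordinates `s` and `φ s`. Comparing the two coordinates of its image shows
  -- that `B (φ s)` is the inversion of `A s`, whose direction is ψ of the direction of `A s`.
  have h1 := Glued.param₁_eq_param₂ φ s.1 hs
  rw [inversion_sphere] at h1
  have h2 := congrArg F h1
  rw [hFA, hFB, Glued.param₁_eq_param₂ ψ _ hAs] at h2
  have h3 : inversion ψ (A s) hAs = B (φ s) := (Glued.isOpenEmbedding_param₂ ψ).injective h2
  have h4 : (⟨direction (A s), direction_mem hAs⟩ : sphereBundle m₁ V₁) = t := Subtype.ext ht.symm
  rw [← h3, ← h4]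
  change _ = direction (scale ‖(A s).2‖⁻¹
    (ψ ⟨direction (A s), direction_mem hAs⟩ : TotalSpace 𝔼[m₂] V₂))
  rw [direction_scale (inv_pos.2 (norm_pos_iff.2 hAs)), direction_of_mem (ψ.toEquiv _).2]

variable (d₁ d₂ φ) in
theorem Glued.continuous_height : Continuous (Glued.height φ) :=
  continuous_quot_lift _ (Continuous.sumElim
    (((continuous_norm_bundle (m := m₁) (V := V₁) d₁).comp continuous_subtype_val).sub
      continuous_const)
    (continuous_const.sub
      ((continuous_norm_bundle (m := m₂) (V := V₂) d₂).comp continuous_subtype_val)))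

variable (d₁ d₂ φ) in
/-- There is a radial curve from one zero section to the other. -/
theorem Glued.exists_continuous_height_eq [Nonempty (sphereBundle m₁ V₁)] :
    ∃ c : ℝ → Glued φ, Continuous c ∧ ∀ t ∈ Icc (-1 : ℝ) 1, Glued.height φ (c t) = t := by
  classical
  obtain ⟨s⟩ := ‹Nonempty (sphereBundle m₁ V₁)›
  have h₁ : Continuous fun t : ℝ => Glued.param₁ φ (scale (1 + t) s) :=
    (Glued.isOpenEmbedding_param₁ φ).continuous.comp
      (show ContMDiff 𝓘(ℝ, ℝ) 𝓑[d₁, m₁] ∞ (fun t : ℝ => scale (1 + t) s.1) from fun t =>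
        contMDiffAt_scale (contMDiffAt_const.add contMDiffAt_id) contMDiffAt_const).continuous
  have h₂ : Continuous fun t : ℝ => Glued.param₂ φ (scale (1 - t) (φ s)) :=
    (Glued.isOpenEmbedding_param₂ φ).continuous.comp
      (show ContMDiff 𝓘(ℝ, ℝ) 𝓑[d₂, m₂] ∞ (fun t : ℝ => scale (1 - t) (φ s).1) from fun t =>
        contMDiffAt_scale (contMDiffAt_const.sub contMDiffAt_id) contMDiffAt_const).continuous
  refine ⟨fun t => if t ≤ 0 then Glued.param₁ φ (scale (1 + t) s)
    else Glued.param₂ φ (scale (1 - t) (φ s)),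
    h₁.if_le h₂ continuous_id continuous_const fun t ht => ?_, fun t ht => ?_⟩
  · have hs : s.1.2 ≠ 0 := ne_zero_of_mem_sphereBundle s.2
    rw [show t = 0 from ht, add_zero, sub_zero, scale_one, scale_one,
      Glued.param₁_eq_param₂ φ s.1 hs, inversion_sphere]
  · simp only
    split_ifs with h
    · rw [Glued.height_param₁, norm_scale_sphere s.2 (by linarith [ht.1]), if_pos (by linarith)]
      ring
    · rw [Glued.height_param₂, norm_scale_sphere (φ s).2 (by linarith [ht.2]),
        if_pos (by linarith)]
      ring

/-- The image of a full level set is again a full level set, so by injectivity of `F` points of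
different levels cannot end up on the same one. -/
theorem height_eq_iff_of_leaves {F : Glued φ ≃ Glued ψ} (hF : ∀ L ∈ leaves φ, F '' L ∈ leaves ψ)
    {g g' : Glued φ} : Glued.height ψ (F g) = Glued.height ψ (F g') ↔
      Glued.height φ g = Glued.height φ g' := by
  obtain ⟨c, -, hc⟩ := (mem_leaves_iff ψ).1 (hF {x | Glued.height φ x = Glued.height φ g}
    ((mem_leaves_iff φ).2 ⟨_, Glued.height_mem_Icc φ g, rfl⟩))
  have h1 : ∀ x, Glued.height φ x = Glued.height φ g ↔ Glued.height ψ (F x) = c := fun x => by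
    have h2 : F x ∈ F '' {x | Glued.height φ x = Glued.height φ g} ↔ F x ∈ _ :=
      iff_of_eq (congrArg (F x ∈ ·) hc)
    rwa [F.injective.mem_set_image] at h2
  rw [(h1 g).1 rfl, eq_comm, ← h1 g', eq_comm]

/-- A foliated diffeomorphism either preserves or exchanges the zero sections. -/
theorem respectsHeight_or_exchanges [Nonempty (sphereBundle m₁ V₁)]
    (F : Glued φ ≃ₘ^∞⟮𝓡 n, 𝓡 n⟯ Glued ψ) (hF : ∀ L ∈ leaves φ, F '' L ∈ leaves ψ) :
    RespectsHeight (Glued.height φ) (Glued.height ψ) F ∨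
      RespectsHeight (Glued.height φ) (Glued.height ψ.symm)
        (F.trans (Glued.swapDiffeomorph n ψ).symm) := by
  have hiff : ∀ {g g'}, Glued.height ψ (F g) = Glued.height ψ (F g') ↔
      Glued.height φ g = Glued.height φ g' := height_eq_iff_of_leaves (F := F.toEquiv) hF
  obtain ⟨c, hc, hct⟩ := Glued.exists_continuous_height_eq d₁ d₂ φ
  obtain ⟨c', -, hct'⟩ := Glued.exists_continuous_height_eq d₁ d₂ ψ
  -- The map induced on heights, made continuous by the curve `c` across the leaves. It is a
  -- continuous bijection of [-1, 1], hence strictly monotone, and fixes or exchanges the ends.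
  set α : ℝ → ℝ := fun t => Glued.height ψ (F (c t))
  have hα : ∀ g, Glued.height ψ (F g) = α (Glued.height φ g) := fun g =>
    hiff.2 (hct _ (Glued.height_mem_Icc φ g)).symm
  have hcont : Continuous α := (Glued.continuous_height d₁ d₂ ψ).comp (F.continuous.comp hc)
  have hinj : InjOn α (Icc (-1) 1) := fun t ht t' ht' h => by
    have h1 := hiff.1 h
    rwa [hct t ht, hct t' ht'] at h1
  have hmaps : ∀ t, α t ∈ Icc (-1 : ℝ) 1 := fun t => Glued.height_mem_Icc ψ _
  have hsurj : ∀ u ∈ Icc (-1 : ℝ) 1, ∃ t ∈ Icc (-1 : ℝ) 1, α t = u := fun u hu => by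
    refine ⟨_, Glued.height_mem_Icc φ (F.symm (c' u)), ?_⟩
    rw [← hα, F.apply_symm_apply, hct' u hu]
  have hl : (-1 : ℝ) ∈ Icc (-1 : ℝ) 1 := ⟨le_rfl, by norm_num⟩
  have hr : (1 : ℝ) ∈ Icc (-1 : ℝ) 1 := ⟨by norm_num, le_rfl⟩
  obtain ⟨t₀, ht₀, hαt₀⟩ := hsurj _ hl
  obtain ⟨t₁, ht₁, hαt₁⟩ := hsurj _ hr
  have hval : ∀ {t u}, t ∈ Icc (-1 : ℝ) 1 → α t = u →
      ∀ g, Glued.height ψ (F g) = u ↔ Glued.height φ g = t := fun {t u} ht hu g => by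
    rw [hα, ← hu]
    exact hinj.eq_iff (Glued.height_mem_Icc φ g) ht
  rcases hcont.continuousOn.strictMonoOn_of_injOn_Icc' (by norm_num) hinj with hm | hm
  · left
    have h0 : α (-1) = -1 := le_antisymm
      ((hm.monotoneOn hl ht₀ ht₀.1).trans hαt₀.le) (hmaps _).1
    have h1 : α 1 = 1 := le_antisymm (hmaps _).2 (hαt₁.ge.trans (hm.monotoneOn ht₁ hr ht₁.2))
    exact ⟨hiff, fun {g} => hval hl h0 g, fun {g} => hval hr h1 g⟩
  · right
    have h0 : α (-1) = 1 := le_antisymm (hmaps _).2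
      (hαt₁.ge.trans (hm.antitoneOn hl ht₁ ht₁.1))
    have h1 : α 1 = -1 := le_antisymm ((hm.antitoneOn ht₀ hr ht₀.2).trans hαt₀.le) (hmaps _).1
    have hs : ∀ g, Glued.height ψ.symm ((F.trans (Glued.swapDiffeomorph n ψ).symm) g) =
        -Glued.height ψ (F g) := fun g => by
      have h2 := Glued.height_swapDiffeomorph n ψ ((Glued.swapDiffeomorph n ψ).symm (F g))
      rw [(Glued.swapDiffeomorph n ψ).apply_symm_apply] at h2
      rw [h2, neg_neg]
      rfl
    exact ⟨fun {g g'} => by rw [hs, hs, neg_inj, hiff],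
      fun {g} => by rw [hs, neg_inj]; exact hval hl h0 g,
      fun {g} => by rw [hs, neg_eq_iff_eq_neg]; exact hval hr h1 g⟩

end FoliatedDiffeomorphisms

/-! ### Statement (2): gluing two copies of one disk bundle -/

section GluingByExtendable

variable {d m : ℕ} {M : Type*} [TopologicalSpace M] [ChartedSpace 𝔼[d] M] [IsManifold (𝓡 d) ∞ M]
  {V : M → Type*} [∀ x, NormedAddCommGroup (V x)] [∀ x, InnerProductSpace ℝ (V x)]
  [TopologicalSpace (TotalSpace 𝔼[m] V)] [FiberBundle 𝔼[m] V] [VectorBundle ℝ 𝔼[m] V]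
  [ContMDiffVectorBundle ∞ 𝔼[m] V (𝓡 d)] [IsContMDiffRiemannianBundle (𝓡 d) ∞ 𝔼[m] V]
  {n : ℕ} [Fact (d + m = n)]

theorem nonempty_diffeomorph_of_extendable (φ₀ φ₁ : extendableDiffeos d m V) :
    Nonempty (Glued φ₀.1 ≃ₘ^∞⟮𝓡 n, 𝓡 n⟯ Glued φ₁.1) := by
  obtain ⟨W, hW⟩ := exists_diffeomorph_of_mem_extendableDiffeos
    (comp_mem_extendableDiffeos φ₁.2 (symm_mem_extendableDiffeos φ₀.2))
  obtain ⟨F, -⟩ := Glued.exists_diffeomorph (n := n) (φ := φ₀.1) (ψ := φ₁.1) W hW fun s =>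
    (congrArg φ₁.1.toEquiv (φ₀.1.toEquiv.symm_apply_apply s)).symm
  exact ⟨F⟩

/-- With `f` and `g` the directions of the two lifts, the seam gives φ₁ ∘ f = g ∘ φ₀ if the zero
sections are preserved. If they are exchanged, it gives φ₁⁻¹ ∘ f = g ∘ φ₀, that is φ₁ ∘ (g ∘ φ₀) =
f; here E₊ = E₋ is essential. -/
theorem mk_mem_range_of_foliatedEquivalent [T2Space M] [Nonempty (sphereBundle m V)]
    {φ₀ φ₁ : extendableDiffeos d m V}
    (h₀ : PiZero.mk φ₀ ∈ range (piZeroInclusion d m V)) (h : FoliatedEquivalent n φ₀.1 φ₁.1) :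
    PiZero.mk φ₁ ∈ range (piZeroInclusion d m V) := by
  have hφ₀ := isotopicToIsometry_of_mk_mem_range h₀
  obtain ⟨F, hF⟩ := h
  rcases respectsHeight_or_exchanges F hF with h | h
  · obtain ⟨A, B, hA, hB, hAB⟩ := exists_conjugation F h
    obtain ⟨f, hf, hfA⟩ := exists_isotopicToIsometry A hA
    obtain ⟨g, hg, hgB⟩ := exists_isotopicToIsometry B hB
    refine hf.mk_mem_range (hg.comp hφ₀) fun s => Subtype.ext ?_
    exact (hAB s (f.1 s) (hfA s)).trans (hgB (φ₀.1 s)).symm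
  · obtain ⟨A, B, hA, hB, hAB⟩ := exists_conjugation _ h
    obtain ⟨f, hf, hfA⟩ := exists_isotopicToIsometry A hA
    obtain ⟨g, hg, hgB⟩ := exists_isotopicToIsometry B hB
    refine (hg.comp hφ₀).mk_mem_range hf fun s => ?_
    have h1 : φ₁.1.symm (f.1 s) = g.1 (φ₀.1 s) :=
      Subtype.ext ((hAB s (f.1 s) (hfA s)).trans (hgB (φ₀.1 s)).symm)
    exact (φ₁.1.toEquiv.symm_apply_eq.1 h1).symm

end GluingByExtendable

end

/-! ### The theorem -/

theorem theorem2p5 {n d₁ m₁ d₂ m₂ : ℕ} [Fact (d₁ + m₁ = n)] [Fact (d₂ + m₂ = n)]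
    (_hm₁ : 1 ≤ m₁) (_hm₂ : 1 ≤ m₂)
    {M₁ : Type*} [TopologicalSpace M₁] [T2Space M₁] [SecondCountableTopology M₁]
    [ConnectedSpace M₁] [ChartedSpace 𝔼[d₁] M₁] [IsManifold (𝓡 d₁) ∞ M₁]
    {V₁ : M₁ → Type*} [∀ x, NormedAddCommGroup (V₁ x)] [∀ x, InnerProductSpace ℝ (V₁ x)]
    [TopologicalSpace (TotalSpace 𝔼[m₁] V₁)] [FiberBundle 𝔼[m₁] V₁] [VectorBundle ℝ 𝔼[m₁] V₁]
    [ContMDiffVectorBundle ∞ 𝔼[m₁] V₁ (𝓡 d₁)] [IsContMDiffRiemannianBundle (𝓡 d₁) ∞ 𝔼[m₁] V₁]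
    {M₂ : Type*} [TopologicalSpace M₂] [T2Space M₂] [SecondCountableTopology M₂]
    [ConnectedSpace M₂] [ChartedSpace 𝔼[d₂] M₂] [IsManifold (𝓡 d₂) ∞ M₂]
    {V₂ : M₂ → Type*} [∀ x, NormedAddCommGroup (V₂ x)] [∀ x, InnerProductSpace ℝ (V₂ x)]
    [TopologicalSpace (TotalSpace 𝔼[m₂] V₂)] [FiberBundle 𝔼[m₂] V₂] [VectorBundle ℝ 𝔼[m₂] V₂]
    [ContMDiffVectorBundle ∞ 𝔼[m₂] V₂ (𝓡 d₂)] [IsContMDiffRiemannianBundle (𝓡 d₂) ∞ 𝔼[m₂] V₂] :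
    (∀ φ₀ : SetDiffeo 𝓑[d₁, m₁] 𝓑[d₂, m₂] (sphereBundle m₁ V₁) (sphereBundle m₂ V₂),
      (∃ hp ∈ extendableDiffeos d₁ m₁ V₁, ∃ hm ∈ extendableDiffeos d₂ m₂ V₂,
        ¬ FoliatedEquivalent n ((hm.comp φ₀).comp hp.symm) φ₀) →
      PiZeroStrict d₁ m₁ V₁ ∨ PiZeroStrict d₂ m₂ V₂) ∧
    (PiZeroStrict d₁ m₁ V₁ →
      ∀ φ₀ φ₁ : extendableDiffeos d₁ m₁ V₁,
        PiZero.mk φ₀ ∈ range (piZeroInclusion d₁ m₁ V₁) →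
        PiZero.mk φ₁ ∉ range (piZeroInclusion d₁ m₁ V₁) →
        Nonempty (Glued φ₀.1 ≃ₘ^∞⟮𝓡 n, 𝓡 n⟯ Glued φ₁.1) ∧
          ¬ FoliatedEquivalent n φ₀.1 φ₁.1) := by
  refine ⟨fun φ₀ ⟨hp, hhp, hm, hhm, hne⟩ => ?_, fun _ φ₀ φ₁ h₀ h₁ =>
    ⟨nonempty_diffeomorph_of_extendable φ₀ φ₁, fun h => ?_⟩⟩
  · by_contra! hs
    simp only [PiZeroStrict, not_not] at hs
    exact hne (heightEquivalent_of_surjective hs.1 hs.2 hhp hhm φ₀).symm.foliatedEquivalent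
  · have : Nonempty (sphereBundle m₁ V₁) := nonempty_sphereBundle _hm₁
    exact h₁ (mk_mem_range_of_foliatedEquivalent h₀ h)
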